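/- Let $\Omega\subset\mathbb R^3$ be a bounded Lipschitz polyhedron with boundary $\Gamma$ and unit outward normal $\nu$, and let $\Gamma$ be divided into triangular faces, any two of which are disjoint or share exactly a vertex or an edge. Let $\beta\ge 1$. *Graded meshes.* For an integer $N\ge1$ put $h=1/N$, and let $\Delta_h^\beta$ be the following mesh on $\Gamma$. The three parallels to the sides of a face $F$ through its centroid cut $F$ into three parallelograms and three triangles. Each parallelogram is the affine image of $\hat Q=(0,1)^2$, with $(0,0)$ mapped to a vertex of $F$; each triangle is the affine image of $\hat T=\{0<x_1<1,\ 0<x_2<x_1\}$, with $(1,1)$ mapped to the centroid of $F$ and the edge $x_2=0$ mapped into an edge of $F$ (in either direction, the same for the two faces at that edge). The elements $K$ of $\Delta_h^\beta$ are the images of the cells into which the lines $x_1=(i/N)^\beta$, $x_2=(j/N)^\beta$ $(0\le i,j\le N)$ divide $\hat Q$ and $\hat T$. *Spaces.* $\mathbf X_h$ is the space of the tangential fields on $\Gamma$ whose surface divergence is in $L^2(\Gamma)$ and whose restriction to each element $K$ lies in the lowest-order Raviart-Thomas space of $K$ (the Piola image of $\{(a+cx_1,\,b+dx_2)\}$ on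 $\hat Q$ or of $\{(a,b)+c\,(x_1,x_2)\}$ on $\hat T$). $\mathbf H^{1/2}_\perp(\Gamma)$ is the space of the rotated tangential traces $\mathbf v\times\nu$, $\mathbf v\in H^{1/2}(\Gamma)^3$, with the quotient norm $\|\mathbf u\|_{\mathbf H^{1/2}_\perp(\Gamma)}=\inf\{\|\mathbf v\|_{H^{1/2}(\Gamma)}:\mathbf v\times\nu=\mathbf u\}$, where $\|\mathbf v\|^2_{H^{1/2}(\Gamma)}=\int_\Gamma|\mathbf v|^2+\int_\Gamma\int_\Gamma|\mathbf v(x)-\mathbf v(y)|^2\,|x-y|^{-3}\,dS_x\,dS_y$. *Interpolation.* For $\mathbf u\in\mathbf H^{1/2}_\perp(\Gamma)$ with $\operatorname{div}_\Gamma\mathbf u\in L^2(\Gamma)$, the Raviart-Thomas interpolant $\Pi_{\rm RT}\mathbf u$ is, on each element $K$, the field in the lowest-order Raviart-Thomas space of $K$ with the same fluxes through the edges $e$ of $K$ as $\mathbf u$. The flux of $\mathbf u$ through $e$ is $\int_K(\mathbf u\cdot\nabla\varphi+\varphi\operatorname{div}_\Gamma\mathbf u)$ for a function $\varphi\in\bigcap_{p<2}W^{1,p}(K)$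 with $\varphi=1$ on $e$ and $\varphi=0$ on $\partial K\setminus e$. **Lemma.** There is a constant $C>0$ that depends only on $\Gamma$ (with its division into triangular faces) and on $\beta$, such that for every $N\ge1$, with $h=1/N$, every mesh $\Delta_h^\beta$ as above and every real or complex field $\mathbf u\in\mathbf H^{1/2}_\perp(\Gamma)$ with $\operatorname{div}_\Gamma\mathbf u\in\operatorname{div}_\Gamma\mathbf X_h$, $$\|\mathbf u-\Pi_{\rm RT}\mathbf u\|_{L^2(\Gamma)}\le C\,h^{1-\beta/2}\,\|\mathbf u\|_{\mathbf H^{1/2}_\perp(\Gamma)}.$$ -/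

import Mathlib

open MeasureTheory Set
open scoped ContDiff

noncomputable section

namespace GradedRT

/-! ### Vectors in three-space -/

/-- Euclidean three-space. -/
abbrev E3 : Type := EuclideanSpace ℝ (Fin 3)

/-- Values of (real or complex) vector fields. -/
abbrev V (𝕜 : Type*) : Type _ := EuclideanSpace 𝕜 (Fin 3)

/-- The vector product. -/
def cross {R : Type*} [CommRing R] (x y : EuclideanSpace R (Fin 3)) : EuclideanSpace R (Fin 3) :=
  WithLp.toLp 2 (crossProduct x.ofLp y.ofLp)

/-- A real vector regarded as a vector over `𝕜`. -/
def toV (𝕜 : Type*) [RCLike 𝕜] (a : E3) : V 𝕜 := WithLp.toLp 2 fun k => (a k : 𝕜)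

/-- The bilinear product `v · a` of a `𝕜`-vector with a real vector. -/
def bdot {𝕜 : Type*} [RCLike 𝕜] (v : V 𝕜) (a : E3) : 𝕜 := ∑ k, v k * (a k : 𝕜)

/-! ### Reference elements and affine patches -/

/-- The two kinds of elements. -/
inductive Shape
  | square
  | triangle

/-- The unit square `(0,1)²` and the unit triangle `{0 < x₁ < 1, 0 < x₂ < x₁}`. -/
def Shape.dom : Shape → Set (ℝ × ℝ)
  | .square => {x | 0 < x.1 ∧ x.1 < 1 ∧ 0 < x.2 ∧ x.2 < 1}
  | .triangle => {x | 0 < x.1 ∧ x.1 < 1 ∧ 0 < x.2 ∧ x.2 < x.1}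

/-- A flat piece of surface: the image of a reference element under
`(x₁, x₂) ↦ p + x₁ a + x₂ b`. -/
structure Patch where
  shape : Shape
  p : E3
  a : E3
  b : E3

namespace Patch

variable (K : Patch)

/-- The affine parametrisation, on the whole plane. -/
def map (x : ℝ × ℝ) : E3 := K.p + x.1 • K.a + x.2 • K.b

/-- The (open) element. -/
def carrier : Set E3 := K.map '' K.shape.dom

/-- The non-normalised normal `a × b`. -/
def nrm : E3 := cross K.a K.b

/-- The Jacobian of the parametrisation. -/
def jac : ℝ := ‖K.nrm‖

/-- The vector `a*` of the plane of the patch with `a* · a = 1` and `a* · b = 0`. -/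
def dualA : E3 := (K.jac ^ 2)⁻¹ • cross K.b K.nrm

/-- The vector `b*` of the plane of the patch with `b* · a = 0` and `b* · b = 1`. -/
def dualB : E3 := (K.jac ^ 2)⁻¹ • cross K.nrm K.a

/-- The inverse of the parametrisation. -/
def coord (y : E3) : ℝ × ℝ := (inner ℝ K.dualA (y - K.p), inner ℝ K.dualB (y - K.p))

theorem coord_map (h : K.jac ≠ 0) (x : ℝ × ℝ) : K.coord (K.map x) = x := by
  have hJ : K.jac ^ 2 = (K.nrm 0) ^ 2 + (K.nrm 1) ^ 2 + (K.nrm 2) ^ 2 := by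
    rw [jac, EuclideanSpace.norm_sq_eq]
    simp [Fin.sum_univ_three]
  have h2 : K.jac ^ 2 ≠ 0 := pow_ne_zero 2 h
  have h0 : K.nrm 0 = K.a 1 * K.b 2 - K.a 2 * K.b 1 := by simp [nrm, cross, cross_apply]
  have h1 : K.nrm 1 = K.a 2 * K.b 0 - K.a 0 * K.b 2 := by simp [nrm, cross, cross_apply]
  have h3 : K.nrm 2 = K.a 0 * K.b 1 - K.a 1 * K.b 0 := by simp [nrm, cross, cross_apply]
  have e : K.map x - K.p = x.1 • K.a + x.2 • K.b := by rw [map]; abel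
  refine Prod.ext ?_ ?_
  · simp only [coord, e, dualA, inner_smul_left, PiLp.inner_apply, Fin.sum_univ_three]
    simp only [cross, cross_apply, h0, h1, h3]
    simp
    rw [h0, h1, h3] at hJ
    rw [inv_mul_eq_iff_eq_mul₀ h2, hJ]
    ring
  · simp only [coord, e, dualB, inner_smul_left, PiLp.inner_apply, Fin.sum_univ_three]
    simp only [cross, cross_apply, h0, h1, h3]
    simp
    rw [h0, h1, h3] at hJ
    rw [inv_mul_eq_iff_eq_mul₀ h2, hJ]
    ring

/-- Surface measure on the patch. -/
def surfMeasure : Measure E3 :=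
  ENNReal.ofReal K.jac • (volume.restrict K.shape.dom).map K.map

variable {𝕜 : Type*} [RCLike 𝕜]

/-- The (contravariant) Piola transform of a tangential field to the reference element:
`u ∘ map = jac⁻¹ (û₁ a + û₂ b)`. -/
def pull (u : E3 → V 𝕜) (x : ℝ × ℝ) : 𝕜 × 𝕜 :=
  (K.jac • bdot (u (K.map x)) K.dualA, K.jac • bdot (u (K.map x)) K.dualB)

/-- The inverse Piola transform. -/
def push (w : ℝ × ℝ → 𝕜 × 𝕜) (y : E3) : V 𝕜 :=
  (K.jac⁻¹ : ℝ) • ((w (K.coord y)).1 • toV 𝕜 K.a + (w (K.coord y)).2 • toV 𝕜 K.b)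

end Patch

/-! ### Lowest-order Raviart-Thomas elements on the reference elements -/

/-- The space `RT₀` on a reference element: the fields `(α + γ x₁, β + δ x₂)` on the square, and
those with `γ = δ` on the triangle. -/
def IsRefRT0 {𝕜 : Type*} [RCLike 𝕜] : Shape → (ℝ × ℝ → 𝕜 × 𝕜) → Prop
  | .square, w => ∃ α β γ δ : 𝕜, ∀ x, w x = (α + γ * (x.1 : 𝕜), β + δ * (x.2 : 𝕜))
  | .triangle, w => ∃ α β γ : 𝕜, ∀ x, w x = (α + γ * (x.1 : 𝕜), β + γ * (x.2 : 𝕜))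

/-- Affine functions vanishing on the bottom, right, top and left edge of the unit square and
positive inside. -/
def squareEdge : Fin 4 → ℝ × ℝ → ℝ :=
  ![fun x => x.2, fun x => 1 - x.1, fun x => 1 - x.2, fun x => x.1]

/-- Affine functions vanishing on the bottom, right and oblique edge of the unit triangle and
positive inside. -/
def triangleEdge : Fin 3 → ℝ × ℝ → ℝ :=
  ![fun x => x.2, fun x => 1 - x.1, fun x => x.1 - x.2]

/-- A function which is `1` on the edge `e`, `0` on the other edges (vertices excepted), and smooth
away from the vertices. Its gradient is `O(1/r)` at distance `r` from the vertices, so that it lies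
in `W^{1,p}` for every `p < 2` and thus in `H^{1-ε}` for every `ε > 0`. -/
def cutoff {n : ℕ} (d : Fin n → ℝ × ℝ → ℝ) (e : Fin n) (x : ℝ × ℝ) : ℝ :=
  (∏ k ∈ Finset.univ.erase e, d k x) / ∑ l, ∏ k ∈ Finset.univ.erase l, d k x

theorem cutoff_eq_one {n : ℕ} (d : Fin n → ℝ × ℝ → ℝ) (e : Fin n) (x : ℝ × ℝ)
    (h0 : d e x = 0) (h : ∀ k, k ≠ e → d k x ≠ 0) : cutoff d e x = 1 := by
  have hs : ∑ l, ∏ k ∈ Finset.univ.erase l, d k x = ∏ k ∈ Finset.univ.erase e, d k x := by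
    refine Finset.sum_eq_single e (fun l _ hl => ?_) (by simp)
    exact Finset.prod_eq_zero (Finset.mem_erase.2 ⟨hl.symm, Finset.mem_univ e⟩) h0
  rw [cutoff, hs, div_self]
  exact Finset.prod_ne_zero_iff.2 fun k hk => h k (Finset.ne_of_mem_erase hk)

theorem cutoff_eq_zero {n : ℕ} (d : Fin n → ℝ × ℝ → ℝ) (e k : Fin n) (x : ℝ × ℝ)
    (hk : k ≠ e) (h0 : d k x = 0) : cutoff d e x = 0 := by
  rw [cutoff, Finset.prod_eq_zero (Finset.mem_erase.2 ⟨hk, Finset.mem_univ k⟩) h0, zero_div]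

/-- The flux `(u · n, 1)_e` of the field `u` with divergence `f` through the edge `e`, defined by
Green's formula `(u · n, φ)_{∂K} = (u, ∇φ)_K + (f, φ)_K` for `φ` the cutoff of `e`. -/
def edgeFlux {𝕜 : Type*} [RCLike 𝕜] (D : Set (ℝ × ℝ)) {n : ℕ} (d : Fin n → ℝ × ℝ → ℝ)
    (e : Fin n) (u : ℝ × ℝ → 𝕜 × 𝕜) (f : ℝ × ℝ → 𝕜) : 𝕜 :=
  ∫ x in D, (fderiv ℝ (cutoff d e) x (1, 0) • (u x).1 + fderiv ℝ (cutoff d e) x (0, 1) • (u x).2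
    + cutoff d e x • f x)

/-- The `RT₀` field on the unit square with fluxes `q 0, …, q 3` through the bottom, right, top and
left edge. -/
def squareRT {𝕜 : Type*} [RCLike 𝕜] (q : Fin 4 → 𝕜) (x : ℝ × ℝ) : 𝕜 × 𝕜 :=
  (-q 3 + (q 1 + q 3) * (x.1 : 𝕜), -q 0 + (q 2 + q 0) * (x.2 : 𝕜))

/-- The `RT₀` field on the unit triangle with fluxes `q 0, q 1, q 2` through the bottom, right and
oblique edge. -/
def triangleRT {𝕜 : Type*} [RCLike 𝕜] (q : Fin 3 → 𝕜) (x : ℝ × ℝ) : 𝕜 × 𝕜 :=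
  ((-q 0 - q 2) + (q 0 + q 1 + q 2) * (x.1 : 𝕜), -q 0 + (q 0 + q 1 + q 2) * (x.2 : 𝕜))

/-- Raviart-Thomas interpolation on the reference elements of a field `u` with divergence `f`. -/
def refInterp {𝕜 : Type*} [RCLike 𝕜] :
    Shape → (ℝ × ℝ → 𝕜 × 𝕜) → (ℝ × ℝ → 𝕜) → ℝ × ℝ → 𝕜 × 𝕜
  | .square, u, f => squareRT fun e => edgeFlux Shape.square.dom squareEdge e u f
  | .triangle, u, f => triangleRT fun e => edgeFlux Shape.triangle.dom triangleEdge e u f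

theorem squareRT_flux {𝕜 : Type*} [RCLike 𝕜] (q : Fin 4 → 𝕜) (t : ℝ) :
    -(squareRT q (t, 0)).2 = q 0 ∧ (squareRT q (1, t)).1 = q 1 ∧
      (squareRT q (t, 1)).2 = q 2 ∧ -(squareRT q (0, t)).1 = q 3 := by
  simp [squareRT]

theorem triangleRT_flux {𝕜 : Type*} [RCLike 𝕜] (q : Fin 3 → 𝕜) (t : ℝ) :
    -(triangleRT q (t, 0)).2 = q 0 ∧ (triangleRT q (1, t)).1 = q 1 ∧
      -(triangleRT q (t, t)).1 + (triangleRT q (t, t)).2 = q 2 := by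
  refine ⟨by simp [triangleRT], by simp [triangleRT], ?_⟩
  simp only [triangleRT]
  ring

theorem isRefRT0_refInterp {𝕜 : Type*} [RCLike 𝕜] (S : Shape) (u : ℝ × ℝ → 𝕜 × 𝕜)
    (f : ℝ × ℝ → 𝕜) : IsRefRT0 S (refInterp S u f) := by
  cases S
  · exact ⟨_, _, _, _, fun x => rfl⟩
  · exact ⟨_, _, _, fun x => rfl⟩

/-! ### Lipschitz polyhedral surfaces -/

/-- Near each of its boundary points, the open set `Ω` is, in a suitable Cartesian coordinate
system with last axis `e`, the set of points below the graph of a Lipschitz function. -/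
def IsLipschitzDomain (Ω : Set E3) : Prop :=
  IsOpen Ω ∧ ∀ x ∈ frontier Ω, ∃ e : E3, ‖e‖ = 1 ∧ ∃ r > 0, ∃ (L : NNReal) (g : E3 → ℝ),
    LipschitzWith L g ∧ ∀ y ∈ Metric.ball x r,
      (y ∈ Ω ↔ inner ℝ e y < g (y - (inner ℝ e y : ℝ) • e))

/-- The patch given by a triangle with vertices `v 0, v 1, v 2`. -/
def trianglePatch (v : Fin 3 → E3) : Patch := ⟨.triangle, v 0, v 1 - v 0, v 2 - v 1⟩

/-- A bounded Lipschitz polyhedron `Ω` in three-space, with the surface `Γ = ∂Ω` divided into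
triangles `F i` any two of which are disjoint or meet in a common vertex or in a common edge. -/
structure PolyhedralSurface (ι : Type*) where
  /-- the polyhedron -/
  Ω : Set E3
  nonempty : Ω.Nonempty
  bounded : Bornology.IsBounded Ω
  lipschitz : IsLipschitzDomain Ω
  /-- the vertices of the faces -/
  vert : ι → Fin 3 → E3
  indep : ∀ i, AffineIndependent ℝ (vert i)
  frontier_eq : frontier Ω = ⋃ i, convexHull ℝ (range (vert i))
  distinct : ∀ i j, i ≠ j → range (vert i) ≠ range (vert j)
  conforming : ∀ i j, convexHull ℝ (range (vert i)) ∩ convexHull ℝ (range (vert j)) =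
    convexHull ℝ (range (vert i) ∩ range (vert j))
  /-- the unit outward normal on each face -/
  normal : ι → E3
  normal_norm : ∀ i, ‖normal i‖ = 1
  normal_orth : ∀ i k l, inner ℝ (normal i) (vert i k - vert i l) = 0
  normal_outward : ∀ i, ∀ x ∈ (trianglePatch (vert i)).carrier, ∃ ε > 0, ∀ t ∈ Ioo (0 : ℝ) ε,
    x - t • normal i ∈ Ω ∧ x + t • normal i ∉ closure Ω

namespace PolyhedralSurface

variable {ι : Type*} [Fintype ι] (Γ : PolyhedralSurface ι) {𝕜 : Type*} [RCLike 𝕜]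

/-- Surface measure on the face `F i`. -/
def faceMeasure (i : ι) : Measure E3 := (trianglePatch (Γ.vert i)).surfMeasure

/-- Surface measure on `Γ`. -/
def surfMeasure : Measure E3 := ∑ i, Γ.faceMeasure i

/-! ### Trace spaces -/

/-- The norm of `H^{1/2}(Γ)³`: the square root of
`‖v‖²_{L²(Γ)} + ∫_Γ ∫_Γ |v(x) - v(y)|² / |x - y|³`. -/
def halfNorm (v : E3 → V 𝕜) : ENNReal :=
  ((∫⁻ x, ‖v x‖ₑ ^ 2 ∂Γ.surfMeasure) +
    ∫⁻ x, ∫⁻ y, ‖v x - v y‖ₑ ^ 2 / edist x y ^ 3 ∂Γ.surfMeasure ∂Γ.surfMeasure) ^ (1 / 2 : ℝ)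

/-- `u = v × ν` almost everywhere on `Γ`. -/
def IsRotatedTangential (v u : E3 → V 𝕜) : Prop :=
  ∀ i, ∀ᵐ x ∂Γ.faceMeasure i, u x = cross (v x) (toV 𝕜 (Γ.normal i))

/-- The space `H^{1/2}_⊥(Γ)` of the rotated tangential traces `v × ν`, `v ∈ H^{1/2}(Γ)³`, where
`H^{1/2}(Γ)` is the space of the traces on `Γ` of the functions in `H¹(Ω)`. -/
def MemHalfPerp (u : E3 → V 𝕜) : Prop :=
  ∃ v : E3 → V 𝕜, AEStronglyMeasurable v Γ.surfMeasure ∧ Γ.halfNorm v < ⊤ ∧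
    Γ.IsRotatedTangential v u

/-- The (quotient) norm of `H^{1/2}_⊥(Γ)`. -/
def halfPerpNorm (u : E3 → V 𝕜) : ENNReal :=
  ⨅ (v : E3 → V 𝕜) (_ : AEStronglyMeasurable v Γ.surfMeasure ∧ Γ.IsRotatedTangential v u),
    Γ.halfNorm v

/-! ### Surface divergence -/

/-- The surface divergence of a tangential field as a functional on smooth functions:
`⟨div_Γ u, φ⟩ = - ∫_Γ u · ∇_Γ φ` (for tangential `u`, `u · ∇_Γ φ = u · ∇φ`). -/
def divPairing (u : E3 → V 𝕜) (φ : E3 → ℝ) : 𝕜 :=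
  -∫ x, bdot (u x) (gradient φ x) ∂Γ.surfMeasure

/-- `f` is the surface divergence of `u`. -/
def HasDiv (u : E3 → V 𝕜) (f : E3 → 𝕜) : Prop :=
  ∀ φ : E3 → ℝ, ContDiff ℝ ∞ φ → Γ.divPairing u φ = ∫ x, φ x • f x ∂Γ.surfMeasure

open Classical in
/-- The surface divergence of a field for which it is in `L²(Γ)`. -/
def surfDiv (u : E3 → V 𝕜) : E3 → 𝕜 :=
  if h : ∃ f : E3 → 𝕜, MemLp f 2 Γ.surfMeasure ∧ Γ.HasDiv u f then h.choose else 0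

/-! ### Graded meshes -/

/-- For each edge of the triangulation, the endpoint that is next to the image of `(0,0)` in the
triangular block at that edge. -/
abbrev Orientation : Type := {o : Sym2 E3 → E3 // ∀ e, o e ∈ e}

/-- The six blocks of a face with vertices `v 0, v 1, v 2`, cut out by the parallels to its sides
through the centroid: for each `k` the parallelogram at the vertex `v k` (with `(0,0)` mapped to
this vertex) and the triangle at the edge from `v k` to `v (k + 1)` (with `(1,1)` mapped to the
centroid). -/
def block (o : Orientation) (v : Fin 3 → E3) (k : Fin 3) : Shape → Patch
  | .square => ⟨.square, v k, (1 / 3 : ℝ) • (v (k + 1) - v k), (1 / 3 : ℝ) • (v (k + 2) - v k)⟩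
  | .triangle =>
    let P := o.1 s(v k, v (k + 1))
    let R := v k + v (k + 1) - P
    ⟨.triangle, P + (1 / 3 : ℝ) • (R - P), (1 / 3 : ℝ) • (R - P), (1 / 3 : ℝ) • (v (k + 2) - R)⟩

/-- The grid points `(i/N)^β`. -/
def node (β : ℝ) (N i : ℕ) : ℝ := ((i : ℝ) / N) ^ β

/-- The cell of index `(i, j)` in the block `B`: the image of the rectangle
`(x_i, x_{i+1}) × (x_j, x_{j+1})`, or, on the diagonal of a triangular block, of the part of it in
the unit triangle. -/
def cellPatch (β : ℝ) (N : ℕ) (B : Patch) (i j : ℕ) : Patch where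
  shape := match B.shape with
    | .square => .square
    | .triangle => if i = j then .triangle else .square
  p := B.map (node β N i, node β N j)
  a := (node β N (i + 1) - node β N i) • B.a
  b := (node β N (j + 1) - node β N j) • B.b

/-- The indices of the cells of the graded mesh: a cell of a parallelogram block (`Sum.inl`), or a
cell of a triangular block (`Sum.inr`, with `j ≤ i`). -/
abbrev Cell (ι : Type*) (N : ℕ) : Type _ :=
  ι × Fin 3 × ((Fin N × Fin N) ⊕ {c : Fin N × Fin N // c.2 ≤ c.1})

/-- The elements of the graded mesh on `Γ` with grading parameter `β` and `h = 1 / N`. -/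
def element (β : ℝ) (N : ℕ) (o : Orientation) : Cell ι N → Patch
  | (F, k, .inl c) => cellPatch β N (block o (Γ.vert F) k .square) c.1 c.2
  | (F, k, .inr c) => cellPatch β N (block o (Γ.vert F) k .triangle) c.1.1 c.1.2

/-- The boundary element space `X_h`: fields that are elementwise in `RT₀` (in the sense of the
Piola transform) and whose surface divergence on `Γ` is in `L²(Γ)`. -/
def MemXh (β : ℝ) (N : ℕ) (o : Orientation) (w : E3 → V 𝕜) : Prop :=
  (∀ c : Cell ι N, ∃ r : ℝ × ℝ → 𝕜 × 𝕜, IsRefRT0 (Γ.element β N o c).shape r ∧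
    ∀ y ∈ (Γ.element β N o c).carrier, w y = (Γ.element β N o c).push r y) ∧
  ∃ f : E3 → 𝕜, MemLp f 2 Γ.surfMeasure ∧ Γ.HasDiv w f

/-- `div_Γ u ∈ div_Γ X_h`. -/
def HasDiscreteDiv (β : ℝ) (N : ℕ) (o : Orientation) (u : E3 → V 𝕜) : Prop :=
  ∃ w : E3 → V 𝕜, Γ.MemXh β N o w ∧
    ∀ φ : E3 → ℝ, ContDiff ℝ ∞ φ → Γ.divPairing u φ = Γ.divPairing w φ

/-- The Raviart-Thomas interpolant `Π_RT u` on the graded mesh: on each element it is the field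
that corresponds, under the Piola transform, to the interpolant on the reference element (recall
that the divergence of the Piola transform of `u` is `jac` times that of `u`). -/
def rtInterp (β : ℝ) (N : ℕ) (o : Orientation) (u : E3 → V 𝕜) (y : E3) : V 𝕜 :=
  ∑ c : Cell ι N, (Γ.element β N o c).carrier.indicator
    ((Γ.element β N o c).push (refInterp (Γ.element β N o c).shape ((Γ.element β N o c).pull u)
      fun x => (Γ.element β N o c).jac • Γ.surfDiv u ((Γ.element β N o c).map x))) y

end PolyhedralSurface

end GradedRT

end

/-! ### Cauchy–Schwarz, affine substitutions and singular powers in the plane. -/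

noncomputable section

namespace GradedRT

open scoped ENNReal NNReal

/-! ### Inequalities for lower integrals -/

/-! The estimate is local. Let `K` be an element with side lengths comparable to h₁ and h₂, and let
u = v × ν. On `K` the claim is that ∫_K |u − Πu|² is at most a constant times max(h₁,h₂)³/(h₁h₂)
times the Gagliardo double integral of v over K × K. The grading gives side lengths between N^{-β}
and β/N, so this factor is at most β² h^{2−β} (`max_step_le`). The elements are disjoint and cover Γ
up to a null set, so the double integrals over the sets K × K add up to at most the one over Γ × Γ,
and the local bounds can be summed (`lintegral_error_le`). The infimum over v then produces the
quotient norm.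

On one element let U denote the components of the Piola pull-back of u, rescaled by `aniso` so that
U is of the size of u whatever the aspect ratio. Since div u is the divergence of a discrete field,
the pulled-back divergence is a constant f on the element (`exists_elementwise_div`), and testing
with one fixed bump bounds |f| by the L¹ norm of the pulled-back field (`exists_enorm_div_le`).
Interpolation reproduces constants, so the error at x is at most |U(x) − U(y)| plus the interpolant
of U − U(y). Averaging over y leaves only one task: to bound the fluxes of U − U(y), in the mean
over y, by the Gagliardo seminorm.

Two difficulties arise. First, the flux is a pairing with a gradient as large as 1/r at distance r
from the vertices. The Hardy-type inequality `hardy` shows that the weight 1/r, applied to the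
averaged differences of U, is still controlled by the seminorm.

Second, the bounds must not depend on h₁/h₂. The flux through the left edge has to be O(h₂), but its
integrand contains h₁ ∂₂φ, which is too large when h₁ ≫ h₂. The flux depends only on the boundary
values of φ (`greenPairing_eq_zero`), so φ may be replaced by a function supported in x₁ < ε x₂(1 −
x₂), with ε = min(1, h₂/h₁). There ∂₂φ is smaller than the bound for ∂₁φ by the factor ε, and h₁ε ≤
h₂ (`greenPairing_left_eq`, `enorm_greenDensity_leftFun_le`). The price is that U on a thin slab has
to be compared with U on the whole rectangle. Doubling the width of the slab costs a multiple of
√width, and these costs form a geometric series, so not even a logarithm of the aspect ratio is lost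
(`slabOsc_double_le`, `slabOsc_le`, `edgeWeight_hardy`). Symmetries of the square give the other
three edges. Triangular elements occur only on the diagonal of a block, where h₁ = h₂, and there the
original cutoffs suffice.

What remains is geometry: blocks and cells are identified through barycentric coordinates, and test
functions on an element are extended to smooth functions on space that vanish near the rest of the
surface. -/

theorem sq_lintegral_mul_le {α : Type*} [MeasurableSpace α] {μ : Measure α} {f g : α → ℝ≥0∞}
    (hf : AEMeasurable f μ) (hg : AEMeasurable g μ) :
    (∫⁻ x, f x * g x ∂μ) ^ 2 ≤ (∫⁻ x, f x ^ 2 ∂μ) * ∫⁻ x, g x ^ 2 ∂μ := by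
  have h := ENNReal.lintegral_mul_le_Lp_mul_Lq μ Real.HolderConjugate.two_two hf hg
  have h2 := pow_le_pow_left' h 2
  simp only [Pi.mul_apply] at h2
  refine h2.trans (le_of_eq ?_)
  rw [mul_pow, ← ENNReal.rpow_natCast, ← ENNReal.rpow_natCast, ← ENNReal.rpow_mul,
    ← ENNReal.rpow_mul]
  simp

theorem sq_lintegral_le {α : Type*} [MeasurableSpace α] {μ : Measure α} {g : α → ℝ≥0∞}
    (hg : AEMeasurable g μ) : (∫⁻ x, g x ∂μ) ^ 2 ≤ μ univ * ∫⁻ x, g x ^ 2 ∂μ := by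
  simpa using sq_lintegral_mul_le (f := fun _ => 1) aemeasurable_const hg

theorem ENNReal_add_sq_le (a b : ℝ≥0∞) : (a + b) ^ 2 ≤ 2 * (a ^ 2 + b ^ 2) := by
  have h := ENNReal.rpow_add_le_mul_rpow_add_rpow a b (p := 2) (by norm_num)
  have e : (2 : ℝ) - 1 = 1 := by norm_num
  rw [e, ENNReal.rpow_one] at h
  exact_mod_cast h

/-! ### Affine changes of variables in the plane -/

/-- The affine map `x ↦ p + x₁ a + x₂ b` of the plane. -/
def planeMap (p a b : ℝ × ℝ) (x : ℝ × ℝ) : ℝ × ℝ := p + x.1 • a + x.2 • b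

/-- The linear part of `planeMap`. -/
def planeLin (a b : ℝ × ℝ) : ℝ × ℝ →L[ℝ] ℝ × ℝ :=
  LinearMap.toContinuousLinearMap
    (Matrix.toLin (Module.Basis.finTwoProd ℝ) (Module.Basis.finTwoProd ℝ) !![a.1, b.1; a.2, b.2])

theorem planeLin_apply (a b x : ℝ × ℝ) : planeLin a b x = x.1 • a + x.2 • b := by
  ext <;> simp [planeLin, Matrix.toLin_finTwoProd_apply] <;> ring

theorem planeLin_det (a b : ℝ × ℝ) : (planeLin a b).det = a.1 * b.2 - a.2 * b.1 := by
  simp [planeLin, LinearMap.det_toLin, Matrix.det_fin_two_of]; ring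

theorem planeMap_eq (p a b : ℝ × ℝ) : planeMap p a b = fun x => p + planeLin a b x := by
  ext x <;> simp [planeMap, planeLin_apply, add_assoc]

theorem hasFDerivAt_planeMap (p a b x : ℝ × ℝ) :
    HasFDerivAt (planeMap p a b) (planeLin a b) x := by
  rw [planeMap_eq]
  exact (planeLin a b).hasFDerivAt.const_add p

theorem planeMap_injective (p a b : ℝ × ℝ) (h : a.1 * b.2 - a.2 * b.1 ≠ 0) :
    Function.Injective (planeMap p a b) := by
  intro x y hxy
  have h1 := congrArg Prod.fst hxy
  have h2 := congrArg Prod.snd hxy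
  simp [planeMap] at h1 h2
  refine Prod.ext ?_ ?_
  · apply mul_left_cancel₀ h; linear_combination b.2 * h1 - b.1 * h2
  · apply mul_left_cancel₀ h; linear_combination a.1 * h2 - a.2 * h1

theorem lintegral_image_planeMap (p a b : ℝ × ℝ) (h : a.1 * b.2 - a.2 * b.1 ≠ 0) {s : Set (ℝ × ℝ)}
    (hs : MeasurableSet s) (F : ℝ × ℝ → ℝ≥0∞) :
    ∫⁻ x in planeMap p a b '' s, F x =
      ENNReal.ofReal |a.1 * b.2 - a.2 * b.1| * ∫⁻ x in s, F (planeMap p a b x) := by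
  rw [lintegral_image_eq_lintegral_abs_det_fderiv_mul volume hs
    (fun x _ => (hasFDerivAt_planeMap p a b x).hasFDerivWithinAt)
    (planeMap_injective p a b h).injOn, planeLin_det, lintegral_const_mul']
  exact ENNReal.ofReal_ne_top

theorem lintegral_planeMap_le (p a b : ℝ × ℝ) (h : a.1 * b.2 - a.2 * b.1 ≠ 0) {s t : Set (ℝ × ℝ)}
    (hs : MeasurableSet s) (hst : MapsTo (planeMap p a b) s t) (F : ℝ × ℝ → ℝ≥0∞) :
    ∫⁻ x in s, F (planeMap p a b x) ≤
      ENNReal.ofReal |a.1 * b.2 - a.2 * b.1|⁻¹ * ∫⁻ x in t, F x := by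
  have h0 : 0 < |a.1 * b.2 - a.2 * b.1| := abs_pos.2 h
  have e := lintegral_image_planeMap p a b h hs F
  have e2 : ∫⁻ x in s, F (planeMap p a b x) = ENNReal.ofReal |a.1 * b.2 - a.2 * b.1|⁻¹ *
      ∫⁻ x in planeMap p a b '' s, F x := by
    rw [e, ← mul_assoc, ← ENNReal.ofReal_mul (by positivity), inv_mul_cancel₀ h0.ne']
    simp
  rw [e2]
  gcongr
  exact hst.image_subset

/-! ### A Hardy inequality -/

/-- The Gagliardo integrals over `D` for the distance of the images under `s`. -/
def gagliardo {F : Type*} [NormedAddCommGroup F] (D : Set (ℝ × ℝ)) (s : ℝ × ℝ → ℝ × ℝ)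
    (U : ℝ × ℝ → F) : ℝ≥0∞ :=
  ∫⁻ x in D, ∫⁻ y in D, ‖U x - U y‖ₑ ^ 2 / edist (s x) (s y) ^ 3

/-- Off the diagonal one multiplies and divides by the cube of the distance, which injectivity of
`s` keeps nonzero; on the diagonal both sides vanish. -/
theorem sq_enorm_sub_le {F : Type*} [NormedAddCommGroup F] (s : ℝ × ℝ → ℝ × ℝ)
    (U : ℝ × ℝ → F) (x y : ℝ × ℝ) (hs : Function.Injective s) {d : ℝ≥0∞}
    (hd : edist (s x) (s y) ≤ d) :
    ‖U x - U y‖ₑ ^ 2 ≤ d ^ 3 * (‖U x - U y‖ₑ ^ 2 / edist (s x) (s y) ^ 3) := by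
  rcases eq_or_ne x y with rfl | h
  · simp
  have h0 : edist (s x) (s y) ≠ 0 := by simpa [edist_eq_zero] using fun h' => h (hs h')
  have h1 : edist (s x) (s y) ≠ ⊤ := edist_ne_top _ _
  calc ‖U x - U y‖ₑ ^ 2 = edist (s x) (s y) ^ 3 * (‖U x - U y‖ₑ ^ 2 / edist (s x) (s y) ^ 3) := by
        rw [ENNReal.mul_div_cancel (pow_ne_zero _ h0) (ENNReal.pow_ne_top h1)]
    _ ≤ _ := by gcongr

theorem lintegral_rpow_Ioo : ∫⁻ t in Ioo (-1 : ℝ) 1, ENNReal.ofReal (|t| ^ (-(3 / 4) : ℝ)) ≤ 8 := by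
  have h1 : ∫⁻ t in Ioo (0 : ℝ) 1, ENNReal.ofReal (|t| ^ (-(3 / 4) : ℝ)) = 4 := by
    have hi : IntegrableOn (fun t : ℝ => t ^ (-(3 / 4) : ℝ)) (Ioo 0 1) := by
      rw [← integrableOn_Ioc_iff_integrableOn_Ioo]
      exact (intervalIntegral.intervalIntegrable_rpow' (by norm_num)).1
    have e : ∫⁻ t in Ioo (0 : ℝ) 1, ENNReal.ofReal (|t| ^ (-(3 / 4) : ℝ)) =
        ∫⁻ t in Ioo (0 : ℝ) 1, ENNReal.ofReal (t ^ (-(3 / 4) : ℝ)) :=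
      setLIntegral_congr_fun measurableSet_Ioo fun t ht => by simp [abs_of_pos ht.1]
    rw [e, ← ofReal_integral_eq_lintegral_ofReal hi, ← integral_Ioc_eq_integral_Ioo,
      ← intervalIntegral.integral_of_le zero_le_one, integral_rpow (by norm_num)]
    · norm_num
    · filter_upwards [self_mem_ae_restrict measurableSet_Ioo] with t ht
      exact Real.rpow_nonneg ht.1.le _
  have h2 : ∫⁻ t in Ioo (-1 : ℝ) 0, ENNReal.ofReal (|t| ^ (-(3 / 4) : ℝ)) = 4 := by
    rw [← h1]
    have := (Measure.measurePreserving_neg (volume : Measure ℝ)).setLIntegral_comp_preimage_emb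
      (MeasurableEquiv.neg ℝ).measurableEmbedding
      (fun t : ℝ => ENNReal.ofReal (|t| ^ (-(3 / 4) : ℝ))) (Ioo 0 1)
    rw [← this]
    simp
  have hsub : Ioo (-1 : ℝ) 1 ⊆ (Ioo (-1) 0 ∪ Ioo 0 1) ∪ {0} := by
    intro t ht
    rcases lt_trichotomy t 0 with h | h | h
    · exact Or.inl (Or.inl ⟨ht.1, h⟩)
    · exact Or.inr h
    · exact Or.inl (Or.inr ⟨h, ht.2⟩)
  calc _ ≤ ∫⁻ t in (Ioo (-1 : ℝ) 0 ∪ Ioo 0 1) ∪ {0}, ENNReal.ofReal (|t| ^ (-(3 / 4) : ℝ)) :=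
        lintegral_mono_set hsub
    _ ≤ _ := (lintegral_union_le _ _ _).trans (add_le_add (lintegral_union_le _ _ _) le_rfl)
    _ = 8 := by rw [h1, h2]; simp; norm_num

/-- In the maximum norm both coordinates are bounded by ‖x − z‖, so the power −3/2 of the norm is
dominated by the product of the powers −3/4 of the coordinates. The integral then splits into two
one-dimensional ones, each at most 8. -/
theorem lintegral_norm_rpow_le {z : ℝ × ℝ} {D : Set (ℝ × ℝ)}
    (hD : ∀ x ∈ D, |x.1 - z.1| < 1 ∧ |x.2 - z.2| < 1) :
    ∫⁻ x in D, ENNReal.ofReal (‖x - z‖ ^ (-(3 / 2) : ℝ)) ≤ 64 := by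
  have hmeas : Measurable fun t : ℝ => ENNReal.ofReal (|t| ^ (-(3 / 4) : ℝ)) := by fun_prop
  set f : ℝ → ℝ≥0∞ := fun t => ENNReal.ofReal (|t| ^ (-(3 / 4) : ℝ)) with hf
  have hone : ∀ c : ℝ, ∫⁻ t in Ioo (c - 1) (c + 1), f (t - c) ≤ 8 := by
    intro c
    have := (measurePreserving_sub_right (volume : Measure ℝ) c).setLIntegral_comp_preimage_emb
      (MeasurableEquiv.subRight c).measurableEmbedding f (Ioo (-1) 1)
    have e : (fun x => x - c) ⁻¹' Ioo (-1) 1 = Ioo (c - 1) (c + 1) := by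
      ext t; simp only [mem_preimage, mem_Ioo]; constructor <;> rintro ⟨a, b⟩ <;> constructor <;> linarith
    rw [e] at this
    rw [this]
    exact lintegral_rpow_Ioo
  calc _ ≤ ∫⁻ x in Ioo (z.1 - 1) (z.1 + 1) ×ˢ Ioo (z.2 - 1) (z.2 + 1),
          ENNReal.ofReal (‖x - z‖ ^ (-(3 / 2) : ℝ)) := by
        refine lintegral_mono_set fun x hx => ?_
        have := hD x hx
        simp only [abs_lt] at this
        refine ⟨⟨?_, ?_⟩, ⟨?_, ?_⟩⟩ <;> linarith [this.1.1, this.1.2, this.2.1, this.2.2]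
    _ ≤ ∫⁻ x in Ioo (z.1 - 1) (z.1 + 1) ×ˢ Ioo (z.2 - 1) (z.2 + 1), f (x.1 - z.1) * f (x.2 - z.2) := by
        have hnull : ∀ᵐ x : ℝ × ℝ, x.1 ≠ z.1 ∧ x.2 ≠ z.2 := by
          rw [Measure.volume_eq_prod]
          refine Filter.Eventually.and ?_ ?_
          · exact Measure.quasiMeasurePreserving_fst.ae (p := fun t => t ≠ z.1)
              (Measure.ae_ne volume z.1)
          · exact Measure.quasiMeasurePreserving_snd.ae (p := fun t => t ≠ z.2)
              (Measure.ae_ne volume z.2)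
        refine lintegral_mono_ae (ae_restrict_of_ae ?_)
        filter_upwards [hnull] with x hx
        have h1 : 0 < |x.1 - z.1| := abs_pos.2 (sub_ne_zero.2 hx.1)
        have h2 : 0 < |x.2 - z.2| := abs_pos.2 (sub_ne_zero.2 hx.2)
        simp only [hf]
        rw [← ENNReal.ofReal_mul (by positivity)]
        refine ENNReal.ofReal_le_ofReal ?_
        have hn1 : |x.1 - z.1| ≤ ‖x - z‖ := norm_fst_le (x - z)
        have hn2 : |x.2 - z.2| ≤ ‖x - z‖ := norm_snd_le (x - z)
        have hn : 0 < ‖x - z‖ := h1.trans_le hn1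
        calc ‖x - z‖ ^ (-(3 / 2) : ℝ) = ‖x - z‖ ^ (-(3 / 4) : ℝ) * ‖x - z‖ ^ (-(3 / 4) : ℝ) := by
              rw [← Real.rpow_add hn]; norm_num
          _ ≤ _ := by
              gcongr ?_ * ?_
              · exact Real.rpow_le_rpow_of_nonpos h1 hn1 (by norm_num)
              · exact Real.rpow_le_rpow_of_nonpos h2 hn2 (by norm_num)
    _ = (∫⁻ t in Ioo (z.1 - 1) (z.1 + 1), f (t - z.1)) *
          ∫⁻ t in Ioo (z.2 - 1) (z.2 + 1), f (t - z.2) := by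
        rw [Measure.volume_eq_prod, ← Measure.prod_restrict]
        exact lintegral_prod_mul (f := fun t => f (t - z.1)) (g := fun t => f (t - z.2))
          (by fun_prop) (by fun_prop)
    _ ≤ 8 * 8 := mul_le_mul' (hone _) (hone _)
    _ = 64 := by norm_num

end GradedRT
end

/-! ### A Hardy-type inequality at a point of a star-shaped region. -/

noncomputable section

namespace GradedRT
open scoped ENNReal NNReal

section Hardy

variable {F : Type*} [NormedAddCommGroup F] {U : ℝ × ℝ → F}

theorem measurable_enorm_sub (hU : StronglyMeasurable U) :
    Measurable fun p : (ℝ × ℝ) × (ℝ × ℝ) => ‖U p.1 - U p.2‖ₑ :=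
  ((hU.comp_measurable measurable_fst).sub (hU.comp_measurable measurable_snd)).enorm

theorem measurable_lintegral_enorm_sub (hU : StronglyMeasurable U) (D : Set (ℝ × ℝ)) :
    Measurable fun x => ∫⁻ y in D, ‖U x - U y‖ₑ :=
  (measurable_enorm_sub hU).lintegral_prod_right'

theorem lintegral_sq_enorm_sub_le {D : Set (ℝ × ℝ)} (hD : MeasurableSet D) {s : ℝ × ℝ → ℝ × ℝ}
    (hs : Function.Injective s) {d : ℝ≥0∞} (hd' : d ≠ ⊤)
    (hd : ∀ x ∈ D, ∀ y ∈ D, edist (s x) (s y) ≤ d) :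
    ∫⁻ x in D, ∫⁻ y in D, ‖U x - U y‖ₑ ^ 2 ≤ d ^ 3 * gagliardo D s U := by
  have hd3 : d ^ 3 ≠ ⊤ := ENNReal.pow_ne_top hd'
  rw [gagliardo, ← lintegral_const_mul' _ _ hd3]
  refine setLIntegral_mono' hD fun x hx => ?_
  rw [← lintegral_const_mul' _ _ hd3]
  exact setLIntegral_mono' hD fun y hy => sq_enorm_sub_le s U x y hs (hd x hx y hy)

theorem enorm_sub_le_add (x y z : F) : ‖x - z‖ₑ ≤ ‖x - y‖ₑ + ‖y - z‖ₑ := by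
  simpa using enorm_add_le (x - y) (y - z)

/-- A planar region in a square of side `1` that is star-shaped with respect to the point `z`. -/
structure StarRegion (D : Set (ℝ × ℝ)) (z : ℝ × ℝ) : Prop where
  measurableSet : MeasurableSet D
  volume_le : volume D ≤ 1
  le_volume : 2⁻¹ ≤ volume D
  near : ∀ x ∈ D, |x.1 - z.1| < 1 ∧ |x.2 - z.2| < 1
  diam : ∀ x ∈ D, ∀ y ∈ D, edist x y ≤ 1
  star : ∀ x ∈ D, ∀ σ : ℝ, 0 < σ → σ ≤ 1 → z + σ • (x - z) ∈ D

theorem lintegral_homothety_le {D : Set (ℝ × ℝ)} {z : ℝ × ℝ} (h : StarRegion D z) {σ : ℝ}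
    (h0 : 0 < σ) (h1 : σ ≤ 1) (f : ℝ × ℝ → ℝ≥0∞) :
    ∫⁻ y in D, f (z + σ • (y - z)) ≤ ENNReal.ofReal (σ ^ 2)⁻¹ * ∫⁻ y in D, f y := by
  have e : ∀ y : ℝ × ℝ, planeMap (z - σ • z) (σ, 0) (0, σ) y = z + σ • (y - z) := by
    intro y; ext <;> simp [planeMap] <;> ring
  have := lintegral_planeMap_le (z - σ • z) (σ, 0) (0, σ) (by simp [h0.ne']) h.measurableSet
    (t := D) (fun x hx => by rw [e]; exact h.star x hx σ h0 h1) f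
  simp only [e] at this
  refine this.trans_eq ?_
  congr 3
  simp only [mul_zero, sub_zero]
  rw [abs_of_pos (by positivity)]; ring

/-- Between x and y an intermediate point is inserted that ranges over the homothetic copy of `D`
with centre z and ratio σ = √‖x − z‖. This copy is within 2σ of x, so the part `a` from x to the
copy is bounded by the local Gagliardo integral at x. The part `b` from the copy to the rest of `D`
costs only the Jacobian σ⁻². The square root balances the two: `a`² is O(σ g) and `b`² is O(σ⁻² G).
After splitting ‖x − z‖⁻¹ into the powers −3/4 and −1/4, Cauchy–Schwarz needs nothing but the
integrability of ‖x − z‖^{-3/2}. -/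
theorem hardy {D : Set (ℝ × ℝ)} {z : ℝ × ℝ} (h : StarRegion D z) (hU : StronglyMeasurable U) :
    (∫⁻ x in D, ENNReal.ofReal ‖x - z‖⁻¹ * ∫⁻ y in D, ‖U x - U y‖ₑ) ^ 2 ≤
      36864 * gagliardo D id U := by
  set μ : Measure (ℝ × ℝ) := volume.restrict D with hμ
  have hμ1 : μ univ ≤ 1 := by simpa [hμ] using h.volume_le
  set σ : ℝ × ℝ → ℝ := fun x => √‖x - z‖ with hσ
  set H : ℝ × ℝ → ℝ × ℝ → ℝ × ℝ := fun x y => z + σ x • (y - z) with hH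
  set N : ℝ × ℝ → ℝ × ℝ → ℝ≥0∞ := fun x y => ‖U x - U y‖ₑ with hN
  set g : ℝ × ℝ → ℝ≥0∞ := fun x => ∫⁻ y in D, N x y ^ 2 / edist x y ^ 3 with hg
  set B : ℝ × ℝ → ℝ≥0∞ := fun x => ∫⁻ y, N x y ∂μ with hB
  set a : ℝ × ℝ → ℝ≥0∞ := fun x => ∫⁻ y, N x (H x y) ∂μ with ha
  set b : ℝ × ℝ → ℝ≥0∞ := fun x => ∫⁻ y, B (H x y) ∂μ with hb
  set G := gagliardo D id U with hG
  have hGg : G = ∫⁻ x, g x ∂μ := rfl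
  have hNm : Measurable fun p : (ℝ × ℝ) × (ℝ × ℝ) => N p.1 p.2 := measurable_enorm_sub hU
  have hNx : ∀ x, Measurable (N x) := fun x => hNm.comp measurable_prodMk_left
  have hBm : Measurable B := measurable_lintegral_enorm_sub hU D
  have hHm : Measurable fun p : (ℝ × ℝ) × (ℝ × ℝ) => H p.1 p.2 := by
    have : Continuous fun p : (ℝ × ℝ) × (ℝ × ℝ) => H p.1 p.2 := by
      simp only [hH, hσ]; fun_prop
    exact this.measurable
  have hHx : ∀ x, Measurable (H x) := fun x => hHm.comp measurable_prodMk_left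
  have ham : Measurable a := by
    have : Measurable fun p : (ℝ × ℝ) × (ℝ × ℝ) => N p.1 (H p.1 p.2) :=
      hNm.comp (measurable_fst.prodMk hHm)
    exact this.lintegral_prod_right'
  have hNH : ∀ x, Measurable fun y => N x (H x y) := fun x => (hNx x).comp (hHx x)
  have hBH : ∀ x, Measurable fun y => B (H x y) := fun x => hBm.comp (hHx x)
  have hbm : Measurable b := by
    have : Measurable fun p : (ℝ × ℝ) × (ℝ × ℝ) => B (H p.1 p.2) := hBm.comp hHm
    exact this.lintegral_prod_right'
  have hr1 : ∀ x ∈ D, ‖x - z‖ ≤ 1 := fun x hx =>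
    max_le (h.near x hx).1.le (h.near x hx).2.le
  have hσ1 : ∀ x ∈ D, σ x ≤ 1 := fun x hx => Real.sqrt_le_one.2 (hr1 x hx)
  have hσ2 : ∀ x, σ x ^ 2 = ‖x - z‖ := fun x => Real.sq_sqrt (norm_nonneg _)
  -- pointwise bound
  have hpt : ∀ x, B x ≤ 2 * (a x + b x) := by
    intro x
    -- The factor 2 compensates for averaging over a region whose area is only known to be at least
    -- 1/2.
    have h1 : ∀ y, N x y ≤ 2 * ∫⁻ w, (N x (H x w) + N (H x w) y) ∂μ := by
      intro y
      calc N x y = 2 * (2⁻¹ * N x y) := by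
            rw [← mul_assoc, ENNReal.mul_inv_cancel (by simp) (by simp), one_mul]
        _ ≤ 2 * (∫⁻ _, N x y ∂μ) := by
            gcongr
            rw [lintegral_const, mul_comm]
            gcongr
            simpa [hμ] using h.le_volume
        _ ≤ _ := by
            gcongr with w
            exact enorm_sub_le_add _ _ _
    calc B x ≤ ∫⁻ y, 2 * ∫⁻ w, (N x (H x w) + N (H x w) y) ∂μ ∂μ := lintegral_mono h1
      _ = 2 * ∫⁻ y, ∫⁻ w, (N x (H x w) + N (H x w) y) ∂μ ∂μ := lintegral_const_mul' _ _ (by simp)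
      _ = 2 * ∫⁻ w, ∫⁻ y, (N x (H x w) + N (H x w) y) ∂μ ∂μ := by
          rw [lintegral_lintegral_swap]
          refine Measurable.aemeasurable ?_
          simp only [Function.uncurry_def]
          exact ((hNx x).comp ((hHx x).comp measurable_snd)).add
            (hNm.comp (((hHx x).comp measurable_snd).prodMk measurable_fst))
      _ ≤ 2 * ∫⁻ w, (N x (H x w) + B (H x w)) ∂μ := by
          gcongr with w
          rw [lintegral_add_left measurable_const, lintegral_const]
          gcongr
          exact mul_le_of_le_one_right' hμ1
      _ = 2 * (a x + b x) := by rw [lintegral_add_left (hNH x)]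
  -- bounds for the two parts
  have hpos : ∀ x ∈ D, x ≠ z → 0 < σ x := fun x _ hxz =>
    Real.sqrt_pos.2 (norm_pos_iff.2 (sub_ne_zero.2 hxz))
  -- The distance from x to the copy is at most σ² + σ ≤ 2σ; the cube (2σ)³ against the Jacobian σ⁻²
  -- leaves 8σ.
  have hab : ∀ x ∈ D, x ≠ z → a x ^ 2 ≤ ENNReal.ofReal (8 * σ x) * g x := by
    intro x hx hxz
    have h0 := hpos x hx hxz
    have hdist : ∀ y ∈ D, edist x (H x y) ≤ ENNReal.ofReal (2 * σ x) := by
      intro y hy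
      rw [edist_dist, dist_eq_norm]
      refine ENNReal.ofReal_le_ofReal ?_
      have e : x - H x y = (x - z) - σ x • (y - z) := by simp only [hH]; abel
      rw [e]
      refine (norm_sub_le _ _).trans ?_
      rw [norm_smul, Real.norm_of_nonneg h0.le]
      have h3 := hr1 y hy
      have h4 := hσ1 x hx
      rw [← hσ2 x]
      nlinarith
    calc a x ^ 2 ≤ 1 * ∫⁻ y, N x (H x y) ^ 2 ∂μ :=
          (sq_lintegral_le (hNH x).aemeasurable).trans (by gcongr)
      _ = ∫⁻ y, N x (H x y) ^ 2 ∂μ := one_mul _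
      _ ≤ ∫⁻ y in D, ENNReal.ofReal (2 * σ x) ^ 3 *
            (N x (H x y) ^ 2 / edist x (H x y) ^ 3) :=
          setLIntegral_mono' h.measurableSet fun y hy =>
            sq_enorm_sub_le id U x (H x y) Function.injective_id (hdist y hy)
      _ = ENNReal.ofReal (2 * σ x) ^ 3 *
            ∫⁻ y in D, (N x (H x y) ^ 2 / edist x (H x y) ^ 3) := by
          rw [lintegral_const_mul' _ _ (ENNReal.pow_ne_top ENNReal.ofReal_ne_top)]
      _ ≤ ENNReal.ofReal (2 * σ x) ^ 3 * (ENNReal.ofReal (σ x ^ 2)⁻¹ * g x) := by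
          gcongr
          exact lintegral_homothety_le h h0 (hσ1 x hx) fun y => N x y ^ 2 / edist x y ^ 3
      _ = ENNReal.ofReal (8 * σ x) * g x := by
          rw [← mul_assoc, ← ENNReal.ofReal_pow (by positivity),
            ← ENNReal.ofReal_mul (by positivity)]
          congr 2
          field_simp; norm_num
  have hbb : ∀ x ∈ D, x ≠ z → b x ^ 2 ≤ ENNReal.ofReal (σ x ^ 2)⁻¹ * G := by
    intro x hx hxz
    have h0 := hpos x hx hxz
    calc b x ^ 2 ≤ 1 * ∫⁻ y, B (H x y) ^ 2 ∂μ :=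
          (sq_lintegral_le (hBH x).aemeasurable).trans (by gcongr)
      _ = ∫⁻ y, B (H x y) ^ 2 ∂μ := one_mul _
      _ ≤ ENNReal.ofReal (σ x ^ 2)⁻¹ * ∫⁻ y, B y ^ 2 ∂μ :=
          lintegral_homothety_le h h0 (hσ1 x hx) fun y => B y ^ 2
      _ ≤ ENNReal.ofReal (σ x ^ 2)⁻¹ * G := by
          gcongr
          calc ∫⁻ y, B y ^ 2 ∂μ ≤ ∫⁻ y, ∫⁻ w, N y w ^ 2 ∂μ ∂μ := by
                refine lintegral_mono fun y => ?_
                refine (sq_lintegral_le (hNx y).aemeasurable).trans ?_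
                exact mul_le_of_le_one_left' hμ1
            _ ≤ 1 ^ 3 * G := lintegral_sq_enorm_sub_le h.measurableSet Function.injective_id
                (by simp) h.diam
            _ = G := by simp
  -- The square of the power −3/4 is still integrable in the plane. The square of the power −1/4
  -- cancels the factor σ in `hab` and turns the factor σ⁻² in `hbb` into the power −3/2.
  set w : ℝ × ℝ → ℝ≥0∞ := fun x => ENNReal.ofReal (‖x - z‖ ^ (-(3 / 4) : ℝ)) with hw
  set w' : ℝ × ℝ → ℝ≥0∞ := fun x => ENNReal.ofReal (‖x - z‖ ^ (-(1 / 4) : ℝ)) with hw'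
  have hwm : Measurable w := by fun_prop
  have hwm' : Measurable w' := by fun_prop
  have hww : ∀ x, ENNReal.ofReal ‖x - z‖⁻¹ = w x * w' x := by
    intro x
    simp only [hw, hw']
    rw [← ENNReal.ofReal_mul (by positivity)]
    congr 1
    rcases (norm_nonneg (x - z)).eq_or_lt with h0 | h0
    · rw [← h0]; simp [Real.zero_rpow]
    · rw [← Real.rpow_add h0, ← Real.rpow_neg_one]; norm_num
  have hI : ∫⁻ x in D, ENNReal.ofReal (‖x - z‖ ^ (-(3 / 2) : ℝ)) ≤ 64 :=
    lintegral_norm_rpow_le h.near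
  have hw2 : ∫⁻ x, w x ^ 2 ∂μ ≤ 64 := by
    refine le_trans (le_of_eq (lintegral_congr fun x => ?_)) hI
    simp only [hw]
    rw [← ENNReal.ofReal_pow (by positivity), ← Real.rpow_natCast, ← Real.rpow_mul (norm_nonneg _)]
    norm_num
  have hne : ∀ᵐ x ∂μ, x ∈ D ∧ x ≠ z :=
    (ae_restrict_mem h.measurableSet).and (ae_restrict_of_ae (Measure.ae_ne volume z))
  have hwa : Measurable fun x => w' x * a x := hwm'.mul ham
  have hwb : Measurable fun x => w' x * b x := hwm'.mul hbm
  have hwwa : Measurable fun x => w x * (w' x * a x) := hwm.mul hwa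
  have hA : (∫⁻ x, w x * (w' x * a x) ∂μ) ^ 2 ≤ 512 * G := by
    refine (sq_lintegral_mul_le hwm.aemeasurable hwa.aemeasurable).trans ?_
    calc _ ≤ 64 * ∫⁻ x, 8 * g x ∂μ := by
          refine mul_le_mul' hw2 (lintegral_mono_ae ?_)
          filter_upwards [hne] with x hx
          have h0 : 0 < ‖x - z‖ := norm_pos_iff.2 (sub_ne_zero.2 hx.2)
          rw [mul_pow]
          refine (mul_le_mul_right (hab x hx.1 hx.2) _).trans (le_of_eq ?_)
          rw [← mul_assoc]
          congr 1
          simp only [hw', hσ]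
          rw [← ENNReal.ofReal_pow (by positivity), ← ENNReal.ofReal_mul (by positivity),
            ← Real.rpow_natCast, ← Real.rpow_mul (norm_nonneg _), Real.sqrt_eq_rpow]
          have : ‖x - z‖ ^ (-(1 / 4) * ((2 : ℕ) : ℝ)) * (8 * ‖x - z‖ ^ (1 / 2 : ℝ)) = 8 := by
            rw [mul_left_comm, ← Real.rpow_add h0]; norm_num
          rw [this]; norm_num
      _ = 512 * G := by
          rw [lintegral_const_mul' _ _ (by simp), ← hGg, ← mul_assoc]; norm_num
  have hBd : (∫⁻ x, w x * (w' x * b x) ∂μ) ^ 2 ≤ 4096 * G := by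
    refine (sq_lintegral_mul_le hwm.aemeasurable hwb.aemeasurable).trans ?_
    calc _ ≤ 64 * ∫⁻ x, ENNReal.ofReal (‖x - z‖ ^ (-(3 / 2) : ℝ)) * G ∂μ := by
          refine mul_le_mul' hw2 (lintegral_mono_ae ?_)
          filter_upwards [hne] with x hx
          have h0 : 0 < ‖x - z‖ := norm_pos_iff.2 (sub_ne_zero.2 hx.2)
          rw [mul_pow]
          refine (mul_le_mul_right (hbb x hx.1 hx.2) _).trans (le_of_eq ?_)
          rw [← mul_assoc]
          congr 1
          simp only [hw', hσ2]
          rw [← ENNReal.ofReal_pow (by positivity), ← ENNReal.ofReal_mul (by positivity),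
            ← Real.rpow_natCast, ← Real.rpow_mul (norm_nonneg _), ← Real.rpow_neg_one,
            ← Real.rpow_add h0]
          norm_num
      _ ≤ 64 * (64 * G) := by
          rw [lintegral_mul_const _ (by fun_prop)]
          gcongr
      _ = 4096 * G := by rw [← mul_assoc]; norm_num
  calc _ ≤ (∫⁻ x, 2 * (w x * (w' x * a x) + w x * (w' x * b x)) ∂μ) ^ 2 := by
        refine pow_le_pow_left' (lintegral_mono fun x => ?_) 2
        rw [hww]
        refine (mul_le_mul_right (hpt x) _).trans (le_of_eq ?_)
        ring
    _ = (2 * (∫⁻ x, w x * (w' x * a x) ∂μ + ∫⁻ x, w x * (w' x * b x) ∂μ)) ^ 2 := by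
        rw [lintegral_const_mul' _ _ (by simp),
          lintegral_add_left hwwa]
    -- The constant 4 · 2 · (512 + 4096) = 36864 is 192², which is why 192 appears once square roots
    -- are taken.
    _ ≤ 4 * (2 * (512 * G + 4096 * G)) := by
        rw [mul_pow]
        refine mul_le_mul' (by norm_num) ((ENNReal_add_sq_le _ _).trans ?_)
        gcongr
    _ = 36864 * G := by ring

end Hardy

end GradedRT
end

/-! ### Reference regions, thin slabs, and the weight at a short edge. -/

noncomputable section

namespace GradedRT
open scoped ENNReal NNReal

/-! ### The reference elements as planar regions -/

theorem square_dom_eq : Shape.square.dom = Ioo (0 : ℝ) 1 ×ˢ Ioo (0 : ℝ) 1 := by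
  ext x; simp [Shape.dom, and_assoc]

theorem triangle_dom_eq : Shape.triangle.dom = regionBetween (fun _ => 0) id (Ioo (0 : ℝ) 1) := by
  ext x; simp [Shape.dom, regionBetween, and_assoc]

theorem isOpen_dom (S : Shape) : IsOpen S.dom := by
  have h1 : IsOpen {x : ℝ × ℝ | 0 < x.1} := isOpen_lt continuous_const continuous_fst
  have h2 : IsOpen {x : ℝ × ℝ | x.1 < 1} := isOpen_lt continuous_fst continuous_const
  have h3 : IsOpen {x : ℝ × ℝ | 0 < x.2} := isOpen_lt continuous_const continuous_snd
  cases S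
  · exact h1.inter (h2.inter (h3.inter (isOpen_lt continuous_snd continuous_const)))
  · exact h1.inter (h2.inter (h3.inter (isOpen_lt continuous_snd continuous_fst)))

theorem measurableSet_dom (S : Shape) : MeasurableSet S.dom := (isOpen_dom S).measurableSet

theorem dom_subset_square (S : Shape) : S.dom ⊆ Shape.square.dom := by
  rintro x hx
  cases S
  · exact hx
  · exact ⟨hx.1, hx.2.1, hx.2.2.1, hx.2.2.2.trans hx.2.1⟩

theorem volume_square : volume Shape.square.dom = 1 := by
  rw [square_dom_eq, Measure.volume_eq_prod, Measure.prod_prod]; simp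

theorem volume_triangle : volume Shape.triangle.dom = 2⁻¹ := by
  rw [triangle_dom_eq, Measure.volume_eq_prod, volume_regionBetween_eq_integral]
  · have : ∫ y in Ioo (0 : ℝ) 1, ((id - fun _ => (0 : ℝ)) : ℝ → ℝ) y = 2⁻¹ := by
      rw [← integral_Ioc_eq_integral_Ioo, ← intervalIntegral.integral_of_le zero_le_one]
      simp
    rw [this, ENNReal.ofReal_inv_of_pos (by norm_num)]; simp
  · exact integrableOn_zero
  · exact (continuous_id.integrableOn_Icc (a := (0 : ℝ)) (b := 1)).mono_set Ioo_subset_Icc_self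
  · exact measurableSet_Ioo
  · exact fun x hx => hx.1.le

theorem volume_dom_le (S : Shape) : volume S.dom ≤ 1 :=
  (measure_mono (dom_subset_square S)).trans volume_square.le

theorem le_volume_dom (S : Shape) : 2⁻¹ ≤ volume S.dom := by
  cases S
  · rw [volume_square]; exact ENNReal.inv_le_one.2 one_le_two
  · exact volume_triangle.ge

theorem near_of_mem_square {x z : ℝ × ℝ} (hx : x ∈ Shape.square.dom)
    (hz : 0 ≤ z.1 ∧ z.1 ≤ 1 ∧ 0 ≤ z.2 ∧ z.2 ≤ 1) : |x.1 - z.1| < 1 ∧ |x.2 - z.2| < 1 := by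
  obtain ⟨a, b, c, d⟩ := hx
  obtain ⟨e, f, g, h⟩ := hz
  simp only [abs_lt]
  refine ⟨⟨?_, ?_⟩, ⟨?_, ?_⟩⟩ <;> linarith

theorem edist_le_one_of_mem_square {x y : ℝ × ℝ} (hx : x ∈ Shape.square.dom)
    (hy : y ∈ Shape.square.dom) : edist x y ≤ 1 := by
  have := near_of_mem_square hx ⟨hy.1.le, hy.2.1.le, hy.2.2.1.le, hy.2.2.2.le⟩
  rw [edist_dist, dist_eq_norm]
  refine ENNReal.ofReal_le_one.2 ?_
  exact max_le this.1.le this.2.le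

theorem starRegion_square {z : ℝ × ℝ} (hz : 0 ≤ z.1 ∧ z.1 ≤ 1 ∧ 0 ≤ z.2 ∧ z.2 ≤ 1) :
    StarRegion Shape.square.dom z where
  measurableSet := measurableSet_dom _
  volume_le := volume_dom_le _
  le_volume := le_volume_dom _
  near _ hx := near_of_mem_square hx hz
  diam _ hx _ hy := edist_le_one_of_mem_square hx hy
  star x hx σ h0 h1 := by
    obtain ⟨a, b, c, d⟩ := hx
    obtain ⟨e, f, g, h⟩ := hz
    simp only [Shape.dom, mem_ofPred_eq, Prod.fst_add, Prod.snd_add, Prod.smul_fst, Prod.smul_snd,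
      Prod.fst_sub, Prod.snd_sub, smul_eq_mul]
    refine ⟨?_, ?_, ?_, ?_⟩ <;> nlinarith

theorem starRegion_triangle {z : ℝ × ℝ} (hz : z.1 ≤ 1 ∧ 0 ≤ z.2 ∧ z.2 ≤ z.1) :
    StarRegion Shape.triangle.dom z where
  measurableSet := measurableSet_dom _
  volume_le := volume_dom_le _
  le_volume := le_volume_dom _
  near _ hx := near_of_mem_square (dom_subset_square _ hx)
    ⟨hz.2.1.trans hz.2.2, hz.1, hz.2.1, hz.2.2.trans hz.1⟩
  diam _ hx _ hy := edist_le_one_of_mem_square (dom_subset_square _ hx) (dom_subset_square _ hy)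
  star x hx σ h0 h1 := by
    obtain ⟨a, b, c, d⟩ := hx
    obtain ⟨e, f, g⟩ := hz
    simp only [Shape.dom, mem_ofPred_eq, Prod.fst_add, Prod.snd_add, Prod.smul_fst, Prod.smul_snd,
      Prod.fst_sub, Prod.snd_sub, smul_eq_mul]
    refine ⟨?_, ?_, ?_, ?_⟩ <;> nlinarith

/-! ### Anisotropic Gagliardo integrals -/

/-- The diagonal scaling `(x₁, x₂) ↦ (h₁ x₁, h₂ x₂)`. -/
def scl (h₁ h₂ : ℝ) (x : ℝ × ℝ) : ℝ × ℝ := (h₁ * x.1, h₂ * x.2)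

theorem scl_injective {h₁ h₂ : ℝ} (p₁ : 0 < h₁) (p₂ : 0 < h₂) : Function.Injective (scl h₁ h₂) := by
  intro x y hxy
  simp only [scl, Prod.mk.injEq, mul_eq_mul_left_iff, p₁.ne', p₂.ne', or_false] at hxy
  exact Prod.ext hxy.1 hxy.2

theorem edist_scl_le {h₁ h₂ d : ℝ} (p₁ : 0 < h₁) (p₂ : 0 < h₂) {x y : ℝ × ℝ}
    (e₁ : h₁ * |x.1 - y.1| ≤ d) (e₂ : h₂ * |x.2 - y.2| ≤ d) :
    edist (scl h₁ h₂ x) (scl h₁ h₂ y) ≤ ENNReal.ofReal d := by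
  rw [edist_dist, Prod.dist_eq]
  refine ENNReal.ofReal_le_ofReal (max_le ?_ ?_)
  · simpa [scl, Real.dist_eq, ← mul_sub, abs_mul, abs_of_pos p₁] using e₁
  · simpa [scl, Real.dist_eq, ← mul_sub, abs_mul, abs_of_pos p₂] using e₂

theorem le_ofReal_mul_rpow_half {a X : ℝ≥0∞} {c : ℝ}
    (h : a ^ 2 ≤ ENNReal.ofReal c ^ 2 * X) : a ≤ ENNReal.ofReal c * X ^ (1 / 2 : ℝ) := by
  have h1 := ENNReal.rpow_le_rpow h (by norm_num : (0 : ℝ) ≤ 1 / 2)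
  rw [ENNReal.mul_rpow_of_nonneg _ _ (by norm_num), ← ENNReal.rpow_natCast, ← ENNReal.rpow_natCast,
    ← ENNReal.rpow_mul, ← ENNReal.rpow_mul] at h1
  simpa using h1

section Slab

variable {F : Type*} [NormedAddCommGroup F] {U : ℝ × ℝ → F}

/-- The part `0 < x₁ < ε` of the unit square. -/
def slab (ε : ℝ) : Set (ℝ × ℝ) := Ioo (0 : ℝ) ε ×ˢ Ioo (0 : ℝ) 1

theorem slab_one : slab 1 = Shape.square.dom := square_dom_eq.symm

theorem volume_slab (ε : ℝ) : volume (slab ε) = ENNReal.ofReal ε := by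
  rw [slab, Measure.volume_eq_prod, Measure.prod_prod]; simp

theorem measurableSet_slab (ε : ℝ) : MeasurableSet (slab ε) :=
  measurableSet_Ioo.prod measurableSet_Ioo

theorem slab_subset {ε ε' : ℝ} (h : ε ≤ ε') : slab ε ⊆ slab ε' :=
  prod_mono (Ioo_subset_Ioo_right h) le_rfl

/-- The integral of `‖U x - U y‖` over `x` in the slab of width `ε` and `y` in the square. -/
def slabOsc (U : ℝ × ℝ → F) (ε : ℝ) : ℝ≥0∞ :=
  ∫⁻ x in slab ε, ∫⁻ y in Shape.square.dom, ‖U x - U y‖ₑ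

theorem slabOsc_one_le (hU : StronglyMeasurable U) {h₁ h₂ m : ℝ} (p₁ : 0 < h₁) (p₂ : 0 < h₂)
    (m₁ : h₁ ≤ m) (m₂ : h₂ ≤ m) : slabOsc U 1 ≤
      (ENNReal.ofReal m ^ 3 * gagliardo Shape.square.dom (scl h₁ h₂) U) ^ (1 / 2 : ℝ) := by
  have : slabOsc U 1 ^ 2 ≤ ENNReal.ofReal 1 ^ 2 *
      (ENNReal.ofReal m ^ 3 * gagliardo Shape.square.dom (scl h₁ h₂) U) := by
    rw [slabOsc, slab_one]
    refine (sq_lintegral_le (measurable_lintegral_enorm_sub hU _).aemeasurable).trans ?_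
    simp only [Measure.restrict_apply_univ, volume_square, one_mul, ENNReal.ofReal_one, one_pow]
    refine le_trans (lintegral_mono fun x => ?_) (lintegral_sq_enorm_sub_le
      (measurableSet_dom _) (scl_injective p₁ p₂) ENNReal.ofReal_ne_top fun x hx y hy => ?_)
    · refine (sq_lintegral_le
        ((measurable_enorm_sub hU).comp measurable_prodMk_left).aemeasurable).trans ?_
      simp [volume_square]
    · have := near_of_mem_square hx ⟨hy.1.le, hy.2.1.le, hy.2.2.1.le, hy.2.2.2.le⟩
      refine edist_scl_le p₁ p₂ ?_ ?_
      · nlinarith [abs_nonneg (x.1 - y.1)]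
      · nlinarith [abs_nonneg (x.2 - y.2)]
  simpa using le_ofReal_mul_rpow_half this

/-- An intermediate point z in the slab of width 2ε is inserted and averaged over. Since h₂ ≤ 2εh₁,
all scaled distances inside that slab are at most 2εh₁, and the first part gains the factor
(2ε)^{3/2} from the Gagliardo kernel. Divided by ε, the inequality says that halving the width
raises the mean oscillation by at most 2√ε times the seminorm term. -/
theorem slabOsc_double_le (hU : StronglyMeasurable U) {h₁ h₂ ε : ℝ} (p₁ : 0 < h₁) (p₂ : 0 < h₂)
    (hε : 0 < ε) (hε1 : 2 * ε ≤ 1) (hh : h₂ ≤ 2 * ε * h₁) : slabOsc U ε ≤ 2⁻¹ * slabOsc U (2 * ε) +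
      ENNReal.ofReal (2 * (ε * √ε)) *
      (ENNReal.ofReal h₁ ^ 3 * gagliardo Shape.square.dom (scl h₁ h₂) U) ^ (1 / 2 : ℝ) := by
  set G := gagliardo Shape.square.dom (scl h₁ h₂) U with hG
  set N : ℝ × ℝ → ℝ × ℝ → ℝ≥0∞ := fun x y => ‖U x - U y‖ₑ with hN
  have hNm : Measurable fun p : (ℝ × ℝ) × (ℝ × ℝ) => N p.1 p.2 := measurable_enorm_sub hU
  have hNx : ∀ x, Measurable (N x) := fun x => hNm.comp measurable_prodMk_left
  set B : ℝ × ℝ → ℝ≥0∞ := fun x => ∫⁻ y in Shape.square.dom, N x y with hB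
  have hBm : Measurable B := measurable_lintegral_enorm_sub hU _
  set J := ∫⁻ x in slab ε, ∫⁻ z in slab (2 * ε), N x z with hJ
  set c := ENNReal.ofReal (2 * ε) with hc
  have c0 : c ≠ 0 := by simpa [hc] using hε
  have ct : c ≠ ⊤ := ENNReal.ofReal_ne_top
  have hsub : slab (2 * ε) ⊆ Shape.square.dom := slab_one ▸ slab_subset hε1
  have hsub' : slab ε ⊆ slab (2 * ε) := slab_subset (by linarith)
  have key : c * slabOsc U ε ≤ J + ENNReal.ofReal ε * slabOsc U (2 * ε) := by
    have hpt : ∀ x, c * B x ≤ (∫⁻ z in slab (2 * ε), N x z) + slabOsc U (2 * ε) := by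
      intro x
      calc c * B x = ∫⁻ _ in slab (2 * ε), B x := by
            rw [lintegral_const, Measure.restrict_apply_univ, volume_slab, mul_comm]
        _ ≤ ∫⁻ z in slab (2 * ε), (N x z + B z) := by
            refine lintegral_mono fun z => ?_
            calc B x ≤ ∫⁻ y in Shape.square.dom, (N x z + N z y) :=
                  lintegral_mono fun y => enorm_sub_le_add _ _ _
              _ = N x z + B z := by
                  rw [lintegral_add_left measurable_const, lintegral_const,
                    Measure.restrict_apply_univ, volume_square, mul_one]
        _ = _ := by rw [lintegral_add_left (hNx x)]; rfl
    calc c * slabOsc U ε = ∫⁻ x in slab ε, c * B x := (lintegral_const_mul' _ _ ct).symm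
      _ ≤ ∫⁻ x in slab ε, ((∫⁻ z in slab (2 * ε), N x z) + slabOsc U (2 * ε)) := lintegral_mono hpt
      _ = _ := by
          rw [lintegral_add_right _ measurable_const, lintegral_const, Measure.restrict_apply_univ,
            volume_slab, mul_comm (slabOsc U (2 * ε))]
  have hJ2 : J ^ 2 ≤ ENNReal.ofReal (4 * ε ^ 2 * √ε) ^ 2 * (ENNReal.ofReal h₁ ^ 3 * G) := by
    calc J ^ 2 ≤ ENNReal.ofReal ε * ∫⁻ x in slab ε, (∫⁻ z in slab (2 * ε), N x z) ^ 2 := by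
          refine (sq_lintegral_le (measurable_lintegral_enorm_sub hU _).aemeasurable).trans ?_
          rw [Measure.restrict_apply_univ, volume_slab]
      _ ≤ ENNReal.ofReal ε * ∫⁻ x in slab (2 * ε), c * ∫⁻ z in slab (2 * ε), N x z ^ 2 := by
          gcongr with x
          refine (sq_lintegral_le (hNx x).aemeasurable).trans ?_
          simp [volume_slab, hc]
      _ = ENNReal.ofReal ε * (c * ∫⁻ x in slab (2 * ε), ∫⁻ z in slab (2 * ε), N x z ^ 2) := by
          rw [lintegral_const_mul' _ _ ct]
      _ ≤ ENNReal.ofReal ε * (c * (ENNReal.ofReal (2 * ε * h₁) ^ 3 *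
            gagliardo (slab (2 * ε)) (scl h₁ h₂) U)) := by
          gcongr
          refine lintegral_sq_enorm_sub_le (measurableSet_slab _) (scl_injective p₁ p₂)
            ENNReal.ofReal_ne_top fun x hx y hy => edist_scl_le p₁ p₂ ?_ ?_
          · have : |x.1 - y.1| ≤ 2 * ε := by
              rw [abs_le]; constructor <;> linarith [hx.1.1, hx.1.2, hy.1.1, hy.1.2]
            nlinarith
          · have : |x.2 - y.2| ≤ 1 := by
              rw [abs_le]; constructor <;> linarith [hx.2.1, hx.2.2, hy.2.1, hy.2.2]
            nlinarith
      _ ≤ ENNReal.ofReal ε * (c * (ENNReal.ofReal (2 * ε * h₁) ^ 3 * G)) := by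
          gcongr
          refine (lintegral_mono_set hsub).trans (lintegral_mono fun x => ?_)
          exact lintegral_mono_set hsub
      _ = _ := by
          -- The measures of the two slabs and the cube of the diameter: ε · 2ε · (2ε)³ = 16ε⁵.
          have e : ENNReal.ofReal (4 * ε ^ 2 * √ε) ^ 2 = ENNReal.ofReal ε * c *
              ENNReal.ofReal (2 * ε) ^ 3 := by
            rw [hc, ← ENNReal.ofReal_pow (by positivity), ← ENNReal.ofReal_pow (by positivity),
              ← ENNReal.ofReal_mul hε.le, ← ENNReal.ofReal_mul (by positivity)]
            congr 1
            rw [mul_pow, Real.sq_sqrt hε.le]; ring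
          rw [e, ENNReal.ofReal_mul (p := 2 * ε) (by positivity)]
          ring
  have hJ3 := le_ofReal_mul_rpow_half hJ2
  set R := (ENNReal.ofReal h₁ ^ 3 * G) ^ (1 / 2 : ℝ) with hR
  refine (ENNReal.mul_le_mul_iff_right c0 ct).1 (key.trans ?_)
  rw [mul_add, add_comm]
  refine add_le_add (le_of_eq ?_) (hJ3.trans_eq ?_)
  · rw [← mul_assoc]; congr 1
    rw [hc, ENNReal.ofReal_mul (by norm_num), mul_right_comm, ENNReal.ofReal_ofNat,
      ENNReal.mul_inv_cancel (by simp) (by simp), one_mul]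
  · rw [← mul_assoc]; congr 1
    rw [hc, ← ENNReal.ofReal_mul (by positivity)]; congr 1; ring

/-- The doubling step is iterated until the width exceeds 1/2. The increments √ε, √(2ε), √(4ε), …
grow geometrically and are dominated by the last one, so the mean oscillation over the slab stays
bounded however thin it is. -/
theorem slabOsc_le (hU : StronglyMeasurable U) {h₁ h₂ ε : ℝ} (p₁ : 0 < h₁) (p₂ : 0 < h₂)
    (hε : 0 < ε) (hε1 : ε ≤ 1) (hh : h₂ ≤ ε * h₁) : slabOsc U ε ≤ ENNReal.ofReal (7 * ε) *
      (ENNReal.ofReal h₁ ^ 3 * gagliardo Shape.square.dom (scl h₁ h₂) U) ^ (1 / 2 : ℝ) := by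
  set R := (ENNReal.ofReal h₁ ^ 3 * gagliardo Shape.square.dom (scl h₁ h₂) U) ^ (1 / 2 : ℝ) with hR
  -- The bound is strengthened to ε(7 − 5√ε) so that the induction on the number of doublings
  -- closes: the step needs 5√2 − 2 ≥ 5, and the base case needs the bound to be at least ε · 2 ≥ 1
  -- for ε > 1/2.
  have main : ∀ n : ℕ, ∀ ε : ℝ, (1 / 2) ^ (n + 1) < ε → ε ≤ 1 → h₂ ≤ ε * h₁ →
      slabOsc U ε ≤ ENNReal.ofReal (ε * (7 - 5 * √ε)) * R := by
    intro n
    have base : ∀ ε : ℝ, 1 / 2 < ε → ε ≤ 1 → h₂ ≤ ε * h₁ →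
        slabOsc U ε ≤ ENNReal.ofReal (ε * (7 - 5 * √ε)) * R := by
      intro ε h1 h2 h3
      have h4 : slabOsc U ε ≤ slabOsc U 1 := lintegral_mono_set (slab_subset h2)
      refine (h4.trans (slabOsc_one_le hU p₁ p₂ le_rfl (by nlinarith))).trans ?_
      rw [← hR]
      refine le_mul_of_one_le_left' (ENNReal.one_le_ofReal.2 ?_)
      have : √ε ≤ 1 := Real.sqrt_le_one.2 h2
      nlinarith
    induction n with
    | zero => simpa using base
    | succ n ih =>
      intro ε h1 h2 h3
      rcases lt_or_ge (1 / 2) ε with h | h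
      · exact base ε h h2 h3
      have hε : 0 < ε := lt_trans (by positivity) h1
      have i := ih (2 * ε) (by rw [pow_succ] at h1; linarith) (by linarith) (by nlinarith)
      refine (slabOsc_double_le hU p₁ p₂ hε (by linarith) (by nlinarith)).trans ?_
      rw [← hR]
      calc _ ≤ 2⁻¹ * (ENNReal.ofReal (2 * ε * (7 - 5 * √(2 * ε))) * R) +
            ENNReal.ofReal (2 * (ε * √ε)) * R := by gcongr
        _ = ENNReal.ofReal (ε * (7 - 5 * √(2 * ε)) + 2 * (ε * √ε)) * R := by
            rw [← mul_assoc, ← add_mul]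
            congr 1
            have h5 : √(2 * ε) ≤ 1 := Real.sqrt_le_one.2 (by linarith)
            have e : (2 : ℝ≥0∞)⁻¹ = ENNReal.ofReal 2⁻¹ := by
              rw [ENNReal.ofReal_inv_of_pos (by norm_num)]; simp
            rw [e, ← ENNReal.ofReal_mul (by norm_num), ← ENNReal.ofReal_add]
            · congr 1; ring
            · have : 0 ≤ 7 - 5 * √(2 * ε) := by linarith
              positivity
            · positivity
        _ ≤ _ := by
            gcongr
            rw [Real.sqrt_mul (by norm_num)]
            have h6 : (1.41 : ℝ) ≤ √2 := Real.le_sqrt_of_sq_le (by norm_num)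
            have h7 := Real.sqrt_nonneg ε
            have h8 : 0 ≤ ε * √ε := by positivity
            nlinarith
  obtain ⟨n, hn⟩ := exists_pow_lt_of_lt_one hε (by norm_num : (1 / 2 : ℝ) < 1)
  refine (main n ε (lt_of_le_of_lt ?_ hn) hε1 hh).trans ?_
  · exact pow_le_pow_of_le_one (by norm_num) (by norm_num) (Nat.le_succ n)
  · refine mul_le_mul_left (ENNReal.ofReal_le_ofReal ?_) _
    nlinarith [Real.sqrt_nonneg ε]

/-! ### The weight at the short edge -/

/-- The function `x₁ ↦ x₁ (1 - x₁)`. -/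
def bub (t : ℝ) : ℝ := t * (1 - t)

open Classical in
/-- The weight `1 / (ε d)` on the part `x₁ < ε d` of the square, with `d = x₂ (1 - x₂)`. -/
def edgeWeight (ε : ℝ) (x : ℝ × ℝ) : ℝ≥0∞ :=
  if x.1 < ε * bub x.2 then ENNReal.ofReal (ε * bub x.2)⁻¹ else 0

/-- Where x₁ < x₂(1 − x₂), the maximum-norm distances to the two left corners are exactly x₂ and 1 −
x₂, and 1/(x₂(1 − x₂)) = 1/x₂ + 1/(1 − x₂). -/
theorem edgeWeight_one_le {x : ℝ × ℝ} (hx : x ∈ Shape.square.dom) : edgeWeight 1 x ≤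
    ENNReal.ofReal ‖x - (0, 0)‖⁻¹ + ENNReal.ofReal ‖x - (0, 1)‖⁻¹ := by
  obtain ⟨a, b, c, d⟩ := hx
  rw [edgeWeight]
  split_ifs with h
  · simp only [bub, one_mul] at h ⊢
    have e1 : ‖x - (0, 0)‖ = x.2 := by
      rw [Prod.norm_def]
      simp only [Prod.fst_sub, Prod.snd_sub, sub_zero, Real.norm_eq_abs, abs_of_pos a, abs_of_pos c]
      exact max_eq_right (by nlinarith)
    have e2 : ‖x - (0, 1)‖ = 1 - x.2 := by
      rw [Prod.norm_def]
      simp only [Prod.fst_sub, Prod.snd_sub, sub_zero, Real.norm_eq_abs, abs_of_pos a,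
        abs_sub_comm x.2 1, abs_of_pos (sub_pos.2 d)]
      exact max_eq_right (by nlinarith)
    rw [e1, e2, ← ENNReal.ofReal_add (by positivity) (inv_nonneg.2 (by linarith))]
    refine ENNReal.ofReal_le_ofReal (le_of_eq ?_)
    have : (1 : ℝ) - x.2 ≠ 0 := by linarith
    field_simp; ring
  · exact zero_le

theorem lintegral_norm_inv_le {D : Set (ℝ × ℝ)} {z : ℝ × ℝ} (h : StarRegion D z) :
    ∫⁻ x in D, ENNReal.ofReal ‖x - z‖⁻¹ ≤ 64 := by
  refine le_trans (setLIntegral_mono' h.measurableSet fun x hx => ENNReal.ofReal_le_ofReal ?_)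
    (lintegral_norm_rpow_le h.near)
  have h1 : ‖x - z‖ ≤ 1 := max_le (h.near x hx).1.le (h.near x hx).2.le
  rcases (norm_nonneg (x - z)).eq_or_lt with h0 | h0
  · rw [← h0]; simp [Real.zero_rpow]
  · rw [← Real.rpow_neg_one]
    exact Real.rpow_le_rpow_of_exponent_ge h0 h1 (by norm_num)

theorem measurable_edgeWeight (ε : ℝ) : Measurable (edgeWeight ε) := by
  unfold edgeWeight bub
  exact Measurable.ite (measurableSet_lt (by fun_prop) (by fun_prop)) (by fun_prop) (by fun_prop)

/-- The dilation x₁ ↦ εx₁ maps the square onto the slab that carries the weight and turns the weight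
into the one for ε = 1, which is at most a sum of inverse distances to two corners. `hardy` for the
dilated field controls the differences within the slab; the comparison of the slab with the whole
square is the slab oscillation, bounded uniformly in ε. -/
theorem edgeWeight_hardy (hU : StronglyMeasurable U) {h₁ h₂ : ℝ} (p₁ : 0 < h₁) (p₂ : 0 < h₂) :
    ∫⁻ x in Shape.square.dom, edgeWeight (min 1 (h₂ / h₁)) x *
      ∫⁻ y in Shape.square.dom, ‖U x - U y‖ₑ ≤ 1280 *
      (ENNReal.ofReal (max h₁ h₂) ^ 3 * gagliardo Shape.square.dom (scl h₁ h₂) U) ^ (1 / 2 : ℝ) := by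
  set D := Shape.square.dom with hD
  have hDm : MeasurableSet D := measurableSet_dom _
  set ε := min 1 (h₂ / h₁) with hε
  set m := max h₁ h₂ with hm
  set G := gagliardo D (scl h₁ h₂) U with hG
  set R := (ENNReal.ofReal m ^ 3 * G) ^ (1 / 2 : ℝ) with hR
  have ε0 : 0 < ε := lt_min one_pos (div_pos p₂ p₁)
  have ε1 : ε ≤ 1 := min_le_left _ _
  set E : ℝ × ℝ → ℝ × ℝ := planeMap 0 (ε, 0) (0, 1) with hE
  have hEx : ∀ x, E x = (ε * x.1, x.2) := by intro x; ext <;> simp [hE, planeMap, mul_comm]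
  have hEm : Measurable E := by
    have : E = fun x => (ε * x.1, x.2) := funext hEx
    rw [this]; fun_prop
  have hcv : ∀ f : ℝ × ℝ → ℝ≥0∞, ∫⁻ x in slab ε, f x = ENNReal.ofReal ε * ∫⁻ x in D, f (E x) := by
    intro f
    have := lintegral_image_planeMap 0 (ε, 0) (0, 1) (by simp [ε0.ne']) hDm f
    have e : planeMap 0 (ε, 0) (0, 1) '' D = slab ε := by
      ext y
      constructor
      · rintro ⟨x, hx, rfl⟩
        rw [show planeMap 0 (ε, 0) (0, 1) x = (ε * x.1, x.2) from hEx x]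
        exact ⟨⟨by nlinarith [hx.1], by nlinarith [hx.2.1]⟩, hx.2.2⟩
      · rintro ⟨hy1, hy2⟩
        refine ⟨(ε⁻¹ * y.1, y.2), ⟨by have := hy1.1; positivity, ?_, hy2⟩, ?_⟩
        · have := hy1.2
          rw [inv_mul_lt_iff₀ ε0]; linarith
        · rw [show planeMap 0 (ε, 0) (0, 1) (ε⁻¹ * y.1, y.2) = _ from hEx _]
          ext <;> simp [ε0.ne']
    rw [e] at this
    simpa [abs_of_pos ε0] using this
  have hcv' : ∀ f : ℝ × ℝ → ℝ≥0∞, ∫⁻ x in D, f (E x) = ENNReal.ofReal ε⁻¹ * ∫⁻ x in slab ε, f x := by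
    intro f
    rw [hcv, ← mul_assoc, ← ENNReal.ofReal_mul (by positivity), inv_mul_cancel₀ ε0.ne']; simp
  set N : ℝ × ℝ → ℝ × ℝ → ℝ≥0∞ := fun x y => ‖U x - U y‖ₑ with hN
  have hNm : Measurable fun p : (ℝ × ℝ) × (ℝ × ℝ) => N p.1 p.2 := measurable_enorm_sub hU
  set B : ℝ × ℝ → ℝ≥0∞ := fun x => ∫⁻ y in D, N x y with hB
  have hBm : Measurable B := measurable_lintegral_enorm_sub hU _
  have hBE : Measurable fun z => B (E z) := hBm.comp hEm
  have hsub : slab ε ⊆ D := (slab_subset ε1).trans_eq slab_one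
  -- scaling of the Gagliardo integral
  have hV : StronglyMeasurable (U ∘ E) := hU.comp_measurable hEm
  have hεh : ε * h₁ ≤ h₂ := by
    have : ε ≤ h₂ / h₁ := min_le_right _ _
    rwa [le_div_iff₀ p₁] at this
  -- For ε = 1 the left side is h₂³, for ε = h₂/h₁ it is h₂h₁²; both are at most m³.
  have hcase : ENNReal.ofReal h₂ ^ 3 * ENNReal.ofReal ε⁻¹ ^ 2 ≤ ENNReal.ofReal m ^ 3 := by
    rw [← ENNReal.ofReal_pow p₂.le, ← ENNReal.ofReal_pow (by positivity),
      ← ENNReal.ofReal_pow (by positivity), ← ENNReal.ofReal_mul (by positivity)]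
    refine ENNReal.ofReal_le_ofReal ?_
    rcases le_total 1 (h₂ / h₁) with h | h
    · rw [hε, min_eq_left h, inv_one, one_pow, mul_one]
      exact pow_le_pow_left₀ p₂.le (le_max_right _ _) 3
    · rw [hε, min_eq_right h, inv_div]
      have : h₂ ^ 3 * (h₁ / h₂) ^ 2 = h₂ * h₁ ^ 2 := by field_simp
      rw [this, pow_succ' m]
      have h3 : h₂ ≤ m := le_max_right _ _
      have h4 : h₁ ≤ m := le_max_left _ _
      gcongr
  have hGV : gagliardo D id (U ∘ E) ≤ ENNReal.ofReal m ^ 3 * G := by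
    have hpt : ∀ x y, ‖(U ∘ E) x - (U ∘ E) y‖ₑ ^ 2 / edist (id x) (id y) ^ 3 ≤
        ENNReal.ofReal h₂ ^ 3 * (N (E x) (E y) ^ 2 / edist (scl h₁ h₂ (E x)) (scl h₁ h₂ (E y)) ^ 3) := by
      intro x y
      rcases eq_or_ne x y with rfl | hxy
      · simp
      have hd0 : edist x y ≠ 0 := mt edist_eq_zero.1 hxy
      have hd : edist (scl h₁ h₂ (E x)) (scl h₁ h₂ (E y)) ≤ ENNReal.ofReal h₂ * edist x y := by
        rw [edist_dist x y, ← ENNReal.ofReal_mul p₂.le]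
        have n1 : |x.1 - y.1| ≤ dist x y := by rw [dist_eq_norm]; exact norm_fst_le (x - y)
        have n2 : |x.2 - y.2| ≤ dist x y := by rw [dist_eq_norm]; exact norm_snd_le (x - y)
        refine edist_scl_le p₁ p₂ ?_ ?_
        · rw [hEx, hEx]
          simp only [← mul_sub, abs_mul, abs_of_pos ε0]
          nlinarith [abs_nonneg (x.1 - y.1)]
        · rw [hEx, hEx]; exact mul_le_mul_of_nonneg_left n2 p₂.le
      change ‖U (E x) - U (E y)‖ₑ ^ 2 / edist x y ^ 3 ≤ _
      rw [ENNReal.div_le_iff_le_mul (Or.inl (pow_ne_zero _ hd0))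
        (Or.inl (ENNReal.pow_ne_top (edist_ne_top _ _)))]
      refine (sq_enorm_sub_le (scl h₁ h₂) U (E x) (E y) (scl_injective p₁ p₂) hd).trans (le_of_eq ?_)
      simp only [hN]
      rw [mul_pow]; ring
    calc gagliardo D id (U ∘ E) ≤ ∫⁻ x in D, ∫⁻ y in D, ENNReal.ofReal h₂ ^ 3 *
          (N (E x) (E y) ^ 2 / edist (scl h₁ h₂ (E x)) (scl h₁ h₂ (E y)) ^ 3) :=
          lintegral_mono fun x => lintegral_mono fun y => hpt x y
      _ = ENNReal.ofReal h₂ ^ 3 * (∫⁻ x in D, ENNReal.ofReal ε⁻¹ * ∫⁻ y in slab ε,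
          (N (E x) y ^ 2 / edist (scl h₁ h₂ (E x)) (scl h₁ h₂ y) ^ 3)) := by
          rw [← lintegral_const_mul' _ _ (ENNReal.pow_ne_top ENNReal.ofReal_ne_top)]
          refine lintegral_congr fun x => ?_
          rw [lintegral_const_mul' _ _ (ENNReal.pow_ne_top ENNReal.ofReal_ne_top), ← hcv'
            fun y => N (E x) y ^ 2 / edist (scl h₁ h₂ (E x)) (scl h₁ h₂ y) ^ 3]
      _ = ENNReal.ofReal h₂ ^ 3 * ENNReal.ofReal ε⁻¹ ^ 2 * gagliardo (slab ε) (scl h₁ h₂) U := by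
          rw [lintegral_const_mul' _ _ ENNReal.ofReal_ne_top, hcv' fun x => ∫⁻ y in slab ε,
            (N x y ^ 2 / edist (scl h₁ h₂ x) (scl h₁ h₂ y) ^ 3), gagliardo]
          ring
      _ ≤ ENNReal.ofReal m ^ 3 * G := by
          refine mul_le_mul' hcase ?_
          exact (lintegral_mono_set hsub).trans (lintegral_mono fun x => lintegral_mono_set hsub)
  have hcorner : ∀ z : ℝ × ℝ, 0 ≤ z.1 ∧ z.1 ≤ 1 ∧ 0 ≤ z.2 ∧ z.2 ≤ 1 →
      ∫⁻ x in D, ENNReal.ofReal ‖x - z‖⁻¹ * ∫⁻ y in D, N (E x) (E y) ≤ 192 * R := by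
    intro z hz
    have h1 := (hardy (starRegion_square hz) hV).trans (mul_le_mul_right hGV 36864)
    have h2 : (36864 : ℝ≥0∞) = ENNReal.ofReal 192 ^ 2 := by norm_num
    rw [h2] at h1
    have := le_ofReal_mul_rpow_half h1
    rwa [ENNReal.ofReal_ofNat] at this
  -- the slab average
  have hosc : ∫⁻ z in D, B (E z) ≤ 7 * R := by
    rw [hcv' B]
    change _ * slabOsc U ε ≤ _
    rcases le_total 1 (h₂ / h₁) with h | h
    · have e : ε = 1 := min_eq_left h
      rw [e, inv_one, ENNReal.ofReal_one, one_mul]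
      refine (slabOsc_one_le hU p₁ p₂ (le_max_left _ _) (le_max_right _ _)).trans ?_
      exact le_mul_of_one_le_left' (by norm_num)
    · have e : ε = h₂ / h₁ := min_eq_right h
      refine (mul_le_mul_right (slabOsc_le hU p₁ p₂ ε0 ε1
        (by rw [e]; field_simp; exact le_rfl)) _).trans ?_
      rw [← mul_assoc, ← ENNReal.ofReal_mul (by positivity)]
      have : ε⁻¹ * (7 * ε) = 7 := by field_simp
      rw [this]
      refine mul_le_mul' (by norm_num) ?_
      refine ENNReal.rpow_le_rpow ?_ (by norm_num)
      gcongr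
      exact le_max_left _ _
  have hpt : ∀ x, B x ≤ (∫⁻ z in D, N x (E z)) + 7 * R := by
    intro x
    calc B x = ∫⁻ _ in D, B x := by
          rw [lintegral_const, Measure.restrict_apply_univ, hD, volume_square, mul_one]
      _ ≤ ∫⁻ z in D, (N x (E z) + B (E z)) := by
          refine lintegral_mono fun z => ?_
          calc B x ≤ ∫⁻ y in D, (N x (E z) + N (E z) y) :=
                lintegral_mono fun y => enorm_sub_le_add _ _ _
            _ = N x (E z) + B (E z) := by
                rw [lintegral_add_left measurable_const, lintegral_const,
                  Measure.restrict_apply_univ, hD, volume_square, mul_one]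
      _ ≤ _ := by
          rw [lintegral_add_right _ hBE]
          gcongr
  -- The Jacobian ε of the dilation absorbs the factor 1/ε of the weight.
  have hw : ∀ x, ENNReal.ofReal ε * edgeWeight ε (E x) = edgeWeight 1 x := by
    intro x
    rw [hEx]
    simp only [edgeWeight, mul_lt_mul_iff_right₀ ε0, one_mul]
    split_ifs
    · rw [← ENNReal.ofReal_mul ε0.le]; congr 1; rw [mul_inv, ← mul_assoc, mul_inv_cancel₀ ε0.ne', one_mul]
    · simp
  have hsupp : ∫⁻ x in D, edgeWeight ε x * B x ≤ ∫⁻ x in slab ε, edgeWeight ε x * B x := by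
    rw [← lintegral_indicator hDm, ← lintegral_indicator (measurableSet_slab ε)]
    refine lintegral_mono fun x => ?_
    by_cases hx : x ∈ D
    · by_cases hx' : x ∈ slab ε
      · simp [hx, hx']
      · rw [indicator_of_mem hx, indicator_of_notMem hx', edgeWeight, if_neg, zero_mul]
        intro hlt
        refine hx' ⟨⟨hx.1, hlt.trans_le ?_⟩, hx.2.2⟩
        have : bub x.2 ≤ 1 := by rw [bub]; nlinarith [hx.2.2.1, hx.2.2.2]
        nlinarith
    · simp [hx]
  have hint1 : ∫⁻ x in D, edgeWeight 1 x ≤ 128 := by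
    calc _ ≤ ∫⁻ x in D, (ENNReal.ofReal ‖x - (0, 0)‖⁻¹ + ENNReal.ofReal ‖x - (0, 1)‖⁻¹) :=
          setLIntegral_mono' hDm fun x hx => edgeWeight_one_le hx
      _ ≤ 64 + 64 := by
          rw [lintegral_add_left (by fun_prop)]
          exact add_le_add (lintegral_norm_inv_le (starRegion_square (by norm_num)))
            (lintegral_norm_inv_le (starRegion_square (by norm_num)))
      _ = 128 := by norm_num
  calc _ ≤ ∫⁻ x in slab ε, edgeWeight ε x * B x := hsupp
    _ = ∫⁻ x in D, edgeWeight 1 x * B (E x) := by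
        rw [hcv, ← lintegral_const_mul' _ _ ENNReal.ofReal_ne_top]
        exact lintegral_congr fun x => by rw [← mul_assoc, hw]
    _ ≤ ∫⁻ x in D, (edgeWeight 1 x * (∫⁻ z in D, N (E x) (E z)) + edgeWeight 1 x * (7 * R)) :=
        lintegral_mono fun x => (mul_le_mul_right (hpt _) _).trans_eq (mul_add _ _ _)
    _ = (∫⁻ x in D, edgeWeight 1 x * (∫⁻ z in D, N (E x) (E z))) +
          (∫⁻ x in D, edgeWeight 1 x) * (7 * R) := by
        rw [lintegral_add_right _ ((measurable_edgeWeight 1).mul_const _),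
          lintegral_mul_const _ (measurable_edgeWeight 1)]
    -- Each of the two corners contributes 192 within the slab; 128 is the mass of the weight and 7
    -- the slab oscillation.
    _ ≤ (192 * R + 192 * R) + 128 * (7 * R) := by
        gcongr
        refine le_trans (setLIntegral_mono' hDm fun x hx =>
          mul_le_mul_left (edgeWeight_one_le hx) _) ?_
        simp only [add_mul]
        have hm2 : Measurable fun x => ∫⁻ z in D, N (E x) (E z) :=
          measurable_lintegral_enorm_sub hV D
        have hm3 : Measurable fun x : ℝ × ℝ =>
            ENNReal.ofReal ‖x - (0, 0)‖⁻¹ * ∫⁻ z in D, N (E x) (E z) :=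
          Measurable.mul (by fun_prop) hm2
        rw [lintegral_add_left hm3]
        exact add_le_add (hcorner _ (by norm_num)) (hcorner _ (by norm_num))
    _ = 1280 * R := by ring

end Slab

end GradedRT
end

/-! ### The edge cutoffs and the singular weight at the vertices. -/

noncomputable section

namespace GradedRT
open scoped ENNReal NNReal

/-! ### The denominators of the cutoff functions -/

/-- The denominator of the cutoff functions of a reference element (for the square, in reduced
form). It is comparable with the distance from the vertices. -/
def den : Shape → ℝ × ℝ → ℝ
  | .square, x => x.1 * (1 - x.1) + x.2 * (1 - x.2)
  | .triangle, x => (1 - x.1) * (x.1 - x.2) + x.2 * (x.1 - x.2) + x.2 * (1 - x.1)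

/-- The numerators of the cutoff functions of the unit square. -/
def squareNum : Fin 4 → ℝ × ℝ → ℝ :=
  ![fun x => (1 - x.1) * (1 - x.2) * x.1, fun x => x.2 * (1 - x.2) * x.1,
    fun x => x.2 * (1 - x.1) * x.1, fun x => x.2 * (1 - x.1) * (1 - x.2)]

/-- The numerators of the cutoff functions of the unit triangle. -/
def triangleNum : Fin 3 → ℝ × ℝ → ℝ :=
  ![fun x => (1 - x.1) * (x.1 - x.2), fun x => x.2 * (x.1 - x.2), fun x => x.2 * (1 - x.1)]

theorem erase_four : Finset.univ.erase (0 : Fin 4) = {1, 2, 3} ∧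
    Finset.univ.erase (1 : Fin 4) = {0, 2, 3} ∧ Finset.univ.erase (2 : Fin 4) = {0, 1, 3} ∧
    Finset.univ.erase (3 : Fin 4) = {0, 1, 2} := by decide

theorem erase_three : Finset.univ.erase (0 : Fin 3) = {1, 2} ∧
    Finset.univ.erase (1 : Fin 3) = {0, 2} ∧ Finset.univ.erase (2 : Fin 3) = {0, 1} := by decide

/-- In the sum of the four triple products, opposite edge functions add up to 1, so the denominator
collapses to x₁(1 − x₁) + x₂(1 − x₂). -/
theorem cutoff_square_eq (e : Fin 4) :
    cutoff squareEdge e = fun x => squareNum e x / den .square x := by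
  funext x
  obtain ⟨h0, h1, h2, h3⟩ := erase_four
  have hd : ∑ l, ∏ k ∈ Finset.univ.erase l, squareEdge k x = den .square x := by
    rw [Fin.sum_univ_four, h0, h1, h2, h3]
    simp [squareEdge, den]; ring
  rw [cutoff, hd]
  congr 1
  fin_cases e
  · simp [h0, squareEdge, squareNum]; ring
  · simp [h1, squareEdge, squareNum]; ring
  · simp [h2, squareEdge, squareNum]; ring
  · simp [h3, squareEdge, squareNum]; ring

theorem cutoff_triangle_eq (e : Fin 3) :
    cutoff triangleEdge e = fun x => triangleNum e x / den .triangle x := by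
  funext x
  obtain ⟨h0, h1, h2⟩ := erase_three
  have hd : ∑ l, ∏ k ∈ Finset.univ.erase l, triangleEdge k x = den .triangle x := by
    rw [Fin.sum_univ_three, h0, h1, h2]
    simp [triangleEdge, den]
  rw [cutoff, hd]
  congr 1
  fin_cases e
  · simp [h0, triangleEdge, triangleNum]
  · simp [h1, triangleEdge, triangleNum]
  · simp [h2, triangleEdge, triangleNum]

theorem contDiff_den (S : Shape) : ContDiff ℝ ∞ (den S) := by
  cases S
  · rw [show den .square = fun x => x.1 * (1 - x.1) + x.2 * (1 - x.2) from rfl]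
    fun_prop
  · rw [show den .triangle = fun x => (1 - x.1) * (x.1 - x.2) + x.2 * (x.1 - x.2) +
      x.2 * (1 - x.1) from rfl]
    fun_prop

theorem contDiff_squareNum (e : Fin 4) : ContDiff ℝ ∞ (squareNum e) := by
  fin_cases e <;> simp [squareNum] <;> fun_prop

theorem contDiff_triangleNum (e : Fin 3) : ContDiff ℝ ∞ (triangleNum e) := by
  fin_cases e <;> simp [triangleNum] <;> fun_prop

theorem den_pos {S : Shape} {x : ℝ × ℝ} (hx : x ∈ S.dom) : 0 < den S x := by
  cases S
  · obtain ⟨a, b, c, d⟩ := hx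
    have h1 := mul_pos a (sub_pos.2 b)
    have h2 := mul_pos c (sub_pos.2 d)
    simp only [den]; linarith
  · obtain ⟨a, b, c, d⟩ := hx
    have h1 := mul_pos (sub_pos.2 b) (sub_pos.2 d)
    have h2 := mul_pos c (sub_pos.2 d)
    have h3 := mul_pos c (sub_pos.2 b)
    simp only [den]; linarith

theorem den_le_one {S : Shape} {x : ℝ × ℝ} (hx : x ∈ S.dom) : den S x ≤ 1 := by
  cases S
  · obtain ⟨a, b, c, d⟩ := hx
    simp only [den]; nlinarith [sq_nonneg (x.1 - 1 / 2), sq_nonneg (x.2 - 1 / 2)]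
  · obtain ⟨a, b, c, d⟩ := hx
    simp only [den]; nlinarith [mul_pos c (sub_pos.2 d), mul_pos c (sub_pos.2 b),
      mul_pos (sub_pos.2 b) (sub_pos.2 d), mul_pos c a, mul_pos c c]

theorem squareNum_nonneg (e : Fin 4) {x : ℝ × ℝ} (hx : x ∈ Shape.square.dom) :
    0 ≤ squareNum e x := by
  obtain ⟨a, b, c, d⟩ := hx
  have b' := sub_pos.2 b
  have d' := sub_pos.2 d
  fin_cases e <;> simp [squareNum] <;> positivity

theorem squareNum_le (e : Fin 4) {x : ℝ × ℝ} (hx : x ∈ Shape.square.dom) :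
    squareNum e x ≤ den .square x := by
  have h : ∑ l, squareNum l x = den .square x := by
    rw [Fin.sum_univ_four]; simp [squareNum, den]; ring
  rw [← h]
  exact Finset.single_le_sum (f := fun l => squareNum l x)
    (fun l _ => squareNum_nonneg l hx) (Finset.mem_univ e)

theorem triangleNum_nonneg (e : Fin 3) {x : ℝ × ℝ} (hx : x ∈ Shape.triangle.dom) :
    0 ≤ triangleNum e x := by
  obtain ⟨a, b, c, d⟩ := hx
  have b' := sub_pos.2 b
  have d' := sub_pos.2 d
  fin_cases e <;> simp [triangleNum] <;> positivity

theorem triangleNum_le (e : Fin 3) {x : ℝ × ℝ} (hx : x ∈ Shape.triangle.dom) :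
    triangleNum e x ≤ den .triangle x := by
  have h : ∑ l, triangleNum l x = den .triangle x := by
    rw [Fin.sum_univ_three]; simp [triangleNum, den]
  rw [← h]
  exact Finset.single_le_sum (f := fun l => triangleNum l x)
    (fun l _ => triangleNum_nonneg l hx) (Finset.mem_univ e)

/-! ### Integrability of the singular weight -/

/-- The vertices of a reference element. -/
def vertices : Shape → Finset (ℝ × ℝ)
  | .square => {(0, 0), (1, 0), (1, 1), (0, 1)}
  | .triangle => {(0, 0), (1, 0), (1, 1)}

theorem starRegion_vertices {S : Shape} {z : ℝ × ℝ} (hz : z ∈ vertices S) : StarRegion S.dom z := by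
  cases S
  · refine starRegion_square ?_
    simp only [vertices, Finset.mem_insert, Finset.mem_singleton] at hz
    rcases hz with rfl | rfl | rfl | rfl <;> norm_num
  · refine starRegion_triangle ?_
    simp only [vertices, Finset.mem_insert, Finset.mem_singleton] at hz
    rcases hz with rfl | rfl | rfl <;> norm_num

/-- In the square, t(1 − t) is at least half the distance of t to the nearer endpoint, and the
vertex is chosen coordinate by coordinate. In the triangle, one of the barycentric coordinates 1 −
x₁, x₂, x₁ − x₂ is at least 1/3, and the vertex belonging to it is taken. -/
theorem exists_vertex_le {S : Shape} {x : ℝ × ℝ} (hx : x ∈ S.dom) :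
    ∃ z ∈ vertices S, (den S x)⁻¹ ≤ 4 * ‖x - z‖⁻¹ := by
  have key : ∀ z : ℝ × ℝ, x ≠ z → ‖x - z‖ ≤ 4 * den S x → (den S x)⁻¹ ≤ 4 * ‖x - z‖⁻¹ := by
    intro z hz h
    have h0 : 0 < ‖x - z‖ := norm_pos_iff.2 (sub_ne_zero.2 hz)
    have h1 := den_pos hx
    rw [← div_eq_mul_inv, le_div_iff₀ h0, inv_mul_le_iff₀ h1]
    linarith
  have nrm : ∀ (z : ℝ × ℝ) (d : ℝ), |x.1 - z.1| ≤ d → |x.2 - z.2| ≤ d → ‖x - z‖ ≤ d :=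
    fun z d h1 h2 => max_le h1 h2
  cases S
  · obtain ⟨a, b, c, d⟩ := hx
    have h1 : ∃ z1 : ℝ, (z1 = 0 ∨ z1 = 1) ∧ |x.1 - z1| ≤ 2 * (x.1 * (1 - x.1)) ∧ x.1 ≠ z1 := by
      rcases le_total x.1 (1 / 2) with h | h
      · exact ⟨0, Or.inl rfl, by rw [sub_zero, abs_of_pos a]; nlinarith, a.ne'⟩
      · exact ⟨1, Or.inr rfl, by rw [abs_sub_comm, abs_of_pos (sub_pos.2 b)]; nlinarith, b.ne⟩
    have h2 : ∃ z2 : ℝ, (z2 = 0 ∨ z2 = 1) ∧ |x.2 - z2| ≤ 2 * (x.2 * (1 - x.2)) := by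
      rcases le_total x.2 (1 / 2) with h | h
      · exact ⟨0, Or.inl rfl, by rw [sub_zero, abs_of_pos c]; nlinarith⟩
      · exact ⟨1, Or.inr rfl, by rw [abs_sub_comm, abs_of_pos (sub_pos.2 d)]; nlinarith⟩
    obtain ⟨z1, hz1, e1, n1⟩ := h1
    obtain ⟨z2, hz2, e2⟩ := h2
    have p1 := mul_pos a (sub_pos.2 b)
    have p2 := mul_pos c (sub_pos.2 d)
    refine ⟨(z1, z2), ?_, key _ (fun h => n1 (congrArg Prod.fst h)) (nrm _ _ ?_ ?_)⟩
    · rcases hz1 with rfl | rfl <;> rcases hz2 with rfl | rfl <;> simp [vertices]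
    · simp only [den]; linarith
    · simp only [den]; linarith
  · obtain ⟨a, b, c, d⟩ := hx
    have p1 := mul_pos (sub_pos.2 b) (sub_pos.2 d)
    have p2 := mul_pos c (sub_pos.2 d)
    have p3 := mul_pos c (sub_pos.2 b)
    rcases le_total (1 / 3) (1 - x.1) with h | h
    · refine ⟨(0, 0), by simp [vertices], key _ (fun h => a.ne' (congrArg Prod.fst h)) (nrm _ _ ?_ ?_)⟩
      · simp only [den, sub_zero, abs_of_pos a]; nlinarith
      · simp only [den, sub_zero, abs_of_pos c]; nlinarith
    rcases le_total (1 / 3) x.2 with h' | h'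
    · refine ⟨(1, 1), by simp [vertices], key _ (fun h => b.ne (congrArg Prod.fst h)) (nrm _ _ ?_ ?_)⟩
      · simp only [den, abs_sub_comm x.1, abs_of_pos (sub_pos.2 b)]; nlinarith
      · simp only [den, abs_sub_comm x.2, abs_of_pos (sub_pos.2 (d.trans b))]; nlinarith
    · refine ⟨(1, 0), by simp [vertices], key _ (fun h => b.ne (congrArg Prod.fst h)) (nrm _ _ ?_ ?_)⟩
      · simp only [den, abs_sub_comm x.1, abs_of_pos (sub_pos.2 b)]; nlinarith
      · simp only [den, sub_zero, abs_of_pos c]; nlinarith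

/-- The weight `1 / den`. -/
def denWeight (S : Shape) (x : ℝ × ℝ) : ℝ≥0∞ := ENNReal.ofReal (den S x)⁻¹

theorem measurable_denWeight (S : Shape) : Measurable (denWeight S) := by
  have := (contDiff_den S).continuous.measurable
  unfold denWeight
  fun_prop

theorem one_le_denWeight {S : Shape} {x : ℝ × ℝ} (hx : x ∈ S.dom) : 1 ≤ denWeight S x :=
  ENNReal.one_le_ofReal.2 ((one_le_inv₀ (den_pos hx)).2 (den_le_one hx))

theorem denWeight_le {S : Shape} {x : ℝ × ℝ} (hx : x ∈ S.dom) :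
    denWeight S x ≤ ∑ z ∈ vertices S, 4 * ENNReal.ofReal ‖x - z‖⁻¹ := by
  obtain ⟨z, hz, h⟩ := exists_vertex_le hx
  refine le_trans ?_ (Finset.single_le_sum
    (f := fun z => 4 * ENNReal.ofReal ‖x - z‖⁻¹) (fun _ _ => zero_le) hz)
  refine (ENNReal.ofReal_le_ofReal h).trans_eq ?_
  rw [ENNReal.ofReal_mul (by norm_num)]; simp

theorem card_vertices_le (S : Shape) : (vertices S).card ≤ 4 := by
  cases S
  · exact Finset.card_le_four
  · exact Finset.card_le_three.trans (by norm_num)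

theorem lintegral_denWeight_le (S : Shape) : ∫⁻ x in S.dom, denWeight S x ≤ 1024 := by
  calc _ ≤ ∫⁻ x in S.dom, ∑ z ∈ vertices S, 4 * ENNReal.ofReal ‖x - z‖⁻¹ :=
        setLIntegral_mono' (measurableSet_dom S) fun x hx => denWeight_le hx
    _ = ∑ z ∈ vertices S, 4 * ∫⁻ x in S.dom, ENNReal.ofReal ‖x - z‖⁻¹ := by
        rw [lintegral_finsetSum _ fun z _ => by fun_prop]
        exact Finset.sum_congr rfl fun z _ => lintegral_const_mul' _ _ (by simp)
    _ ≤ ∑ z ∈ vertices S, 4 * 64 := by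
        gcongr with z hz
        exact lintegral_norm_inv_le (starRegion_vertices hz)
    _ ≤ 1024 := by
        rw [Finset.sum_const, nsmul_eq_mul]
        calc ((vertices S).card : ℝ≥0∞) * (4 * 64) ≤ (4 : ℕ) * (4 * 64) := by
              gcongr; exact card_vertices_le S
          _ = 1024 := by norm_num

section

variable {F : Type*} [NormedAddCommGroup F] {U : ℝ × ℝ → F}

theorem denWeight_hardy (S : Shape) (hU : StronglyMeasurable U) :
    ∫⁻ x in S.dom, denWeight S x * ∫⁻ y in S.dom, ‖U x - U y‖ₑ ≤
      3072 * gagliardo S.dom id U ^ (1 / 2 : ℝ) := by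
  have hm := measurable_lintegral_enorm_sub hU S.dom
  calc _ ≤ ∫⁻ x in S.dom, ∑ z ∈ vertices S, 4 * (ENNReal.ofReal ‖x - z‖⁻¹ *
          ∫⁻ y in S.dom, ‖U x - U y‖ₑ) := by
        refine setLIntegral_mono' (measurableSet_dom S) fun x hx => ?_
        refine (mul_le_mul_left (denWeight_le hx) _).trans_eq ?_
        rw [Finset.sum_mul]
        exact Finset.sum_congr rfl fun z _ => mul_assoc _ _ _
    _ = ∑ z ∈ vertices S, 4 * ∫⁻ x in S.dom, ENNReal.ofReal ‖x - z‖⁻¹ *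
          ∫⁻ y in S.dom, ‖U x - U y‖ₑ := by
        have hm' : ∀ z : ℝ × ℝ, Measurable fun x => 4 * (ENNReal.ofReal ‖x - z‖⁻¹ *
            ∫⁻ y in S.dom, ‖U x - U y‖ₑ) :=
          fun z => Measurable.const_mul (Measurable.mul (by fun_prop) hm) _
        rw [lintegral_finsetSum _ fun z _ => hm' z]
        exact Finset.sum_congr rfl fun z _ => lintegral_const_mul' _ _ (by simp)
    _ ≤ ∑ z ∈ vertices S, 4 * (192 * gagliardo S.dom id U ^ (1 / 2 : ℝ)) := by
        gcongr with z hz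
        have h1 := hardy (starRegion_vertices hz) hU
        have h2 : (36864 : ℝ≥0∞) = ENNReal.ofReal 192 ^ 2 := by norm_num
        rw [h2] at h1
        have := le_ofReal_mul_rpow_half h1
        rwa [ENNReal.ofReal_ofNat] at this
    _ ≤ _ := by
        rw [Finset.sum_const, nsmul_eq_mul]
        calc ((vertices S).card : ℝ≥0∞) * (4 * (192 * gagliardo S.dom id U ^ (1 / 2 : ℝ))) ≤
              (4 : ℕ) * (4 * (192 * gagliardo S.dom id U ^ (1 / 2 : ℝ))) := by
              gcongr; exact card_vertices_le S
          _ = 3072 * gagliardo S.dom id U ^ (1 / 2 : ℝ) := by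
              rw [← mul_assoc, ← mul_assoc]; norm_num

/-- This is what makes the flux integrals converge. By the Hardy bound and Tonelli, the weighted
integral of U − U(y) is finite for almost every y; one such y exists because the region has positive
area, and the constant U(y) is integrable against the weight. -/
theorem lintegral_denWeight_enorm_lt_top (S : Shape) (hU : StronglyMeasurable U)
    (hG : gagliardo S.dom id U < ⊤) : ∫⁻ x in S.dom, denWeight S x * ‖U x‖ₑ < ⊤ := by
  have hw := measurable_denWeight S
  have hN := measurable_enorm_sub hU
  have h1 : ∫⁻ y in S.dom, ∫⁻ x in S.dom, denWeight S x * ‖U x - U y‖ₑ < ⊤ := by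
    rw [lintegral_lintegral_swap]
    · have e : ∀ x, ∫⁻ y in S.dom, denWeight S x * ‖U x - U y‖ₑ =
          denWeight S x * ∫⁻ y in S.dom, ‖U x - U y‖ₑ :=
        fun x => lintegral_const_mul' _ _ ENNReal.ofReal_ne_top
      simp only [e]
      refine (denWeight_hardy S hU).trans_lt (ENNReal.mul_lt_top (by simp) ?_)
      exact ENNReal.rpow_lt_top_of_nonneg (by norm_num) hG.ne
    · refine Measurable.aemeasurable ?_
      exact (hw.comp measurable_snd).mul (hN.comp measurable_swap)
  have h2 : ∀ᵐ y ∂volume.restrict S.dom, ∫⁻ x in S.dom, denWeight S x * ‖U x - U y‖ₑ < ⊤ := by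
    refine ae_lt_top' (Measurable.aemeasurable ?_) h1.ne
    exact Measurable.lintegral_prod_right' (f := fun p : (ℝ × ℝ) × (ℝ × ℝ) =>
      denWeight S p.2 * ‖U p.2 - U p.1‖ₑ) ((hw.comp measurable_snd).mul (hN.comp measurable_swap))
  have h3 : NeZero (volume.restrict S.dom) := ⟨by
    rw [Ne, Measure.restrict_eq_zero]
    have := le_volume_dom S
    intro h
    simp [h] at this⟩
  obtain ⟨y, hy⟩ := h2.exists
  calc _ ≤ ∫⁻ x in S.dom, (denWeight S x * ‖U x - U y‖ₑ + denWeight S x * ‖U y‖ₑ) := by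
        refine lintegral_mono fun x => ?_
        rw [← mul_add]
        gcongr
        simpa using enorm_add_le (U x - U y) (U y)
    _ = (∫⁻ x in S.dom, denWeight S x * ‖U x - U y‖ₑ) + (∫⁻ x in S.dom, denWeight S x) * ‖U y‖ₑ := by
        rw [lintegral_add_right _ (hw.mul_const _), lintegral_mul_const _ hw]
    _ < ⊤ := by
        refine ENNReal.add_lt_top.2 ⟨hy, ENNReal.mul_lt_top ?_ enorm_lt_top⟩
        exact (lintegral_denWeight_le S).trans_lt (by simp)

end

end GradedRT
end

/-! ### Green pairings and the exactness of the fluxes on constant fields. -/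

noncomputable section

namespace GradedRT
open scoped ENNReal NNReal

variable {𝕜 : Type*} [RCLike 𝕜]

/-! ### Green pairings -/

/-- The integrand of Green's formula. -/
def greenDensity (φ : ℝ × ℝ → ℝ) (u : ℝ × ℝ → 𝕜 × 𝕜) (f : 𝕜) (x : ℝ × ℝ) : 𝕜 :=
  fderiv ℝ φ x (1, 0) • (u x).1 + fderiv ℝ φ x (0, 1) • (u x).2 + φ x • f

/-- The pairing `∫ (∇φ · u + φ f)` over `D`. -/
def greenPairing (D : Set (ℝ × ℝ)) (φ : ℝ × ℝ → ℝ) (u : ℝ × ℝ → 𝕜 × 𝕜) (f : 𝕜) : 𝕜 :=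
  ∫ x in D, greenDensity φ u f x

/-- The field `u` has constant divergence `f` in `D`, in the sense of distributions. -/
def WeakDiv (D : Set (ℝ × ℝ)) (u : ℝ × ℝ → 𝕜 × 𝕜) (f : 𝕜) : Prop :=
  ∀ φ : ℝ × ℝ → ℝ, ContDiff ℝ ∞ φ → HasCompactSupport φ → tsupport φ ⊆ D →
    greenPairing D φ u f = 0

theorem edgeFlux_eq_greenPairing (D : Set (ℝ × ℝ)) {n : ℕ} (d : Fin n → ℝ × ℝ → ℝ) (e : Fin n)
    (u : ℝ × ℝ → 𝕜 × 𝕜) (f : 𝕜) :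
    edgeFlux D d e u (fun _ => f) = greenPairing D (cutoff d e) u f := rfl

/-- A bounded function, smooth in a reference element, with gradient `O(1 / den)`. -/
structure IsEdgeFun (S : Shape) (φ : ℝ × ℝ → ℝ) : Prop where
  contDiffAt : ∀ x ∈ S.dom, ContDiffAt ℝ ∞ φ x
  bound : ∃ A : ℝ, 0 ≤ A ∧ ∀ x ∈ S.dom, |φ x| ≤ A
  fderiv_bound : ∃ A : ℝ, 0 ≤ A ∧ ∀ x ∈ S.dom, ‖fderiv ℝ φ x‖ ≤ A * (den S x)⁻¹

theorem IsEdgeFun.sub {S : Shape} {φ ψ : ℝ × ℝ → ℝ} (hφ : IsEdgeFun S φ) (hψ : IsEdgeFun S ψ) :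
    IsEdgeFun S fun x => φ x - ψ x := by
  obtain ⟨A, A0, hA⟩ := hφ.bound
  obtain ⟨B, B0, hB⟩ := hψ.bound
  obtain ⟨A', A0', hA'⟩ := hφ.fderiv_bound
  obtain ⟨B', B0', hB'⟩ := hψ.fderiv_bound
  refine ⟨fun x hx => (hφ.contDiffAt x hx).sub (hψ.contDiffAt x hx), ⟨A + B, by positivity,
    fun x hx => (abs_sub _ _).trans (add_le_add (hA x hx) (hB x hx))⟩,
    ⟨A' + B', by positivity, fun x hx => ?_⟩⟩
  rw [fderiv_fun_sub ((hφ.contDiffAt x hx).differentiableAt (by simp))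
    ((hψ.contDiffAt x hx).differentiableAt (by simp)), add_mul]
  exact (norm_sub_le _ _).trans (add_le_add (hA' x hx) (hB' x hx))

theorem exists_fderiv_bound {n : ℝ × ℝ → ℝ} (hn : ContDiff ℝ ∞ n) :
    ∃ A : ℝ, 0 ≤ A ∧ ∀ x ∈ Shape.square.dom, ‖fderiv ℝ n x‖ ≤ A := by
  have hc : Continuous fun x => ‖fderiv ℝ n x‖ := (hn.continuous_fderiv (by simp)).norm
  obtain ⟨A, hA⟩ := ((isCompact_Icc (a := (0 : ℝ)) (b := 1)).prod
    (isCompact_Icc (a := (0 : ℝ)) (b := 1))).bddAbove_image hc.continuousOn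
  refine ⟨max A 0, le_max_right _ _, fun x hx => (hA ⟨x, ?_, rfl⟩).trans (le_max_left _ _)⟩
  exact ⟨⟨hx.1.le, hx.2.1.le⟩, hx.2.2.1.le, hx.2.2.2.le⟩

/-- Differentiating n = (n/den) · den gives den · ∇(n/den) = ∇n − (n/den)∇den, which is bounded
because 0 ≤ n/den ≤ 1. -/
theorem isEdgeFun_div {S : Shape} {n : ℝ × ℝ → ℝ} (hn : ContDiff ℝ ∞ n)
    (h0 : ∀ x ∈ S.dom, 0 ≤ n x) (h1 : ∀ x ∈ S.dom, n x ≤ den S x) :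
    IsEdgeFun S fun x => n x / den S x := by
  have hc : ∀ x ∈ S.dom, ContDiffAt ℝ ∞ (fun x => n x / den S x) x := fun x hx =>
    hn.contDiffAt.div (contDiff_den S).contDiffAt (den_pos hx).ne'
  have hb : ∀ x ∈ S.dom, |n x / den S x| ≤ 1 := fun x hx => by
    rw [abs_of_nonneg (div_nonneg (h0 x hx) (den_pos hx).le), div_le_one (den_pos hx)]
    exact h1 x hx
  obtain ⟨A, A0, hA⟩ := exists_fderiv_bound hn
  obtain ⟨B, B0, hB⟩ := exists_fderiv_bound (contDiff_den S)
  refine ⟨hc, ⟨1, zero_le_one, hb⟩, ⟨A + B, by positivity, fun x hx => ?_⟩⟩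
  have hd := den_pos hx
  have hdc := (hc x hx).differentiableAt (by simp)
  have hdd : DifferentiableAt ℝ (den S) x := (contDiff_den S).differentiable (by simp) x
  have e : n =ᶠ[nhds x] fun y => (n y / den S y) * den S y := by
    filter_upwards [(isOpen_dom S).mem_nhds hx] with y hy
    rw [div_mul_cancel₀ _ (den_pos hy).ne']
  have e2 := e.fderiv_eq (𝕜 := ℝ)
  rw [fderiv_fun_mul hdc hdd] at e2
  have e3 : den S x • fderiv ℝ (fun y => n y / den S y) x =
      fderiv ℝ n x - (n x / den S x) • fderiv ℝ (den S) x := by rw [e2]; abel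
  have e4 : den S x * ‖fderiv ℝ (fun y => n y / den S y) x‖ ≤ A + B := by
    rw [← Real.norm_of_nonneg hd.le, ← norm_smul, e3]
    refine (norm_sub_le _ _).trans (add_le_add (hA x (dom_subset_square S hx)) ?_)
    rw [norm_smul]
    exact (mul_le_of_le_one_left (norm_nonneg _) (hb x hx)).trans (hB x (dom_subset_square S hx))
  rw [← div_eq_mul_inv, le_div_iff₀ hd]; linarith

theorem isEdgeFun_cutoff_square (e : Fin 4) : IsEdgeFun .square (cutoff squareEdge e) := by
  rw [cutoff_square_eq]
  exact isEdgeFun_div (contDiff_squareNum e) (fun x hx => squareNum_nonneg e hx)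
    fun x hx => squareNum_le e hx

theorem isEdgeFun_cutoff_triangle (e : Fin 3) : IsEdgeFun .triangle (cutoff triangleEdge e) := by
  rw [cutoff_triangle_eq]
  exact isEdgeFun_div (contDiff_triangleNum e) (fun x hx => triangleNum_nonneg e hx)
    fun x hx => triangleNum_le e hx

theorem abs_fderiv_fst_le (φ : ℝ × ℝ → ℝ) (x : ℝ × ℝ) :
    |fderiv ℝ φ x (1, 0)| ≤ ‖fderiv ℝ φ x‖ := by
  have := (fderiv ℝ φ x).le_opNorm (1, 0)
  simpa [Prod.norm_def] using this

theorem abs_fderiv_snd_le (φ : ℝ × ℝ → ℝ) (x : ℝ × ℝ) :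
    |fderiv ℝ φ x (0, 1)| ≤ ‖fderiv ℝ φ x‖ := by
  have := (fderiv ℝ φ x).le_opNorm (0, 1)
  simpa [Prod.norm_def] using this

theorem aestronglyMeasurable_greenDensity {S : Shape} {φ : ℝ × ℝ → ℝ} (hφ : IsEdgeFun S φ)
    {u : ℝ × ℝ → 𝕜 × 𝕜} (hu : StronglyMeasurable u) (f : 𝕜) :
    AEStronglyMeasurable (greenDensity φ u f) (volume.restrict S.dom) := by
  have h1 : AEStronglyMeasurable φ (volume.restrict S.dom) :=
    ContinuousOn.aestronglyMeasurable
      (fun x hx => (hφ.contDiffAt x hx).continuousAt.continuousWithinAt) (measurableSet_dom S)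
  have h2 : ∀ v, AEStronglyMeasurable (fun x => fderiv ℝ φ x v) (volume.restrict S.dom) :=
    fun v => (measurable_fderiv_apply_const ℝ φ v).aestronglyMeasurable
  exact (((h2 _).smul (continuous_fst.comp_stronglyMeasurable hu).aestronglyMeasurable).add
    ((h2 _).smul (continuous_snd.comp_stronglyMeasurable hu).aestronglyMeasurable)).add
    (h1.smul aestronglyMeasurable_const)

theorem enorm_greenDensity_le {φ : ℝ × ℝ → ℝ} {u : ℝ × ℝ → 𝕜 × 𝕜} {f : 𝕜} {x : ℝ × ℝ} {A B : ℝ}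
    (hA : ‖fderiv ℝ φ x‖ ≤ A) (hB : |φ x| ≤ B) :
    ‖greenDensity φ u f x‖ₑ ≤ ENNReal.ofReal (2 * A) * ‖u x‖ₑ + ENNReal.ofReal B * ‖f‖ₑ := by
  have hA0 : 0 ≤ A := (norm_nonneg _).trans hA
  have hB0 : 0 ≤ B := (abs_nonneg _).trans hB
  rw [← ofReal_norm (u x), ← ofReal_norm f, ← ofReal_norm, ← ENNReal.ofReal_mul (by positivity),
    ← ENNReal.ofReal_mul hB0, ← ENNReal.ofReal_add (by positivity) (by positivity)]
  refine ENNReal.ofReal_le_ofReal ?_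
  rw [greenDensity]
  refine (norm_add_le _ _).trans (add_le_add ((norm_add_le _ _).trans ?_) ?_)
  · rw [norm_smul, norm_smul, two_mul, add_mul]
    have h1 : ‖(u x).1‖ ≤ ‖u x‖ := norm_fst_le (u x)
    have h2 : ‖(u x).2‖ ≤ ‖u x‖ := norm_snd_le (u x)
    exact add_le_add
      (mul_le_mul ((abs_fderiv_fst_le φ x).trans hA) h1 (norm_nonneg _) hA0)
      (mul_le_mul ((abs_fderiv_snd_le φ x).trans hA) h2 (norm_nonneg _) hA0)
  · rw [norm_smul]
    exact mul_le_mul_of_nonneg_right hB (norm_nonneg _)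

theorem integrableOn_greenDensity {S : Shape} {φ : ℝ × ℝ → ℝ} (hφ : IsEdgeFun S φ)
    {u : ℝ × ℝ → 𝕜 × 𝕜} (hu : StronglyMeasurable u)
    (hu' : ∫⁻ x in S.dom, denWeight S x * ‖u x‖ₑ < ⊤) (f : 𝕜) :
    IntegrableOn (greenDensity φ u f) S.dom := by
  refine ⟨aestronglyMeasurable_greenDensity hφ hu f, ?_⟩
  obtain ⟨A, A0, hA⟩ := hφ.fderiv_bound
  obtain ⟨B, B0, hB⟩ := hφ.bound
  calc ∫⁻ x in S.dom, ‖greenDensity φ u f x‖ₑ ≤ ∫⁻ x in S.dom,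
        (ENNReal.ofReal (2 * A) * (denWeight S x * ‖u x‖ₑ) + ENNReal.ofReal B * ‖f‖ₑ) := by
        refine setLIntegral_mono' (measurableSet_dom S) fun x hx => ?_
        refine (enorm_greenDensity_le (hA x hx) (hB x hx)).trans_eq ?_
        rw [← mul_assoc 2, ENNReal.ofReal_mul (by positivity), mul_assoc, denWeight]
    _ = ENNReal.ofReal (2 * A) * (∫⁻ x in S.dom, denWeight S x * ‖u x‖ₑ) +
          ENNReal.ofReal B * ‖f‖ₑ * volume S.dom := by
        rw [lintegral_add_right _ measurable_const,
          lintegral_const_mul' _ _ ENNReal.ofReal_ne_top, lintegral_const,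
          Measure.restrict_apply_univ]
    _ < ⊤ := by
        refine ENNReal.add_lt_top.2 ⟨ENNReal.mul_lt_top ENNReal.ofReal_lt_top hu',
          ENNReal.mul_lt_top (ENNReal.mul_lt_top ENNReal.ofReal_lt_top enorm_lt_top) ?_⟩
        exact (volume_dom_le S).trans_lt (by simp)

theorem lintegral_denWeight_const_lt_top (S : Shape) (c : 𝕜 × 𝕜) :
    ∫⁻ x in S.dom, denWeight S x * ‖(fun _ => c : ℝ × ℝ → 𝕜 × 𝕜) x‖ₑ < ⊤ := by
  rw [lintegral_mul_const _ (measurable_denWeight S)]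
  exact ENNReal.mul_lt_top ((lintegral_denWeight_le S).trans_lt (by simp)) enorm_lt_top

theorem lintegral_denWeight_sub_lt_top {S : Shape} {u : ℝ × ℝ → 𝕜 × 𝕜}
    (hu' : ∫⁻ x in S.dom, denWeight S x * ‖u x‖ₑ < ⊤) (c : 𝕜 × 𝕜) :
    ∫⁻ x in S.dom, denWeight S x * ‖u x - c‖ₑ < ⊤ := by
  refine lt_of_le_of_lt (lintegral_mono fun x =>
    (mul_le_mul_right (enorm_sub_le (E := 𝕜 × 𝕜)) _).trans_eq (mul_add _ _ _)) ?_
  rw [lintegral_add_right _ ((measurable_denWeight S).mul_const _)]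
  exact ENNReal.add_lt_top.2 ⟨hu', lintegral_denWeight_const_lt_top S c⟩

/-- A constant field has zero divergence, so all of `f` stays with the difference. The singular
weight makes both integrals converge, so the pairing may be split. -/
theorem greenPairing_eq_const_add {S : Shape} {φ : ℝ × ℝ → ℝ} (hφ : IsEdgeFun S φ)
    {u : ℝ × ℝ → 𝕜 × 𝕜} (hu : StronglyMeasurable u)
    (hu' : ∫⁻ x in S.dom, denWeight S x * ‖u x‖ₑ < ⊤) (f : 𝕜) (c : 𝕜 × 𝕜) :
    greenPairing S.dom φ u f =
      greenPairing S.dom φ (fun _ => c) 0 + greenPairing S.dom φ (fun x => u x - c) f := by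
  have hi : IntegrableOn (greenDensity φ (fun x => u x - c) f) S.dom :=
    integrableOn_greenDensity hφ (hu.sub stronglyMeasurable_const)
      (lintegral_denWeight_sub_lt_top hu' c) _
  rw [greenPairing, greenPairing, greenPairing, ← integral_add
    (integrableOn_greenDensity hφ stronglyMeasurable_const (lintegral_denWeight_const_lt_top S c) _)
    hi]
  refine integral_congr_ae (Filter.Eventually.of_forall fun x => ?_)
  simp only [greenDensity, Prod.fst_sub, Prod.snd_sub, smul_sub, smul_zero]
  ring

theorem greenPairing_sub {S : Shape} {φ ψ : ℝ × ℝ → ℝ} (hφ : IsEdgeFun S φ) (hψ : IsEdgeFun S ψ)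
    {u : ℝ × ℝ → 𝕜 × 𝕜} (hu : StronglyMeasurable u)
    (hu' : ∫⁻ x in S.dom, denWeight S x * ‖u x‖ₑ < ⊤) (f : 𝕜) :
    greenPairing S.dom (fun x => φ x - ψ x) u f =
      greenPairing S.dom φ u f - greenPairing S.dom ψ u f := by
  rw [greenPairing, greenPairing, greenPairing, ← integral_sub
    (integrableOn_greenDensity hφ hu hu' _) (integrableOn_greenDensity hψ hu hu' _)]
  refine setIntegral_congr_fun (measurableSet_dom S) fun x hx => ?_
  simp only [greenDensity]
  rw [fderiv_fun_sub ((hφ.contDiffAt x hx).differentiableAt (by simp))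
    ((hψ.contDiffAt x hx).differentiableAt (by simp))]
  simp only [sub_apply, sub_smul]
  ring

/-! ### Fluxes of constant fields -/

theorem integrableOn_fderiv {S : Shape} {φ : ℝ × ℝ → ℝ} (hφ : IsEdgeFun S φ) (v : ℝ × ℝ)
    (hv : v = (1, 0) ∨ v = (0, 1)) : IntegrableOn (fun x => fderiv ℝ φ x v) S.dom := by
  have h := integrableOn_greenDensity (𝕜 := ℝ) hφ (u := fun _ => v) stronglyMeasurable_const
    (lintegral_denWeight_const_lt_top S v) 0
  refine h.congr (Filter.Eventually.of_forall fun x => ?_)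
  rcases hv with rfl | rfl <;> simp [greenDensity]

theorem greenPairing_const {S : Shape} {φ : ℝ × ℝ → ℝ} (hφ : IsEdgeFun S φ) (c : 𝕜 × 𝕜) :
    greenPairing S.dom φ (fun _ => c) 0 = (∫ x in S.dom, fderiv ℝ φ x (1, 0)) • c.1 +
      (∫ x in S.dom, fderiv ℝ φ x (0, 1)) • c.2 := by
  have h1 := integrableOn_fderiv hφ (1, 0) (Or.inl rfl)
  have h2 := integrableOn_fderiv hφ (0, 1) (Or.inr rfl)
  rw [greenPairing, ← integral_smul_const, ← integral_smul_const,
    ← integral_add (h1.smul_const _) (h2.smul_const _)]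
  simp [greenDensity]

theorem integral_deriv_line {c : ℝ → ℝ} {a b : ℝ} (hab : a ≤ b)
    (hc : ∀ t ∈ Icc a b, ContDiffAt ℝ 1 c t) : ∫ t in Ioo a b, deriv c t = c b - c a := by
  rw [← integral_Ioc_eq_integral_Ioo, ← intervalIntegral.integral_of_le hab]
  rw [← uIcc_of_le hab] at hc
  refine intervalIntegral.integral_deriv_eq_sub
    (fun t ht => (hc t ht).differentiableAt (by simp)) (ContinuousOn.intervalIntegrable fun t ht => ?_)
  have h := ((hc t ht).continuousAt_fderiv (by simp)).clm_apply (continuousAt_const (y := (1 : ℝ)))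
  exact h.continuousWithinAt

/-- Fubini and the fundamental theorem of calculus on horizontal lines; the difference of the
endpoint values is the same `v` on each of them, and the lines have total height 1. The open range
of y avoids the vertices, where φ need not even be continuous; integrability over `D` is all that is
asked there. -/
theorem integral_fderiv_fst {D : Set (ℝ × ℝ)} {l r : ℝ → ℝ} (hD : MeasurableSet D)
    (hmem : ∀ x, x ∈ D ↔ x.2 ∈ Ioo (0 : ℝ) 1 ∧ x.1 ∈ Ioo (l x.2) (r x.2))
    (hlr : ∀ y ∈ Ioo (0 : ℝ) 1, l y ≤ r y) {φ : ℝ × ℝ → ℝ}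
    (hint : IntegrableOn (fun x => fderiv ℝ φ x (1, 0)) D)
    (hφ : ∀ y ∈ Ioo (0 : ℝ) 1, ∀ t ∈ Icc (l y) (r y), ContDiffAt ℝ 1 φ (t, y)) {v : ℝ}
    (hv : ∀ y ∈ Ioo (0 : ℝ) 1, φ (r y, y) - φ (l y, y) = v) :
    ∫ x in D, fderiv ℝ φ x (1, 0) = v := by
  rw [← integral_indicator hD, Measure.volume_eq_prod, integral_prod_symm]
  · have key : ∀ y, ∫ t, D.indicator (fun x => fderiv ℝ φ x (1, 0)) (t, y) =
        (Ioo (0 : ℝ) 1).indicator (fun _ => v) y := by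
      intro y
      by_cases hy : y ∈ Ioo (0 : ℝ) 1
      · have hcd : ∀ t ∈ Icc (l y) (r y), ContDiffAt ℝ 1 (fun t => φ (t, y)) t := fun t ht =>
          ContDiffAt.comp (f := fun t : ℝ => (t, y)) t (hφ y hy t ht) (by fun_prop)
        rw [indicator_of_mem hy, ← hv y hy, ← integral_deriv_line (hlr y hy) hcd,
          ← integral_indicator measurableSet_Ioo]
        refine integral_congr_ae (Filter.Eventually.of_forall fun t => ?_)
        by_cases ht : t ∈ Ioo (l y) (r y)
        · have hm : (t, y) ∈ D := (hmem _).2 ⟨hy, ht⟩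
          simp only [indicator_of_mem hm, indicator_of_mem ht]
          have h1 := ((hφ y hy t (Ioo_subset_Icc_self ht)).differentiableAt (by simp)).hasFDerivAt
          have h2 : HasDerivAt (fun t : ℝ => (t, y)) (1, 0) t :=
            (hasDerivAt_id t).prodMk (hasDerivAt_const t y)
          exact (h1.comp_hasDerivAt t h2).deriv.symm
        · have hm : (t, y) ∉ D := fun h => ht ((hmem _).1 h).2
          simp only [indicator_of_notMem hm, indicator_of_notMem ht]
      · rw [indicator_of_notMem hy]
        refine integral_eq_zero_of_ae (Filter.Eventually.of_forall fun t => ?_)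
        exact indicator_of_notMem (fun h => hy ((hmem _).1 h).1) _
    simp only [key]
    rw [integral_indicator measurableSet_Ioo]
    simp
  · rw [← Measure.volume_eq_prod]
    exact (integrable_indicator_iff hD).2 hint

theorem integral_fderiv_snd {D : Set (ℝ × ℝ)} {l r : ℝ → ℝ} (hD : MeasurableSet D)
    (hmem : ∀ x, x ∈ D ↔ x.1 ∈ Ioo (0 : ℝ) 1 ∧ x.2 ∈ Ioo (l x.1) (r x.1))
    (hlr : ∀ y ∈ Ioo (0 : ℝ) 1, l y ≤ r y) {φ : ℝ × ℝ → ℝ}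
    (hint : IntegrableOn (fun x => fderiv ℝ φ x (0, 1)) D)
    (hφ : ∀ y ∈ Ioo (0 : ℝ) 1, ∀ t ∈ Icc (l y) (r y), ContDiffAt ℝ 1 φ (y, t)) {v : ℝ}
    (hv : ∀ y ∈ Ioo (0 : ℝ) 1, φ (y, r y) - φ (y, l y) = v) :
    ∫ x in D, fderiv ℝ φ x (0, 1) = v := by
  rw [← integral_indicator hD, Measure.volume_eq_prod, integral_prod]
  · have key : ∀ y, ∫ t, D.indicator (fun x => fderiv ℝ φ x (0, 1)) (y, t) =
        (Ioo (0 : ℝ) 1).indicator (fun _ => v) y := by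
      intro y
      by_cases hy : y ∈ Ioo (0 : ℝ) 1
      · have hcd : ∀ t ∈ Icc (l y) (r y), ContDiffAt ℝ 1 (fun t => φ (y, t)) t := fun t ht =>
          ContDiffAt.comp (f := fun t : ℝ => (y, t)) t (hφ y hy t ht) (by fun_prop)
        rw [indicator_of_mem hy, ← hv y hy, ← integral_deriv_line (hlr y hy) hcd,
          ← integral_indicator measurableSet_Ioo]
        refine integral_congr_ae (Filter.Eventually.of_forall fun t => ?_)
        by_cases ht : t ∈ Ioo (l y) (r y)
        · have hm : (y, t) ∈ D := (hmem _).2 ⟨hy, ht⟩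
          simp only [indicator_of_mem hm, indicator_of_mem ht]
          have h1 := ((hφ y hy t (Ioo_subset_Icc_self ht)).differentiableAt (by simp)).hasFDerivAt
          have h2 : HasDerivAt (fun t : ℝ => (y, t)) (0, 1) t :=
            (hasDerivAt_const t y).prodMk (hasDerivAt_id t)
          exact (h1.comp_hasDerivAt t h2).deriv.symm
        · have hm : (y, t) ∉ D := fun h => ht ((hmem _).1 h).2
          simp only [indicator_of_notMem hm, indicator_of_notMem ht]
      · rw [indicator_of_notMem hy]
        refine integral_eq_zero_of_ae (Filter.Eventually.of_forall fun t => ?_)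
        exact indicator_of_notMem (fun h => hy ((hmem _).1 h).1) _
    simp only [key]
    rw [integral_indicator measurableSet_Ioo]
    simp
  · rw [← Measure.volume_eq_prod]
    exact (integrable_indicator_iff hD).2 hint

theorem contDiffAt_cutoff_square (e : Fin 4) {x : ℝ × ℝ} (hx : den .square x ≠ 0) :
    ContDiffAt ℝ 1 (cutoff squareEdge e) x := by
  rw [cutoff_square_eq]
  exact ((contDiff_squareNum e).contDiffAt.div (contDiff_den _).contDiffAt hx).of_le (by simp)

theorem contDiffAt_cutoff_triangle (e : Fin 3) {x : ℝ × ℝ} (hx : den .triangle x ≠ 0) :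
    ContDiffAt ℝ 1 (cutoff triangleEdge e) x := by
  rw [cutoff_triangle_eq]
  exact ((contDiff_triangleNum e).contDiffAt.div (contDiff_den _).contDiffAt hx).of_le (by simp)

/-- The outward normals of the unit square. -/
def squareNormal : Fin 4 → ℝ × ℝ := ![(0, -1), (1, 0), (0, 1), (-1, 0)]

/-- The outward normals of the unit triangle, multiplied by the lengths of the edges. -/
def triangleNormal : Fin 3 → ℝ × ℝ := ![(0, -1), (1, 0), (-1, 1)]

/-- Here the boundary values of the cutoffs enter: they make Green's definition of the flux agree
with the normal component of a constant field. -/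
theorem integral_fderiv_cutoff_square (e : Fin 4) :
    ∫ x in Shape.square.dom, fderiv ℝ (cutoff squareEdge e) x (1, 0) = (squareNormal e).1 ∧
      ∫ x in Shape.square.dom, fderiv ℝ (cutoff squareEdge e) x (0, 1) = (squareNormal e).2 := by
  have hf := isEdgeFun_cutoff_square e
  constructor
  · refine integral_fderiv_fst (l := fun _ => 0) (r := fun _ => 1) (measurableSet_dom _)
      (fun x => ?_) (fun _ _ => zero_le_one) (integrableOn_fderiv hf _ (Or.inl rfl))
      (fun y hy t ht => contDiffAt_cutoff_square e ?_) (fun y hy => ?_)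
    · simp only [Shape.dom, mem_ofPred_eq, mem_Ioo]; tauto
    · have h1 := mul_pos hy.1 (sub_pos.2 hy.2)
      have h2 := mul_nonneg ht.1 (sub_nonneg.2 ht.2)
      simp only [den]; linarith
    · have h1 : y * (1 - y) ≠ 0 := (mul_pos hy.1 (sub_pos.2 hy.2)).ne'
      have h2 : y ≠ 0 := hy.1.ne'
      have h3 : 1 - y ≠ 0 := (sub_pos.2 hy.2).ne'
      simp only [cutoff_square_eq, den]
      fin_cases e <;> simp [squareNum, squareNormal, h2, h3]
  · refine integral_fderiv_snd (l := fun _ => 0) (r := fun _ => 1) (measurableSet_dom _)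
      (fun x => ?_) (fun _ _ => zero_le_one) (integrableOn_fderiv hf _ (Or.inr rfl))
      (fun y hy t ht => contDiffAt_cutoff_square e ?_) (fun y hy => ?_)
    · simp only [Shape.dom, mem_ofPred_eq, mem_Ioo]; tauto
    · have h1 := mul_pos hy.1 (sub_pos.2 hy.2)
      have h2 := mul_nonneg ht.1 (sub_nonneg.2 ht.2)
      simp only [den]; linarith
    · have h2 : y ≠ 0 := hy.1.ne'
      have h3 : 1 - y ≠ 0 := (sub_pos.2 hy.2).ne'
      simp only [cutoff_square_eq, den]
      fin_cases e <;> simp [squareNum, squareNormal, h2, h3] <;> field_simp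

theorem integral_fderiv_cutoff_triangle (e : Fin 3) :
    ∫ x in Shape.triangle.dom, fderiv ℝ (cutoff triangleEdge e) x (1, 0) = (triangleNormal e).1 ∧
      ∫ x in Shape.triangle.dom, fderiv ℝ (cutoff triangleEdge e) x (0, 1) =
        (triangleNormal e).2 := by
  have hf := isEdgeFun_cutoff_triangle e
  constructor
  · refine integral_fderiv_fst (l := fun y => y) (r := fun _ => 1) (measurableSet_dom _)
      (fun x => ?_) (fun _ h => h.2.le) (integrableOn_fderiv hf _ (Or.inl rfl))
      (fun y hy t ht => contDiffAt_cutoff_triangle e ?_) (fun y hy => ?_)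
    · simp only [Shape.dom, mem_ofPred_eq, mem_Ioo]
      constructor
      · rintro ⟨a, b, c, d⟩; exact ⟨⟨c, d.trans b⟩, d, b⟩
      · rintro ⟨⟨a, b⟩, c, d⟩; exact ⟨a.trans c, d, a, c⟩
    · have h1 := mul_pos hy.1 (sub_pos.2 hy.2)
      have h2 := mul_nonneg (sub_nonneg.2 ht.1) (sub_nonneg.2 ht.2)
      simp only [den]; nlinarith
    · have h2 : y ≠ 0 := hy.1.ne'
      have h3 : 1 - y ≠ 0 := (sub_pos.2 hy.2).ne'
      simp only [cutoff_triangle_eq, den]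
      fin_cases e <;> simp [triangleNum, triangleNormal, h2, h3]
  · refine integral_fderiv_snd (l := fun _ => 0) (r := fun y => y) (measurableSet_dom _)
      (fun x => ?_) (fun _ h => h.1.le) (integrableOn_fderiv hf _ (Or.inr rfl))
      (fun y hy t ht => contDiffAt_cutoff_triangle e ?_) (fun y hy => ?_)
    · simp only [Shape.dom, mem_ofPred_eq, mem_Ioo]; tauto
    · have h1 := mul_pos hy.1 (sub_pos.2 hy.2)
      have h2 := mul_nonneg ht.1 (sub_nonneg.2 ht.2)
      simp only [den]; nlinarith
    · have h2 : y ≠ 0 := hy.1.ne'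
      have h3 : 1 - y ≠ 0 := (sub_pos.2 hy.2).ne'
      simp only [cutoff_triangle_eq, den]
      fin_cases e <;> simp [triangleNum, triangleNormal, h2, h3]

/-- Reproduction of constants; it permits comparing U with the constant field U(y) for every y. -/
theorem squareRT_const (c : 𝕜 × 𝕜) (x : ℝ × ℝ) :
    squareRT (fun e => greenPairing Shape.square.dom (cutoff squareEdge e) (fun _ => c) 0) x = c := by
  have h : ∀ e, greenPairing Shape.square.dom (cutoff squareEdge e) (fun _ => c) 0 =
      (squareNormal e).1 • c.1 + (squareNormal e).2 • c.2 := fun e => by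
    rw [greenPairing_const (isEdgeFun_cutoff_square e), (integral_fderiv_cutoff_square e).1,
      (integral_fderiv_cutoff_square e).2]
  ext <;> simp [squareRT, h, squareNormal]

theorem triangleRT_const (c : 𝕜 × 𝕜) (x : ℝ × ℝ) :
    triangleRT (fun e => greenPairing Shape.triangle.dom (cutoff triangleEdge e)
      (fun _ => c) 0) x = c := by
  have h : ∀ e, greenPairing Shape.triangle.dom (cutoff triangleEdge e) (fun _ => c) 0 =
      (triangleNormal e).1 • c.1 + (triangleNormal e).2 • c.2 := fun e => by
    rw [greenPairing_const (isEdgeFun_cutoff_triangle e), (integral_fderiv_cutoff_triangle e).1,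
      (integral_fderiv_cutoff_triangle e).2]
  ext <;> simp [triangleRT, h, triangleNormal]

end GradedRT
end

/-! ### The flux depends only on the boundary values of the test function. -/

noncomputable section

namespace GradedRT
open scoped ENNReal NNReal

variable {𝕜 : Type*} [RCLike 𝕜]

/-! ### Test functions vanishing on the boundary of the square -/

theorem isEdgeFun_of_contDiff {S : Shape} {φ : ℝ × ℝ → ℝ} (hφ : ContDiff ℝ ∞ φ)
    (hc : HasCompactSupport φ) : IsEdgeFun S φ := by
  obtain ⟨B, hB⟩ := hφ.continuous.bounded_above_of_compact_support hc
  obtain ⟨A, A0, hA⟩ := exists_fderiv_bound hφ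
  refine ⟨fun x _ => hφ.contDiffAt, ⟨B, (norm_nonneg _).trans (hB 0), fun x _ => hB x⟩,
    ⟨A, A0, fun x hx => (hA x (dom_subset_square S hx)).trans ?_⟩⟩
  exact le_mul_of_one_le_right A0 ((one_le_inv₀ (den_pos hx)).2 (den_le_one hx))

theorem integral_fderiv_eq_zero {φ : ℝ × ℝ → ℝ} (hφ : ContDiff ℝ ∞ φ) (hc : HasCompactSupport φ)
    (v : ℝ × ℝ) : ∫ x, fderiv ℝ φ x v = 0 := by
  have h1 : Integrable fun x => fderiv ℝ φ x v :=
    ((hφ.continuous_fderiv (by simp)).clm_apply continuous_const).integrable_of_hasCompactSupport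
      (hc.fderiv_apply (𝕜 := ℝ) v)
  have := integral_mul_fderiv_eq_neg_fderiv_mul_of_integrable (𝕜 := ℝ) (μ := volume)
    (f := fun _ : ℝ × ℝ => (1 : ℝ)) (g := φ) (v := v) (by simp) (by simpa using h1)
    (by simpa using hφ.continuous.integrable_of_hasCompactSupport hc)
    (by simp) (fun x _ => hφ.differentiable (by simp) x)
  simpa using this

theorem setIntegral_fderiv_eq_zero {D : Set (ℝ × ℝ)} {φ : ℝ × ℝ → ℝ} (hφ : ContDiff ℝ ∞ φ)
    (hc : HasCompactSupport φ) (hD : tsupport φ ⊆ D) (v : ℝ × ℝ) :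
    ∫ x in D, fderiv ℝ φ x v = 0 := by
  rw [setIntegral_eq_integral_of_forall_compl_eq_zero, integral_fderiv_eq_zero hφ hc]
  intro x hx
  have : fderiv ℝ φ x = 0 := by
    by_contra h
    exact hx (hD (support_fderiv_subset ℝ h))
  simp [this]

theorem WeakDiv.sub_const {S : Shape} {u : ℝ × ℝ → 𝕜 × 𝕜} (hu : StronglyMeasurable u)
    (hu' : ∫⁻ x in S.dom, denWeight S x * ‖u x‖ₑ < ⊤) {f : 𝕜} (h : WeakDiv S.dom u f)
    (c : 𝕜 × 𝕜) : WeakDiv S.dom (fun x => u x - c) f := by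
  intro φ hφ hc hs
  have hf := isEdgeFun_of_contDiff (S := S) hφ hc
  have := h φ hφ hc hs
  rw [greenPairing_eq_const_add hf hu hu' f c, greenPairing_const hf,
    setIntegral_fderiv_eq_zero hφ hc hs, setIntegral_fderiv_eq_zero hφ hc hs] at this
  simpa using this

theorem deriv_smoothTransition_of_nonpos {z : ℝ} (hz : z ≤ 0) :
    deriv Real.smoothTransition z = 0 := by
  refine IsLocalMin.deriv_eq_zero (Filter.Eventually.of_forall fun y => ?_)
  rw [Real.smoothTransition.zero_of_nonpos hz]
  exact Real.smoothTransition.nonneg y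

theorem deriv_smoothTransition_of_one_le {z : ℝ} (hz : 1 ≤ z) :
    deriv Real.smoothTransition z = 0 := by
  refine IsLocalMax.deriv_eq_zero (Filter.Eventually.of_forall fun y => ?_)
  rw [Real.smoothTransition.one_of_one_le hz]
  exact Real.smoothTransition.le_one y

theorem exists_deriv_smoothTransition_le :
    ∃ M : ℝ, 0 ≤ M ∧ ∀ z, |deriv Real.smoothTransition z| ≤ M := by
  have hc : Continuous (deriv Real.smoothTransition) :=
    (Real.smoothTransition.contDiff (n := 1)).continuous_deriv le_rfl
  obtain ⟨M, hM⟩ := (isCompact_Icc (a := (0 : ℝ)) (b := 1)).bddAbove_image hc.abs.continuousOn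
  refine ⟨max M 0, le_max_right _ _, fun z => ?_⟩
  rcases le_total z 0 with h | h
  · simp [deriv_smoothTransition_of_nonpos h]
  rcases le_total 1 z with h' | h'
  · simp [deriv_smoothTransition_of_one_le h']
  · exact (hM ⟨z, ⟨h, h'⟩, rfl⟩).trans (le_max_left _ _)

theorem hasDerivAt_smoothTransition (z : ℝ) :
    HasDerivAt Real.smoothTransition (deriv Real.smoothTransition z) z :=
  ((Real.smoothTransition.contDiff (n := 1)).differentiable (by simp) z).hasDerivAt

theorem hasDerivAt_bub (t : ℝ) : HasDerivAt bub (1 - 2 * t) t := by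
  have := (hasDerivAt_id t).mul ((hasDerivAt_const t (1 : ℝ)).sub (hasDerivAt_id t))
  refine this.congr_deriv ?_
  simp; ring

theorem contDiff_bub : ContDiff ℝ ∞ bub := by unfold bub; fun_prop

theorem bub_pos {t : ℝ} (h0 : 0 < t) (h1 : t < 1) : 0 < bub t := mul_pos h0 (sub_pos.2 h1)

theorem bub_le {t : ℝ} : bub t ≤ 1 / 4 := by rw [bub]; nlinarith [sq_nonneg (t - 1 / 2)]

/-- The product bubble function of the unit square. -/
def bubble (x : ℝ × ℝ) : ℝ := bub x.1 * bub x.2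

theorem contDiff_bubble : ContDiff ℝ ∞ bubble :=
  (contDiff_bub.comp contDiff_fst).mul (contDiff_bub.comp contDiff_snd)

theorem norm_fderiv_bubble_le {x : ℝ × ℝ} (hx : x ∈ Shape.square.dom) :
    ‖fderiv ℝ bubble x‖ ≤ bub x.1 + bub x.2 := by
  obtain ⟨a, b, c, d⟩ := hx
  have h1 : HasFDerivAt (fun x : ℝ × ℝ => bub x.1)
      ((1 - 2 * x.1) • ContinuousLinearMap.fst ℝ ℝ ℝ) x :=
    (hasDerivAt_bub x.1).comp_hasFDerivAt x hasFDerivAt_fst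
  have h2 : HasFDerivAt (fun x : ℝ × ℝ => bub x.2)
      ((1 - 2 * x.2) • ContinuousLinearMap.snd ℝ ℝ ℝ) x :=
    (hasDerivAt_bub x.2).comp_hasFDerivAt x hasFDerivAt_snd
  have e : fderiv ℝ bubble x = _ := (h1.mul h2).fderiv
  rw [e]
  refine (norm_add_le _ _).trans (add_le_add ?_ ?_)
  · rw [norm_smul, norm_smul, Real.norm_of_nonneg (bub_pos a b).le]
    refine mul_le_of_le_one_right (bub_pos a b).le (mul_le_one₀ ?_ (norm_nonneg _)
      (ContinuousLinearMap.norm_snd_le ℝ ℝ ℝ))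
    rw [Real.norm_eq_abs, abs_le]; constructor <;> linarith
  · rw [norm_smul, norm_smul, Real.norm_of_nonneg (bub_pos c d).le]
    refine mul_le_of_le_one_right (bub_pos c d).le (mul_le_one₀ ?_ (norm_nonneg _)
      (ContinuousLinearMap.norm_fst_le ℝ ℝ ℝ))
    rw [Real.norm_eq_abs, abs_le]; constructor <;> linarith

theorem mem_square_of_bub_pos {x : ℝ × ℝ} (h1 : 0 < bub x.1) (h2 : 0 < bub x.2) :
    x ∈ Shape.square.dom := by
  unfold bub at h1 h2
  refine ⟨?_, ?_, ?_, ?_⟩ <;> by_contra h <;> push Not at h <;> nlinarith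

/-- Green's formula for test functions that vanish on the boundary, except at the vertices. -/
theorem greenPairing_eq_zero {ψ : ℝ × ℝ → ℝ} (hψ : IsEdgeFun .square ψ) {A : ℝ} (A0 : 0 ≤ A)
    (hA : ∀ x ∈ Shape.square.dom, |ψ x| ≤ A * bub x.1 * (den .square x)⁻¹ ∧
      |ψ x| ≤ A * bub x.2 * (den .square x)⁻¹)
    {u : ℝ × ℝ → 𝕜 × 𝕜} (hu : StronglyMeasurable u)
    (hu' : ∫⁻ x in Shape.square.dom, denWeight .square x * ‖u x‖ₑ < ⊤) {f : 𝕜}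
    (h : WeakDiv Shape.square.dom u f) : greenPairing Shape.square.dom ψ u f = 0 := by
  obtain ⟨M, M0, hM⟩ := exists_deriv_smoothTransition_le
  obtain ⟨B, B0, hB⟩ := hψ.bound
  obtain ⟨A', A0', hA'⟩ := hψ.fderiv_bound
  set D := Shape.square.dom with hD
  have hDm : MeasurableSet D := measurableSet_dom _
  -- The cutoff χ n vanishes where (n + 1) · bubble ≤ 1/2 and equals 1 where (n + 1) · bubble ≥ 1;
  -- the former keeps its support compact inside the open square.
  set g : ℕ → ℝ × ℝ → ℝ := fun n x => 2 * ((n + 1) * bubble x) - 1 with hg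
  have hgs : ∀ n, ContDiff ℝ ∞ (g n) := fun n => by
    have := contDiff_bubble
    simp only [hg]; fun_prop
  set χ : ℕ → ℝ × ℝ → ℝ := fun n x => Real.smoothTransition (g n x) with hχ
  have hχs : ∀ n, ContDiff ℝ ∞ (χ n) := fun n => Real.smoothTransition.contDiff.comp (hgs n)
  set ψn : ℕ → ℝ × ℝ → ℝ := fun n => D.indicator fun x => χ n x * ψ x with hψn
  have hbpos : ∀ x ∈ D, 0 < bubble x := fun x hx =>
    mul_pos (bub_pos hx.1 hx.2.1) (bub_pos hx.2.2.1 hx.2.2.2)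
  -- the approximating functions are compactly supported
  set K : ℕ → Set (ℝ × ℝ) := fun n => (Icc 0 1 ×ˢ Icc 0 1) ∩ {x | 0 ≤ g n x} with hK
  have hKc : ∀ n, IsCompact (K n) := fun n =>
    (isCompact_Icc.prod isCompact_Icc).inter_right
      (isClosed_le continuous_const (hgs n).continuous)
  have hKD : ∀ n, K n ⊆ D := by
    rintro n x ⟨⟨h1, h2⟩, h3⟩
    have b1 : 0 ≤ bub x.1 := mul_nonneg h1.1 (sub_nonneg.2 h1.2)
    have b2 : 0 ≤ bub x.2 := mul_nonneg h2.1 (sub_nonneg.2 h2.2)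
    have h4 : 0 < bubble x := by
      have : 0 ≤ g n x := h3
      simp only [hg] at this
      have h5 : (0 : ℝ) < n + 1 := by positivity
      by_contra h6
      nlinarith
    have h5 : bub x.1 ≠ 0 := fun h0 => by simp [bubble, h0] at h4
    have h6 : bub x.2 ≠ 0 := fun h0 => by simp [bubble, h0] at h4
    exact mem_square_of_bub_pos (b1.lt_of_ne' h5) (b2.lt_of_ne' h6)
  have hz : ∀ n, ∀ x ∉ K n, ψn n x = 0 := by
    intro n x hx
    by_cases hxD : x ∈ D
    · have : g n x < 0 := by
        by_contra h0
        exact hx ⟨⟨⟨hxD.1.le, hxD.2.1.le⟩, hxD.2.2.1.le, hxD.2.2.2.le⟩, not_lt.1 h0⟩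
      simp only [hψn, indicator_of_mem hxD, hχ, Real.smoothTransition.zero_of_nonpos this.le,
        zero_mul]
    · exact indicator_of_notMem hxD _
  have hsupp : ∀ n, HasCompactSupport (ψn n) := fun n => HasCompactSupport.intro (hKc n) (hz n)
  have htsupp : ∀ n, tsupport (ψn n) ⊆ D := fun n =>
    (closure_minimal (Function.support_subset_iff'.2 (hz n)) (hKc n).isClosed).trans
      (hKD n)
  have hloc : ∀ n, ∀ x ∈ D, ψn n =ᶠ[nhds x] fun y => χ n y * ψ y := fun n x hx => by
    filter_upwards [(isOpen_dom _).mem_nhds hx] with y hy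
    exact indicator_of_mem hy _
  have hsm : ∀ n, ContDiff ℝ ∞ (ψn n) := by
    intro n
    refine contDiff_iff_contDiffAt.2 fun x => ?_
    by_cases hx : x ∈ D
    · exact ((hχs n).contDiffAt.mul (hψ.contDiffAt x hx)).congr_of_eventuallyEq (hloc n x hx)
    · have h0 : ψn n =ᶠ[nhds x] fun _ => 0 := by
        filter_upwards [(hKc n).isClosed.isOpen_compl.mem_nhds fun h' => hx (hKD n h')] with y hy
        exact hz n y hy
      exact contDiffAt_const.congr_of_eventuallyEq h0
  have hzero : ∀ n, greenPairing D (ψn n) u f = 0 := fun n => h _ (hsm n) (hsupp n) (htsupp n)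
  -- domination
  have hfd : ∀ n, ∀ x ∈ D, ‖fderiv ℝ (ψn n) x‖ ≤ (A' + 4 * M * A) * (den .square x)⁻¹ := by
    intro n x hx
    have hd := den_pos hx
    have b1 := bub_pos hx.1 hx.2.1
    have b2 := bub_pos hx.2.2.1 hx.2.2.2
    have hgd : HasFDerivAt (g n) ((2 * ((n : ℝ) + 1)) • fderiv ℝ bubble x) x := by
      have := (((contDiff_bubble.differentiable (by simp) x).hasFDerivAt.const_mul
        ((n : ℝ) + 1)).const_mul 2).sub_const 1
      rwa [smul_smul] at this
    have hχd : HasFDerivAt (χ n) (deriv Real.smoothTransition (g n x) •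
        ((2 * ((n : ℝ) + 1)) • fderiv ℝ bubble x)) x :=
      (hasDerivAt_smoothTransition _).comp_hasFDerivAt x hgd
    have hψd := ((hψ.contDiffAt x hx).differentiableAt (by simp)).hasFDerivAt
    have e0 : fderiv ℝ (fun y => χ n y * ψ y) x = _ := (hχd.mul hψd).fderiv
    rw [(hloc n x hx).fderiv_eq, e0, add_mul]
    refine (norm_add_le _ _).trans (add_le_add ?_ ?_)
    · rw [norm_smul]
      refine (mul_le_of_le_one_left (norm_nonneg _) ?_).trans (hA' x hx)
      rw [Real.norm_of_nonneg (Real.smoothTransition.nonneg _)]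
      exact Real.smoothTransition.le_one _
    · have hχn : ‖deriv Real.smoothTransition (g n x) • ((2 * ((n : ℝ) + 1)) •
          fderiv ℝ bubble x)‖ ≤ 2 * M * (bubble x)⁻¹ * (bub x.1 + bub x.2) := by
        rw [norm_smul, norm_smul, ← mul_assoc]
        refine mul_le_mul ?_ (norm_fderiv_bubble_le hx) (norm_nonneg _)
          (by have := hbpos x hx; positivity)
        rcases le_total 1 (g n x) with h1 | h1
        · rw [deriv_smoothTransition_of_one_le h1]
          have := hbpos x hx
          simp; positivity
        · have h2 : ((n : ℝ) + 1) ≤ (bubble x)⁻¹ := by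
            rw [← one_div, le_div_iff₀ (hbpos x hx)]
            simp only [hg] at h1; linarith
          rw [Real.norm_eq_abs, Real.norm_of_nonneg (by positivity)]
          calc _ ≤ M * (2 * (bubble x)⁻¹) := by
                gcongr
                exact hM _
            _ = _ := by ring
      rw [norm_smul, Real.norm_eq_abs]
      refine (mul_le_mul_of_nonneg_left hχn (abs_nonneg _)).trans ?_
      obtain ⟨h1, h2⟩ := hA x hx
      have e : |ψ x| * (2 * M * (bubble x)⁻¹ * (bub x.1 + bub x.2)) =
          2 * M * (|ψ x| * (bub x.2)⁻¹ + |ψ x| * (bub x.1)⁻¹) := by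
        rw [bubble]; field_simp
      have h3 : |ψ x| * (bub x.2)⁻¹ ≤ A * (den .square x)⁻¹ := by
        rw [← div_eq_mul_inv, div_le_iff₀ b2]; linarith
      have h4 : |ψ x| * (bub x.1)⁻¹ ≤ A * (den .square x)⁻¹ := by
        rw [← div_eq_mul_inv, div_le_iff₀ b1]; linarith
      rw [e]
      nlinarith
  have hbd : ∀ n, ∀ x ∈ D, |ψn n x| ≤ B := by
    intro n x hx
    rw [show ψn n x = χ n x * ψ x from indicator_of_mem hx _, abs_mul,
      abs_of_nonneg (Real.smoothTransition.nonneg _)]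
    exact (mul_le_of_le_one_left (abs_nonneg _) (Real.smoothTransition.le_one _)).trans (hB x hx)
  -- This dominating function is integrable because u is integrable against 1/den, which is the
  -- hypothesis `hu'`.
  set bound : ℝ × ℝ → ℝ := fun x => 2 * (A' + 4 * M * A) * ((den .square x)⁻¹ * ‖u x‖) + B * ‖f‖
    with hbound
  have hint : IntegrableOn bound D := by
    refine Integrable.add (Integrable.const_mul ⟨?_, ?_⟩ _) (integrableOn_const ?_)
    · exact ((contDiff_den _).continuous.measurable.inv.aestronglyMeasurable).mul
        hu.norm.aestronglyMeasurable
    · refine lt_of_eq_of_lt (setLIntegral_congr_fun hDm fun x hx => ?_) hu'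
      have := den_pos hx
      rw [denWeight, enorm_mul, enorm_norm, Real.enorm_of_nonneg (by positivity)]
    · rw [hD, volume_square]; simp
  have hlim : Filter.Tendsto (fun n => greenPairing D (ψn n) u f) Filter.atTop
      (nhds (greenPairing D ψ u f)) := by
    refine tendsto_integral_of_dominated_convergence bound (fun n => ?_) hint (fun n => ?_) ?_
    · exact aestronglyMeasurable_greenDensity (isEdgeFun_of_contDiff (hsm n) (hsupp n)) hu f
    · filter_upwards [self_mem_ae_restrict hDm] with x hx
      have hd := den_pos hx
      have := enorm_greenDensity_le (u := u) (f := f) (hfd n x hx) (hbd n x hx)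
      rw [← ofReal_norm (u x), ← ofReal_norm f, ← ofReal_norm, ← ENNReal.ofReal_mul (by positivity),
        ← ENNReal.ofReal_mul B0, ← ENNReal.ofReal_add (by positivity) (by positivity),
        ENNReal.ofReal_le_ofReal_iff (by positivity)] at this
      refine this.trans_eq ?_
      simp only [hbound]; ring
    · filter_upwards [self_mem_ae_restrict hDm] with x hx
      have hb := hbpos x hx
      obtain ⟨n₀, hn₀⟩ := exists_nat_gt (bubble x)⁻¹
      refine tendsto_const_nhds.congr' ?_
      filter_upwards [Filter.eventually_ge_atTop n₀] with n hn
      have h1 : 1 < g n x := by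
        have h2 : (bubble x)⁻¹ < (n : ℝ) := hn₀.trans_le (by exact_mod_cast hn)
        rw [inv_lt_iff_one_lt_mul₀ hb] at h2
        simp only [hg]; nlinarith
      -- Equality near x, not just at x, so that the gradients agree for large n as well.
      have h3 : ψn n =ᶠ[nhds x] ψ := by
        filter_upwards [hloc n x hx, (hgs n).continuous.continuousAt.eventually (lt_mem_nhds h1)]
          with y hy hy'
        rw [hy, hχ]
        simp only [Real.smoothTransition.one_of_one_le hy'.le, one_mul]
      simp only [greenDensity]
      rw [h3.fderiv_eq, h3.self_of_nhds]
  simp only [hzero] at hlim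
  exact tendsto_nhds_unique hlim tendsto_const_nhds

end GradedRT
end

/-! ### Control of the constant divergence, and a thin test function at the left edge. -/

noncomputable section

namespace GradedRT
open scoped ENNReal NNReal

variable {𝕜 : Type*} [RCLike 𝕜]

/-! ### The constant divergence is controlled by the field -/

/-- For one fixed bump φ with positive integral, the weak equation reads f ∫φ = −∫∇φ · u, and ∇φ is
bounded. This is an inverse estimate available only because the divergence is constant. -/
theorem exists_enorm_div_le (𝕜 : Type*) [RCLike 𝕜] (S : Shape) : ∃ C : ℝ≥0, ∀ (u : ℝ × ℝ → 𝕜 × 𝕜) (f : 𝕜),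
    StronglyMeasurable u → ∫⁻ x in S.dom, denWeight S x * ‖u x‖ₑ < ⊤ → WeakDiv S.dom u f →
      ‖f‖ₑ ≤ C * ∫⁻ x in S.dom, ‖u x‖ₑ := by
  have hne : S.dom.Nonempty := by
    refine nonempty_of_measure_ne_zero (μ := volume) fun h0 => ?_
    have := le_volume_dom S
    simp [h0] at this
  obtain ⟨x₀, hx₀⟩ := hne
  obtain ⟨φ, hs, hc, hφ, hr, h1⟩ := exists_contDiff_tsupport_subset (n := ⊤)
    ((isOpen_dom S).mem_nhds hx₀)
  have hI : 0 < ∫ x in S.dom, φ x := by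
    rw [setIntegral_eq_integral_of_forall_compl_eq_zero]
    · exact hφ.continuous.integral_pos_of_hasCompactSupport_nonneg_nonzero hc
        (fun x => (hr ⟨x, rfl⟩).1) (by rw [h1]; exact one_ne_zero)
    · exact fun x hx => image_eq_zero_of_notMem_tsupport fun h => hx (hs h)
  set I := ∫ x in S.dom, φ x with hIdef
  obtain ⟨A, A0, hA⟩ := exists_fderiv_bound hφ
  have hf := isEdgeFun_of_contDiff (S := S) hφ hc
  obtain ⟨B, B0, hB⟩ := hf.bound
  refine ⟨Real.toNNReal (I⁻¹ * (2 * A)), fun u f hu hu' h => ?_⟩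
  have hφi : IntegrableOn φ S.dom := (hφ.continuous.integrable_of_hasCompactSupport hc).integrableOn
  have e : greenPairing S.dom φ u f = greenPairing S.dom φ u 0 + I • f := by
    rw [hIdef, ← integral_smul_const, greenPairing, greenPairing,
      ← integral_add (integrableOn_greenDensity hf hu hu' 0) (hφi.smul_const f)]
    refine integral_congr_ae (Filter.Eventually.of_forall fun x => ?_)
    simp [greenDensity]
  rw [h φ hφ hc hs] at e
  have e2 : f = I⁻¹ • -greenPairing S.dom φ u 0 := by
    rw [eq_inv_smul_iff₀ hI.ne', eq_neg_iff_add_eq_zero, add_comm]; exact e.symm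
  rw [e2, enorm_smul, enorm_neg, Real.enorm_of_nonneg (inv_nonneg.2 hI.le)]
  calc _ ≤ ENNReal.ofReal I⁻¹ * ∫⁻ x in S.dom, ENNReal.ofReal (2 * A) * ‖u x‖ₑ := by
        gcongr
        refine (enorm_integral_le_lintegral_enorm _).trans
          (setLIntegral_mono' (measurableSet_dom S) fun x hx => ?_)
        refine (enorm_greenDensity_le (hA x (dom_subset_square S hx)) (hB x hx)).trans_eq ?_
        simp
    _ = _ := by
        rw [lintegral_const_mul' _ _ ENNReal.ofReal_ne_top, ← mul_assoc,
          ← ENNReal.ofReal_mul (by positivity)]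
        rfl

/-! ### A test function for the flux through a short edge -/

/-- A function that is `1` on the left edge of the square and vanishes for `x₁ ≥ ε x₂ (1 - x₂)`. -/
def leftFun (ε : ℝ) (x : ℝ × ℝ) : ℝ := Real.smoothTransition (1 - x.1 * (ε * bub x.2)⁻¹)

theorem contDiffAt_leftFun {ε : ℝ} (hε : 0 < ε) {x : ℝ × ℝ} (hx : x ∈ Shape.square.dom) :
    ContDiffAt ℝ ∞ (leftFun ε) x := by
  have h := (mul_pos hε (bub_pos hx.2.2.1 hx.2.2.2)).ne'
  have h1 : ContDiffAt ℝ ∞ (fun x : ℝ × ℝ => ε * bub x.2) x :=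
    contDiffAt_const.mul (contDiff_bub.comp contDiff_snd).contDiffAt
  exact Real.smoothTransition.contDiff.contDiffAt.comp x
    (contDiffAt_const.sub (contDiffAt_fst.mul (h1.inv h)))

theorem leftFun_eq_zero {ε : ℝ} (hε : 0 < ε) {x : ℝ × ℝ} (hx : x ∈ Shape.square.dom)
    (h : ε * bub x.2 ≤ x.1) : leftFun ε x = 0 := by
  refine Real.smoothTransition.zero_of_nonpos ?_
  rw [sub_nonpos, ← div_eq_mul_inv, one_le_div (mul_pos hε (bub_pos hx.2.2.1 hx.2.2.2))]
  exact h

theorem leftFun_nonneg (ε : ℝ) (x : ℝ × ℝ) : 0 ≤ leftFun ε x := Real.smoothTransition.nonneg _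

theorem leftFun_le_one (ε : ℝ) (x : ℝ × ℝ) : leftFun ε x ≤ 1 := Real.smoothTransition.le_one _

open Classical in
/-- The gradient of `leftFun`. -/
theorem fderiv_leftFun_le {M : ℝ} (hM : ∀ z, |deriv Real.smoothTransition z| ≤ M)
    {ε : ℝ} (hε : 0 < ε) {x : ℝ × ℝ} (hx : x ∈ Shape.square.dom) :
    |fderiv ℝ (leftFun ε) x (1, 0)| ≤ (if x.1 < ε * bub x.2 then M * (ε * bub x.2)⁻¹ else 0) ∧
      |fderiv ℝ (leftFun ε) x (0, 1)| ≤
        ε * (if x.1 < ε * bub x.2 then M * (ε * bub x.2)⁻¹ else 0) := by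
  have hb := bub_pos hx.2.2.1 hx.2.2.2
  have hp := mul_pos hε hb
  have M0 : 0 ≤ M := (abs_nonneg _).trans (hM 0)
  have h2 : HasFDerivAt (fun x : ℝ × ℝ => (ε * bub x.2)⁻¹)
      ((-(ε * (1 - 2 * x.2)) / (ε * bub x.2) ^ 2) • ContinuousLinearMap.snd ℝ ℝ ℝ) x :=
    (((hasDerivAt_bub x.2).const_mul ε).inv hp.ne').comp_hasFDerivAt x hasFDerivAt_snd
  have h3 := (hasFDerivAt_fst (𝕜 := ℝ) (p := x)).mul h2
  have h4 := (hasDerivAt_smoothTransition (1 - x.1 * (ε * bub x.2)⁻¹)).comp_hasFDerivAt x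
    (h3.const_sub 1)
  have e : fderiv ℝ (leftFun ε) x = _ := h4.fderiv
  set s := deriv Real.smoothTransition (1 - x.1 * (ε * bub x.2)⁻¹) with hs
  have e1 : fderiv ℝ (leftFun ε) x (1, 0) = -(s * (ε * bub x.2)⁻¹) := by
    rw [e]; simp
  have e2 : fderiv ℝ (leftFun ε) x (0, 1) =
      s * (x.1 * (ε * (1 - 2 * x.2) / (ε * bub x.2) ^ 2)) := by
    rw [e]; simp; ring
  rw [e1, e2]
  split_ifs with hlt
  · have hsM := hM (1 - x.1 * (ε * bub x.2)⁻¹)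
    rw [← hs] at hsM
    constructor
    · rw [abs_neg, abs_mul, abs_of_pos (inv_pos.2 hp)]
      gcongr
    · have h5 : |x.1 * (ε * (1 - 2 * x.2) / (ε * bub x.2) ^ 2)| ≤ ε * (ε * bub x.2)⁻¹ := by
        rw [abs_mul, abs_div, abs_mul, abs_of_pos hx.1, abs_of_pos hε, abs_of_pos (pow_pos hp 2)]
        have h6 : |1 - 2 * x.2| ≤ 1 := by
          rw [abs_le]; constructor <;> linarith [hx.2.2.1, hx.2.2.2]
        calc _ ≤ (ε * bub x.2) * (ε * 1 / (ε * bub x.2) ^ 2) := by gcongr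
          _ = _ := by field_simp
      rw [abs_mul]
      calc _ ≤ M * (ε * (ε * bub x.2)⁻¹) := by gcongr
        _ = _ := by ring
  · have : s = 0 := by
      refine deriv_smoothTransition_of_nonpos ?_
      rw [sub_nonpos, ← div_eq_mul_inv, one_le_div hp]
      exact not_lt.1 hlt
    simp [this]

/-- On the part of the square where `leftFun` is active, its weight 1/bub x₂ is at most twice the
weight 1/den, so `leftFun` is admissible in Green's formula. -/
theorem den_le_of_lt {ε : ℝ} (h1 : ε ≤ 1) {x : ℝ × ℝ} (hx : x ∈ Shape.square.dom)
    (h : x.1 < ε * bub x.2) : den .square x ≤ 2 * bub x.2 := by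
  have hb := bub_pos hx.2.2.1 hx.2.2.2
  have e : den .square x = x.1 * (1 - x.1) + bub x.2 := rfl
  rw [e]
  nlinarith [hx.1, hx.2.1]

theorem isEdgeFun_leftFun {ε : ℝ} (hε : 0 < ε) (hε1 : ε ≤ 1) : IsEdgeFun .square (leftFun ε) := by
  obtain ⟨M, M0, hM⟩ := exists_deriv_smoothTransition_le
  refine ⟨fun x hx => contDiffAt_leftFun hε hx, ⟨1, zero_le_one, fun x _ => ?_⟩,
    ⟨4 * M * ε⁻¹, by positivity, fun x hx => ?_⟩⟩
  · rw [abs_of_nonneg (leftFun_nonneg _ _)]; exact leftFun_le_one _ _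
  · have hd := den_pos hx
    have hb := bub_pos hx.2.2.1 hx.2.2.2
    obtain ⟨h1, h2⟩ := fderiv_leftFun_le hM hε hx
    have key : (if x.1 < ε * bub x.2 then M * (ε * bub x.2)⁻¹ else 0) ≤
        2 * M * ε⁻¹ * (den .square x)⁻¹ := by
      split_ifs with hlt
      · have h3 : (bub x.2)⁻¹ ≤ 2 * (den .square x)⁻¹ := by
          rw [← div_eq_mul_inv, le_div_iff₀ hd, inv_mul_le_iff₀ hb]
          linarith [den_le_of_lt hε1 hx hlt]
        rw [mul_inv]
        calc M * (ε⁻¹ * (bub x.2)⁻¹) ≤ M * (ε⁻¹ * (2 * (den .square x)⁻¹)) := by gcongr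
          _ = _ := by ring
      · positivity
    have k0 : 0 ≤ 2 * M * ε⁻¹ * (den .square x)⁻¹ := by positivity
    have h3 : |fderiv ℝ (leftFun ε) x (0, 1)| ≤ 2 * M * ε⁻¹ * (den .square x)⁻¹ :=
      (h2.trans (mul_le_mul_of_nonneg_left key hε.le)).trans (mul_le_of_le_one_left k0 hε1)
    refine ContinuousLinearMap.opNorm_le_bound _ (by positivity) fun v => ?_
    have e : fderiv ℝ (leftFun ε) x v =
        v.1 * fderiv ℝ (leftFun ε) x (1, 0) + v.2 * fderiv ℝ (leftFun ε) x (0, 1) := by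
      conv_lhs => rw [show v = v.1 • ((1 : ℝ), (0 : ℝ)) + v.2 • ((0 : ℝ), (1 : ℝ)) by
        ext <;> simp, map_add, map_smul, map_smul]
      simp
    rw [e]
    have n1 : |v.1| ≤ ‖v‖ := norm_fst_le v
    have n2 : |v.2| ≤ ‖v‖ := norm_snd_le v
    calc _ ≤ |v.1| * |fderiv ℝ (leftFun ε) x (1, 0)| + |v.2| * |fderiv ℝ (leftFun ε) x (0, 1)| := by
          refine (norm_add_le _ _).trans_eq ?_
          simp
      _ ≤ ‖v‖ * (2 * M * ε⁻¹ * (den .square x)⁻¹) + ‖v‖ * (2 * M * ε⁻¹ * (den .square x)⁻¹) := by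
          gcongr
          exact h1.trans key
      _ = _ := by ring

/-- Both functions are 1 on the left edge and 0 on the others, so their difference vanishes on the
boundary away from the vertices, at the rate that `greenPairing_eq_zero` requires. The constant may
depend on ε, since it serves only to establish an identity and enters no estimate. -/
theorem cutoff_sub_leftFun_le {ε : ℝ} (hε : 0 < ε) (hε1 : ε ≤ 1) : ∃ A : ℝ, 0 ≤ A ∧
    ∀ x ∈ Shape.square.dom,
      |cutoff squareEdge 3 x - leftFun ε x| ≤ A * bub x.1 * (den .square x)⁻¹ ∧
      |cutoff squareEdge 3 x - leftFun ε x| ≤ A * bub x.2 * (den .square x)⁻¹ := by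
  obtain ⟨M, M0, hM⟩ := exists_deriv_smoothTransition_le
  refine ⟨4 + 4 * M * ε⁻¹ + 4 * ε⁻¹, by positivity, fun x hx => ?_⟩
  have hd := den_pos hx
  have hb := bub_pos hx.2.2.1 hx.2.2.2
  have hb1 := bub_pos hx.1 hx.2.1
  have hb4 : bub x.2 ≤ 1 / 4 := bub_le
  have ε0 : 0 ≤ ε⁻¹ := by positivity
  have hx1 := hx.1
  have hx1' := hx.2.1
  have ed : den .square x = x.1 * (1 - x.1) + bub x.2 := rfl
  have ec : cutoff squareEdge 3 x = bub x.2 * (1 - x.1) / den .square x := by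
    rw [cutoff_square_eq]; simp [squareNum, bub]; ring
  have c0 : 0 ≤ cutoff squareEdge 3 x := by rw [ec]; have := sub_pos.2 hx1'; positivity
  have l0 := leftFun_nonneg ε x
  have l1 := leftFun_le_one ε x
  have Me : 0 ≤ M * ε⁻¹ := by positivity
  have habs : ∀ a b K : ℝ, 0 ≤ a → 0 ≤ b → a ≤ K → b ≤ K → |a - b| ≤ K := by
    intro a b K ha hb h1 h2; rw [abs_le]; constructor <;> linarith
  constructor
  · rw [← div_eq_mul_inv]
    rcases le_or_gt x.1 (1 / 2) with hh | hh
    · have e : cutoff squareEdge 3 x - leftFun ε x = (1 - leftFun ε x) - (1 - cutoff squareEdge 3 x) := by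
        ring
      have hx2 : x.1 ≤ 2 * bub x.1 := by rw [bub]; nlinarith
      rw [e]
      have ec1 : 1 - cutoff squareEdge 3 x = (x.1 * (1 - x.1) + bub x.2 * x.1) / den .square x := by
        rw [ec, eq_div_iff hd.ne', sub_mul, div_mul_cancel₀ _ hd.ne', ed]; ring
      refine habs _ _ _ (by linarith) (by
        rw [ec1]; have := sub_pos.2 hx1'; positivity) ?_ ?_
      · rcases lt_or_ge x.1 (ε * bub x.2) with hlt | hge
        · have hL : 1 - leftFun ε x ≤ M * (x.1 * (ε * bub x.2)⁻¹) := by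
            have := Convex.norm_image_sub_le_of_norm_deriv_le (𝕜 := ℝ) (s := univ)
              (f := Real.smoothTransition) (C := M)
              (fun z _ => (hasDerivAt_smoothTransition z).differentiableAt) (fun z _ => hM z)
              convex_univ (mem_univ (1 - x.1 * (ε * bub x.2)⁻¹)) (mem_univ 1)
            rw [Real.smoothTransition.one] at this
            have h5 : 0 ≤ x.1 * (ε * bub x.2)⁻¹ := by positivity
            rw [sub_sub_cancel, Real.norm_of_nonneg h5] at this
            exact (le_abs_self _).trans this
          refine hL.trans ?_
          rw [le_div_iff₀ hd]
          have hden := den_le_of_lt hε1 hx hlt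
          calc M * (x.1 * (ε * bub x.2)⁻¹) * den .square x
              ≤ M * (x.1 * (ε * bub x.2)⁻¹) * (2 * bub x.2) := by gcongr
            _ = 2 * M * ε⁻¹ * x.1 := by field_simp
            _ ≤ 2 * M * ε⁻¹ * (2 * bub x.1) := by gcongr
            _ ≤ _ := by nlinarith
        · rw [leftFun_eq_zero hε hx hge, sub_zero, le_div_iff₀ hd, one_mul]
          have h6 : bub x.2 ≤ ε⁻¹ * x.1 := by rwa [← div_eq_inv_mul, le_div_iff₀' hε]
          have h7 : x.1 * (1 - x.1) = bub x.1 := rfl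
          rw [ed, h7]
          nlinarith
      · rw [ec1]
        gcongr
        have h7 : x.1 * (1 - x.1) = bub x.1 := rfl
        rw [h7]
        nlinarith
    · have hl : leftFun ε x = 0 := leftFun_eq_zero hε hx (by nlinarith)
      rw [hl, sub_zero, abs_of_nonneg c0, ec]
      refine div_le_div_of_nonneg_right ?_ hd.le
      have h7 : bub x.1 = x.1 * (1 - x.1) := rfl
      have h9 : 0 ≤ (4 * M * ε⁻¹ + 4 * ε⁻¹) * bub x.1 := by positivity
      have h8 : bub x.2 * (1 - x.1) ≤ 1 * bub x.1 := by
        rw [h7]; nlinarith [sub_pos.2 hx1']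
      nlinarith
  · rw [← div_eq_mul_inv]
    refine habs _ _ _ c0 l0 ?_ ?_
    · rw [ec]
      refine div_le_div_of_nonneg_right ?_ hd.le
      have h9 : 0 ≤ (4 * M * ε⁻¹ + 4 * ε⁻¹) * bub x.2 := by positivity
      nlinarith
    · rcases lt_or_ge x.1 (ε * bub x.2) with hlt | hge
      · refine l1.trans ?_
        rw [one_le_div hd]
        have := den_le_of_lt hε1 hx hlt
        nlinarith
      · rw [leftFun_eq_zero hε hx hge]; positivity

/-- This licenses the change of test function, from the prescribed cutoff to one whose support is
adapted to the aspect ratio. -/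
theorem greenPairing_left_eq {ε : ℝ} (hε : 0 < ε) (hε1 : ε ≤ 1)
    {u : ℝ × ℝ → 𝕜 × 𝕜} (hu : StronglyMeasurable u)
    (hu' : ∫⁻ x in Shape.square.dom, denWeight .square x * ‖u x‖ₑ < ⊤) {f : 𝕜}
    (h : WeakDiv Shape.square.dom u f) : greenPairing Shape.square.dom (cutoff squareEdge 3) u f =
      greenPairing Shape.square.dom (leftFun ε) u f := by
  obtain ⟨A, A0, hA⟩ := cutoff_sub_leftFun_le hε hε1
  have h1 := isEdgeFun_cutoff_square 3
  have h2 := isEdgeFun_leftFun hε hε1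
  have := greenPairing_eq_zero (h1.sub h2) A0 hA hu hu' h
  rwa [greenPairing_sub h1 h2 hu hu', sub_eq_zero] at this

end GradedRT
end

/-! ### Flux bounds uniform in the aspect ratio. -/

noncomputable section

namespace GradedRT
open scoped ENNReal NNReal

variable {𝕜 : Type*} [RCLike 𝕜]

/-! ### Fluxes through the edges of an anisotropic rectangle -/

/-- The Piola transform of the field with components `w` on a rectangle with sides `h₁`, `h₂`. -/
def aniso (h₁ h₂ : ℝ) (w : 𝕜 × 𝕜) : 𝕜 × 𝕜 := (h₂ • w.1, h₁ • w.2)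

theorem aniso_sub (h₁ h₂ : ℝ) (w c : 𝕜 × 𝕜) : aniso h₁ h₂ (w - c) = aniso h₁ h₂ w - aniso h₁ h₂ c := by
  ext <;> simp [aniso, smul_sub]

theorem continuous_aniso (h₁ h₂ : ℝ) : Continuous (aniso h₁ h₂ : 𝕜 × 𝕜 → 𝕜 × 𝕜) := by
  unfold aniso; fun_prop

theorem enorm_aniso_le {h₁ h₂ : ℝ} (p₁ : 0 < h₁) (p₂ : 0 < h₂) (w : 𝕜 × 𝕜) :
    ‖aniso h₁ h₂ w‖ₑ ≤ ENNReal.ofReal (max h₁ h₂) * ‖w‖ₑ := by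
  have hm : 0 < max h₁ h₂ := p₁.trans_le (le_max_left _ _)
  rw [← ofReal_norm, ← ofReal_norm w, ← ENNReal.ofReal_mul hm.le]
  refine ENNReal.ofReal_le_ofReal (max_le ?_ ?_)
  · simp only [aniso, norm_smul, Real.norm_of_nonneg p₂.le]
    exact mul_le_mul (le_max_right _ _) (norm_fst_le w) (norm_nonneg _) hm.le
  · simp only [aniso, norm_smul, Real.norm_of_nonneg p₁.le]
    exact mul_le_mul (le_max_left _ _) (norm_snd_le w) (norm_nonneg _) hm.le

theorem lintegral_denWeight_aniso_lt_top {S : Shape} {h₁ h₂ : ℝ} (p₁ : 0 < h₁) (p₂ : 0 < h₂)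
    {U : ℝ × ℝ → 𝕜 × 𝕜} (hU : ∫⁻ x in S.dom, denWeight S x * ‖U x‖ₑ < ⊤) :
    ∫⁻ x in S.dom, denWeight S x * ‖aniso h₁ h₂ (U x)‖ₑ < ⊤ := by
  refine lt_of_le_of_lt (lintegral_mono fun x =>
    mul_le_mul_right (enorm_aniso_le p₁ p₂ (U x)) _) ?_
  simp only [mul_left_comm (denWeight S _)]
  rw [lintegral_const_mul' _ _ ENNReal.ofReal_ne_top]
  exact ENNReal.mul_lt_top ENNReal.ofReal_lt_top hU

/-- The square root of `max(h₁, h₂)³` times the Gagliardo integral on the rectangle. -/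
def osc (h₁ h₂ : ℝ) (U : ℝ × ℝ → 𝕜 × 𝕜) : ℝ≥0∞ :=
  (ENNReal.ofReal (max h₁ h₂) ^ 3 * gagliardo Shape.square.dom (scl h₁ h₂) U) ^ (1 / 2 : ℝ)

/-- The mean, over the constant fields with a value of `U`, of the flux of the difference through
the edge `e` is at most `C k(h₁, h₂) osc`. -/
def FluxBound (𝕜 : Type*) [RCLike 𝕜] (e : Fin 4) (C : ℝ≥0∞) (k : ℝ → ℝ → ℝ) : Prop :=
  ∀ (h₁ h₂ : ℝ) (U : ℝ × ℝ → 𝕜 × 𝕜) (f : 𝕜), 0 < h₁ → 0 < h₂ → StronglyMeasurable U →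
    gagliardo Shape.square.dom id U < ⊤ →
    WeakDiv Shape.square.dom (fun x => aniso h₁ h₂ (U x)) f →
    ∫⁻ y in Shape.square.dom, ‖greenPairing Shape.square.dom (cutoff squareEdge e)
      (fun x => aniso h₁ h₂ (U x - U y)) f‖ₑ ≤ C * ENNReal.ofReal (k h₁ h₂) * osc h₁ h₂ U

/-- After the Piola scaling, ∂₁ meets h₂w₁ and ∂₂ meets h₁w₂. Since ∂₂ carries the additional factor
ε and εh₁ ≤ h₂, both products are of order h₂. -/
theorem enorm_greenDensity_leftFun_le {M : ℝ} (hM : ∀ z, |deriv Real.smoothTransition z| ≤ M)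
    {ε h₁ h₂ : ℝ} (hε : 0 < ε) (p₁ : 0 < h₁) (p₂ : 0 < h₂) (hh : ε * h₁ ≤ h₂) {x : ℝ × ℝ}
    (hx : x ∈ Shape.square.dom) (w : ℝ × ℝ → 𝕜 × 𝕜) (f : 𝕜) :
    ‖greenDensity (leftFun ε) (fun x => aniso h₁ h₂ (w x)) f x‖ₑ ≤
      ENNReal.ofReal (2 * M * h₂) * (edgeWeight ε x * ‖w x‖ₑ) +
        (slab ε).indicator (fun _ => ‖f‖ₑ) x := by
  have M0 : 0 ≤ M := (abs_nonneg _).trans (hM 0)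
  have hb := bub_pos hx.2.2.1 hx.2.2.2
  obtain ⟨d1, d2⟩ := fderiv_leftFun_le hM hε hx
  have n1 : ‖(w x).1‖ₑ ≤ ‖w x‖ₑ := by
    rw [← ofReal_norm, ← ofReal_norm]; exact ENNReal.ofReal_le_ofReal (norm_fst_le (w x))
  have n2 : ‖(w x).2‖ₑ ≤ ‖w x‖ₑ := by
    rw [← ofReal_norm, ← ofReal_norm]; exact ENNReal.ofReal_le_ofReal (norm_snd_le (w x))
  rw [greenDensity]
  refine (enorm_add_le _ _).trans (add_le_add ?_ ?_)
  · refine (enorm_add_le _ _).trans ?_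
    simp only [aniso]
    rw [enorm_smul, enorm_smul, enorm_smul, enorm_smul, Real.enorm_of_nonneg p₁.le,
      Real.enorm_of_nonneg p₂.le]
    have e1 : ‖fderiv ℝ (leftFun ε) x (1, 0)‖ₑ ≤ ENNReal.ofReal M * edgeWeight ε x := by
      rw [← ofReal_norm, edgeWeight]
      refine (ENNReal.ofReal_le_ofReal d1).trans_eq ?_
      split_ifs
      · rw [ENNReal.ofReal_mul M0]
      · simp
    have e2 : ‖fderiv ℝ (leftFun ε) x (0, 1)‖ₑ ≤
        ENNReal.ofReal ε * (ENNReal.ofReal M * edgeWeight ε x) := by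
      rw [← ofReal_norm, edgeWeight]
      refine (ENNReal.ofReal_le_ofReal d2).trans_eq ?_
      rw [ENNReal.ofReal_mul hε.le]
      split_ifs
      · rw [ENNReal.ofReal_mul M0]
      · simp
    calc _ ≤ ENNReal.ofReal M * edgeWeight ε x * (ENNReal.ofReal h₂ * ‖w x‖ₑ) +
          ENNReal.ofReal ε * (ENNReal.ofReal M * edgeWeight ε x) * (ENNReal.ofReal h₁ * ‖w x‖ₑ) := by
          gcongr
      _ = (ENNReal.ofReal M * ENNReal.ofReal h₂ + ENNReal.ofReal M * ENNReal.ofReal (ε * h₁)) *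
          (edgeWeight ε x * ‖w x‖ₑ) := by
          rw [ENNReal.ofReal_mul hε.le]; ring
      _ ≤ (ENNReal.ofReal M * ENNReal.ofReal h₂ + ENNReal.ofReal M * ENNReal.ofReal h₂) *
          (edgeWeight ε x * ‖w x‖ₑ) := by gcongr
      _ = _ := by
          rw [ENNReal.ofReal_mul (by positivity), ENNReal.ofReal_mul (by norm_num)]
          simp only [ENNReal.ofReal_ofNat]
          ring
  · by_cases hs : x ∈ slab ε
    · rw [indicator_of_mem hs, enorm_smul, Real.enorm_of_nonneg (leftFun_nonneg _ _)]
      exact mul_le_of_le_one_left' (ENNReal.ofReal_le_one.2 (leftFun_le_one _ _))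
    · have : leftFun ε x = 0 := by
        refine leftFun_eq_zero hε hx ?_
        by_contra hlt
        push Not at hlt
        refine hs ⟨⟨hx.1, hlt.trans_le ?_⟩, hx.2.2⟩
        have : bub x.2 ≤ 1 / 4 := bub_le
        nlinarith
      simp [this]

/-- The gradient part is integrated over y as well, and after exchanging the order of integration it
is the left side of `edgeWeight_hardy`. In the remaining term |f| can be as large as the longer
side, but it is integrated only over a slab of measure ε. -/
theorem exists_fluxBound_left (𝕜 : Type*) [RCLike 𝕜] :
    ∃ C : ℝ≥0, FluxBound 𝕜 3 C fun _ h₂ => h₂ := by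
  obtain ⟨M, M0, hM⟩ := exists_deriv_smoothTransition_le
  obtain ⟨C₀, hC₀⟩ := exists_enorm_div_le 𝕜 .square
  refine ⟨Real.toNNReal (2 * M) * 1280 + C₀, fun h₁ h₂ U f p₁ p₂ hU hG hdiv => ?_⟩
  set D := Shape.square.dom with hD
  set R := osc h₁ h₂ U with hR
  set m := max h₁ h₂ with hm
  set ε := min 1 (h₂ / h₁) with hε
  have ε0 : 0 < ε := lt_min one_pos (div_pos p₂ p₁)
  have ε1 : ε ≤ 1 := min_le_left _ _
  have hεh : ε * h₁ ≤ h₂ := by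
    have : ε ≤ h₂ / h₁ := min_le_right _ _
    rwa [le_div_iff₀ p₁] at this
  have hUd := lintegral_denWeight_enorm_lt_top .square hU hG
  have hsm : ∀ y, StronglyMeasurable fun x => aniso h₁ h₂ (U x - U y) := fun y =>
    (continuous_aniso h₁ h₂).comp_stronglyMeasurable (hU.sub stronglyMeasurable_const)
  have hfin : ∀ y, ∫⁻ x in D, denWeight .square x * ‖aniso h₁ h₂ (U x - U y)‖ₑ < ⊤ := fun y =>
    lintegral_denWeight_aniso_lt_top p₁ p₂ (lintegral_denWeight_sub_lt_top hUd (U y))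
  have hwd : ∀ y, WeakDiv D (fun x => aniso h₁ h₂ (U x - U y)) f := fun y => by
    simp only [aniso_sub]
    exact hdiv.sub_const ((continuous_aniso h₁ h₂).comp_stronglyMeasurable hU)
      (lintegral_denWeight_aniso_lt_top p₁ p₂ hUd) _
  have hB := measurable_lintegral_enorm_sub hU D
  have hN := measurable_enorm_sub hU
  -- the divergence
  have hf : ‖f‖ₑ ≤ C₀ * (ENNReal.ofReal m * R) := by
    have h1 : ∀ y, ‖f‖ₑ ≤ C₀ * (ENNReal.ofReal m * ∫⁻ x in D, ‖U y - U x‖ₑ) := fun y => by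
      refine (hC₀ _ f (hsm y) (hfin y) (hwd y)).trans ?_
      rw [← lintegral_const_mul' _ _ ENNReal.ofReal_ne_top]
      gcongr with x
      rw [enorm_sub_rev (U y)]
      exact enorm_aniso_le p₁ p₂ _
    calc ‖f‖ₑ = ∫⁻ _ in D, ‖f‖ₑ := by
          rw [lintegral_const, Measure.restrict_apply_univ, hD, volume_square, mul_one]
      _ ≤ ∫⁻ y in D, C₀ * (ENNReal.ofReal m * ∫⁻ x in D, ‖U y - U x‖ₑ) := lintegral_mono h1
      _ = C₀ * (ENNReal.ofReal m * slabOsc U 1) := by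
          rw [lintegral_const_mul' _ _ ENNReal.coe_ne_top,
            lintegral_const_mul' _ _ ENNReal.ofReal_ne_top, slabOsc, slab_one]
      _ ≤ _ := by
          gcongr
          exact slabOsc_one_le hU p₁ p₂ (le_max_left _ _) (le_max_right _ _)
  -- Thinness of the slab pays for the long side.
  have hεm : ENNReal.ofReal ε * ENNReal.ofReal m ≤ ENNReal.ofReal h₂ := by
    rw [← ENNReal.ofReal_mul ε0.le]
    refine ENNReal.ofReal_le_ofReal ?_
    rcases max_cases h₁ h₂ with ⟨h, _⟩ | ⟨h, _⟩
    · rw [hm, h]; exact hεh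
    · rw [hm, h]; nlinarith
  have hpt : ∀ y, ‖greenPairing D (cutoff squareEdge 3) (fun x => aniso h₁ h₂ (U x - U y)) f‖ₑ ≤
      ENNReal.ofReal (2 * M * h₂) * (∫⁻ x in D, edgeWeight ε x * ‖U x - U y‖ₑ) +
        ENNReal.ofReal h₂ * (C₀ * R) := by
    intro y
    rw [greenPairing_left_eq ε0 ε1 (hsm y) (hfin y) (hwd y)]
    refine (enorm_integral_le_lintegral_enorm _).trans ?_
    calc _ ≤ ∫⁻ x in D, (ENNReal.ofReal (2 * M * h₂) * (edgeWeight ε x * ‖U x - U y‖ₑ) +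
          (slab ε).indicator (fun _ => ‖f‖ₑ) x) :=
          setLIntegral_mono' (measurableSet_dom _) fun x hx =>
            enorm_greenDensity_leftFun_le hM ε0 p₁ p₂ hεh hx (fun x => U x - U y) f
      _ ≤ ENNReal.ofReal (2 * M * h₂) * (∫⁻ x in D, edgeWeight ε x * ‖U x - U y‖ₑ) +
          ENNReal.ofReal ε * ‖f‖ₑ := by
          rw [lintegral_add_right _ (measurable_const.indicator (measurableSet_slab ε)),
            lintegral_const_mul' _ _ ENNReal.ofReal_ne_top]
          gcongr
          refine (setLIntegral_le_lintegral _ _).trans_eq ?_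
          rw [lintegral_indicator (measurableSet_slab ε), lintegral_const,
            Measure.restrict_apply_univ, volume_slab, mul_comm]
      _ ≤ _ := by
          refine add_le_add le_rfl ?_
          calc _ ≤ ENNReal.ofReal ε * (C₀ * (ENNReal.ofReal m * R)) := by gcongr
            _ = ENNReal.ofReal ε * ENNReal.ofReal m * (C₀ * R) := by ring
            _ ≤ _ := by gcongr
  have hswap : ∫⁻ y in D, ∫⁻ x in D, edgeWeight ε x * ‖U x - U y‖ₑ ≤ 1280 * R := by
    rw [lintegral_lintegral_swap]
    · have e : ∀ x, ∫⁻ y in D, edgeWeight ε x * ‖U x - U y‖ₑ =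
          edgeWeight ε x * ∫⁻ y in D, ‖U x - U y‖ₑ := fun x =>
        lintegral_const_mul _ (hN.comp measurable_prodMk_left)
      simp only [e]
      exact edgeWeight_hardy hU p₁ p₂
    · refine Measurable.aemeasurable ?_
      exact ((measurable_edgeWeight ε).comp measurable_snd).mul (hN.comp measurable_swap)
  calc _ ≤ ∫⁻ y in D, (ENNReal.ofReal (2 * M * h₂) * (∫⁻ x in D, edgeWeight ε x * ‖U x - U y‖ₑ) +
        ENNReal.ofReal h₂ * (C₀ * R)) := lintegral_mono hpt
    _ = ENNReal.ofReal (2 * M * h₂) * (∫⁻ y in D, ∫⁻ x in D, edgeWeight ε x * ‖U x - U y‖ₑ) +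
        ENNReal.ofReal h₂ * (C₀ * R) := by
        rw [lintegral_add_right _ measurable_const, lintegral_const_mul' _ _ ENNReal.ofReal_ne_top,
          lintegral_const, Measure.restrict_apply_univ, hD, volume_square, mul_one]
    _ ≤ ENNReal.ofReal (2 * M * h₂) * (1280 * R) + ENNReal.ofReal h₂ * (C₀ * R) := by gcongr
    _ = _ := by
        rw [ENNReal.ofReal_mul (by positivity)]
        push_cast
        rw [show ((2 * M).toNNReal : ℝ≥0∞) = ENNReal.ofReal (2 * M) from rfl]
        ring

/-! ### Symmetries of the square -/

/-- An involutive symmetry `σ` of the unit square, with the corresponding action `T` on vectors. -/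
structure SquareSymm (σ : ℝ × ℝ → ℝ × ℝ) (T : 𝕜 × 𝕜 →L[ℝ] 𝕜 × 𝕜) : Prop where
  invol : Function.Involutive σ
  contDiff : ContDiff ℝ ∞ σ
  measurePreserving : MeasurePreserving σ volume volume
  mapsTo : MapsTo σ Shape.square.dom Shape.square.dom
  norm_eq : ∀ w, ‖T w‖ = ‖w‖
  fderiv_comp : ∀ (φ : ℝ × ℝ → ℝ) (x : ℝ × ℝ), DifferentiableAt ℝ φ (σ x) → ∀ w : 𝕜 × 𝕜,
    fderiv ℝ (φ ∘ σ) x (1, 0) • w.1 + fderiv ℝ (φ ∘ σ) x (0, 1) • w.2 =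
      fderiv ℝ φ (σ x) (1, 0) • (T w).1 + fderiv ℝ φ (σ x) (0, 1) • (T w).2

namespace SquareSymm

variable {σ : ℝ × ℝ → ℝ × ℝ} {T : 𝕜 × 𝕜 →L[ℝ] 𝕜 × 𝕜} (h : SquareSymm σ T)
include h

theorem preimage_eq : σ ⁻¹' Shape.square.dom = Shape.square.dom := by
  refine Subset.antisymm (fun x hx => ?_) h.mapsTo
  have := h.mapsTo hx
  rwa [h.invol x] at this

theorem homeomorph : ∃ s : ℝ × ℝ ≃ₜ ℝ × ℝ, ⇑s = σ :=
  ⟨⟨⟨σ, σ, h.invol, h.invol⟩, h.contDiff.continuous, h.contDiff.continuous⟩, rfl⟩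

theorem measurableEmbedding : MeasurableEmbedding σ := by
  obtain ⟨s, hs⟩ := h.homeomorph
  exact hs ▸ s.measurableEmbedding

theorem lintegral_comp (F : ℝ × ℝ → ℝ≥0∞) :
    ∫⁻ x in Shape.square.dom, F (σ x) = ∫⁻ x in Shape.square.dom, F x := by
  have := h.measurePreserving.setLIntegral_comp_preimage_emb h.measurableEmbedding F
    Shape.square.dom
  rwa [h.preimage_eq] at this

theorem greenPairing_comp {φ : ℝ × ℝ → ℝ} (hφ : ∀ x ∈ Shape.square.dom, DifferentiableAt ℝ φ x)
    (u : ℝ × ℝ → 𝕜 × 𝕜) (f : 𝕜) : greenPairing Shape.square.dom (φ ∘ σ) u f =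
      greenPairing Shape.square.dom φ (fun x => T (u (σ x))) f := by
  have := h.measurePreserving.setIntegral_preimage_emb h.measurableEmbedding
    (greenDensity φ (fun x => T (u (σ x))) f) Shape.square.dom
  rw [h.preimage_eq] at this
  rw [greenPairing, greenPairing, ← this]
  refine setIntegral_congr_fun (measurableSet_dom _) fun x hx => ?_
  simp only [greenDensity]
  rw [h.fderiv_comp φ x (hφ _ (h.mapsTo hx)), h.invol x]
  rfl

theorem weakDiv {u : ℝ × ℝ → 𝕜 × 𝕜} {f : 𝕜} (hu : WeakDiv Shape.square.dom u f) :
    WeakDiv Shape.square.dom (fun x => T (u (σ x))) f := by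
  obtain ⟨s, hs⟩ := h.homeomorph
  intro φ hφ hc ht
  rw [← h.greenPairing_comp fun x _ => hφ.differentiable (by simp) x]
  refine hu _ (hφ.comp h.contDiff) ?_ ?_
  · rw [← hs]; exact hc.comp_homeomorph s
  · rw [← hs, tsupport_comp_eq_preimage, hs]
    exact fun x hx => by
      have : σ x ∈ Shape.square.dom := ht hx
      rw [← h.preimage_eq]; exact this

theorem stronglyMeasurable_comp {U : ℝ × ℝ → 𝕜 × 𝕜} (hU : StronglyMeasurable U) :
    StronglyMeasurable fun x => T (U (σ x)) :=
  T.continuous.comp_stronglyMeasurable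
    (hU.comp_measurable h.contDiff.continuous.measurable)

theorem gagliardo_comp {s t : ℝ × ℝ → ℝ × ℝ} (hst : ∀ x y, edist (t x) (t y) = edist (s (σ x)) (s (σ y)))
    (U : ℝ × ℝ → 𝕜 × 𝕜) : gagliardo Shape.square.dom t (fun x => T (U (σ x))) =
      gagliardo Shape.square.dom s U := by
  have e : ∀ x y, ‖T (U (σ x)) - T (U (σ y))‖ₑ ^ 2 / edist (t x) (t y) ^ 3 =
      ‖U (σ x) - U (σ y)‖ₑ ^ 2 / edist (s (σ x)) (s (σ y)) ^ 3 := fun x y => by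
    rw [hst, ← map_sub, ← ofReal_norm, h.norm_eq, ofReal_norm]
  rw [gagliardo, gagliardo, ← h.lintegral_comp
    (fun x => ∫⁻ y in Shape.square.dom, ‖U x - U y‖ₑ ^ 2 / edist (s x) (s y) ^ 3)]
  refine lintegral_congr fun x => ?_
  simp only [e]
  exact h.lintegral_comp fun y => ‖U (σ x) - U y‖ₑ ^ 2 / edist (s (σ x)) (s y) ^ 3

/-- The map `τ` records how the symmetry permutes the side lengths. It preserves their maximum and
matches the scaled distances, so `osc` is carried over unchanged. -/
theorem fluxBound {e e' : Fin 4} (he : cutoff squareEdge e' = cutoff squareEdge e ∘ σ)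
    {τ : ℝ → ℝ → ℝ × ℝ} (hτ : ∀ h₁ h₂, 0 < h₁ → 0 < h₂ → 0 < (τ h₁ h₂).1 ∧ 0 < (τ h₁ h₂).2)
    (hm : ∀ h₁ h₂, max (τ h₁ h₂).1 (τ h₁ h₂).2 = max h₁ h₂)
    (hid : ∀ x y : ℝ × ℝ, edist x y = edist (σ x) (σ y))
    (hs : ∀ h₁ h₂ x y, edist (scl (τ h₁ h₂).1 (τ h₁ h₂).2 x) (scl (τ h₁ h₂).1 (τ h₁ h₂).2 y) =
      edist (scl h₁ h₂ (σ x)) (scl h₁ h₂ (σ y)))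
    (ha : ∀ h₁ h₂ w, T (aniso h₁ h₂ w) = aniso (τ h₁ h₂).1 (τ h₁ h₂).2 (T w))
    {C : ℝ≥0∞} {k : ℝ → ℝ → ℝ} (hb : FluxBound 𝕜 e C k) :
    FluxBound 𝕜 e' C fun h₁ h₂ => k (τ h₁ h₂).1 (τ h₁ h₂).2 := by
  intro h₁ h₂ U f p₁ p₂ hU hG hdiv
  obtain ⟨q₁, q₂⟩ := hτ h₁ h₂ p₁ p₂
  have hdiv' := h.weakDiv hdiv
  simp only [ha] at hdiv'
  have := hb _ _ (fun x => T (U (σ x))) f q₁ q₂ (h.stronglyMeasurable_comp hU)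
    (by rwa [h.gagliardo_comp (s := id) (t := id) hid]) hdiv'
  rw [osc, hm, h.gagliardo_comp (hs h₁ h₂)] at this
  refine le_trans (le_of_eq ?_) this
  rw [← h.lintegral_comp (fun y => ‖greenPairing Shape.square.dom (cutoff squareEdge e')
    (fun x => aniso h₁ h₂ (U x - U y)) f‖ₑ)]
  refine lintegral_congr fun y => ?_
  rw [he, h.greenPairing_comp fun x hx =>
    ((isEdgeFun_cutoff_square e).contDiffAt x hx).differentiableAt (by simp)]
  simp only [ha, map_sub]

end SquareSymm

theorem fderiv_comp_affine {σ : ℝ × ℝ → ℝ × ℝ} {L : ℝ × ℝ →L[ℝ] ℝ × ℝ} {φ : ℝ × ℝ → ℝ} {x : ℝ × ℝ}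
    (hσ : HasFDerivAt σ L x) (hφ : DifferentiableAt ℝ φ (σ x)) (v : ℝ × ℝ) :
    fderiv ℝ (φ ∘ σ) x v = fderiv ℝ φ (σ x) (L v) := by
  rw [(hφ.hasFDerivAt.comp x hσ).fderiv]; rfl

/-- The exchange of the coordinates. -/
theorem squareSymm_swap : SquareSymm (Prod.swap : ℝ × ℝ → ℝ × ℝ)
    ((ContinuousLinearMap.snd ℝ 𝕜 𝕜).prod (ContinuousLinearMap.fst ℝ 𝕜 𝕜)) where
  invol := Prod.swap_swap
  contDiff := contDiff_snd.prodMk contDiff_fst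
  measurePreserving := by
    rw [Measure.volume_eq_prod]; exact Measure.measurePreserving_swap
  mapsTo x hx := ⟨hx.2.2.1, hx.2.2.2, hx.1, hx.2.1⟩
  norm_eq w := by simp [Prod.norm_def, max_comm]
  fderiv_comp φ x hφ w := by
    have hσ : HasFDerivAt (Prod.swap : ℝ × ℝ → ℝ × ℝ)
      ((ContinuousLinearMap.snd ℝ ℝ ℝ).prod (ContinuousLinearMap.fst ℝ ℝ ℝ)) x :=
      ((ContinuousLinearMap.snd ℝ ℝ ℝ).prod (ContinuousLinearMap.fst ℝ ℝ ℝ)).hasFDerivAt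
    rw [fderiv_comp_affine hσ hφ, fderiv_comp_affine hσ hφ]
    simp [add_comm]

/-- The reflection `x₁ ↦ 1 - x₁`. -/
theorem squareSymm_reflect : SquareSymm (fun x : ℝ × ℝ => (1 - x.1, x.2))
    ((-ContinuousLinearMap.fst ℝ 𝕜 𝕜).prod (ContinuousLinearMap.snd ℝ 𝕜 𝕜)) where
  invol x := by simp
  contDiff := by fun_prop
  measurePreserving := by
    rw [Measure.volume_eq_prod]
    exact (volume.measurePreserving_sub_left (1 : ℝ)).prod (MeasurePreserving.id volume)
  mapsTo x hx := ⟨sub_pos.2 hx.2.1, by have := hx.1; simp only; linarith, hx.2.2.1, hx.2.2.2⟩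
  norm_eq w := by simp [Prod.norm_def]
  fderiv_comp φ x hφ w := by
    have hσ : HasFDerivAt (fun x : ℝ × ℝ => (1 - x.1, x.2))
      ((-ContinuousLinearMap.fst ℝ ℝ ℝ).prod (ContinuousLinearMap.snd ℝ ℝ ℝ)) x :=
      (hasFDerivAt_fst.const_sub 1).prodMk hasFDerivAt_snd
    rw [fderiv_comp_affine hσ hφ, fderiv_comp_affine hσ hφ]
    have e : fderiv ℝ φ (1 - x.1, x.2) (-1, 0) = -fderiv ℝ φ (1 - x.1, x.2) (1, 0) := by
      rw [← map_neg]; simp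
    simp [e]

/-- One edge suffices: the reflection carries left to right, and the exchange of coordinates carries
left to bottom and right to top, interchanging h₁ and h₂. -/
theorem exists_fluxBound (𝕜 : Type*) [RCLike 𝕜] : ∃ C : ℝ≥0,
    FluxBound 𝕜 3 C (fun _ h₂ => h₂) ∧ FluxBound 𝕜 1 C (fun _ h₂ => h₂) ∧
    FluxBound 𝕜 0 C (fun h₁ _ => h₁) ∧ FluxBound 𝕜 2 C (fun h₁ _ => h₁) := by
  obtain ⟨C, h3⟩ := exists_fluxBound_left 𝕜
  have hsw : ∀ e e' : Fin 4, cutoff squareEdge e' = cutoff squareEdge e ∘ Prod.swap →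
      FluxBound 𝕜 e C (fun _ h₂ => h₂) → FluxBound 𝕜 e' C (fun h₁ _ => h₁) := fun e e' he hb =>
    squareSymm_swap.fluxBound he (τ := fun h₁ h₂ => (h₂, h₁)) (fun _ _ p q => ⟨q, p⟩)
      (fun h₁ h₂ => max_comm _ _)
      (fun x y => by simp [Prod.edist_eq, max_comm])
      (fun h₁ h₂ x y => by simp [Prod.edist_eq, scl, max_comm])
      (fun h₁ h₂ w => by simp [aniso]) hb
  have h1 : FluxBound 𝕜 1 C fun _ h₂ => h₂ :=
    squareSymm_reflect.fluxBound (e := 3) (by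
        rw [cutoff_square_eq, cutoff_square_eq]
        funext x
        simp [squareNum, den]; congr 1 <;> ring)
      (τ := fun h₁ h₂ => (h₁, h₂)) (fun _ _ p q => ⟨p, q⟩) (fun h₁ h₂ => rfl)
      (fun x y => by
        have e : |x.1 - y.1| = |1 - x.1 - (1 - y.1)| := by rw [← abs_neg]; congr 1; ring
        rw [edist_dist, edist_dist, Prod.dist_eq, Prod.dist_eq]
        simp only [Real.dist_eq, e])
      (fun h₁ h₂ x y => by
        have e : |h₁ * x.1 - h₁ * y.1| = |h₁ * (1 - x.1) - h₁ * (1 - y.1)| := by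
          rw [← abs_neg]; congr 1; ring
        rw [edist_dist, edist_dist, Prod.dist_eq, Prod.dist_eq]
        simp only [scl, Real.dist_eq, e])
      (fun h₁ h₂ w => by simp [aniso]) h3
  refine ⟨C, h3, h1, hsw 3 0 ?_ h3, hsw 1 2 ?_ h1⟩
  · rw [cutoff_square_eq, cutoff_square_eq]
    funext x
    simp [squareNum, den]; congr 1 <;> ring
  · rw [cutoff_square_eq, cutoff_square_eq]
    funext x
    simp [squareNum, den]; congr 1 <;> ring

end GradedRT
end

/-! ### The interpolation error on the reference elements. -/

noncomputable section

namespace GradedRT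
open scoped ENNReal NNReal

variable {𝕜 : Type*} [RCLike 𝕜]

/-! ### The interpolation error on the reference elements -/

theorem aniso_inv_aniso {h₁ h₂ : ℝ} (p₁ : 0 < h₁) (p₂ : 0 < h₂) (w : 𝕜 × 𝕜) :
    aniso h₁⁻¹ h₂⁻¹ (aniso h₁ h₂ w) = w := by
  ext <;> simp [aniso, smul_smul, p₁.ne', p₂.ne']

theorem aniso_add (h₁ h₂ : ℝ) (w c : 𝕜 × 𝕜) : aniso h₁ h₂ (w + c) = aniso h₁ h₂ w + aniso h₁ h₂ c := by
  ext <;> simp [aniso, smul_add]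

theorem refInterp_eq_const_add {S : Shape} {u : ℝ × ℝ → 𝕜 × 𝕜} (hu : StronglyMeasurable u)
    (hu' : ∫⁻ x in S.dom, denWeight S x * ‖u x‖ₑ < ⊤) (f : 𝕜) (c : 𝕜 × 𝕜) (x : ℝ × ℝ) :
    refInterp S u (fun _ => f) x = c + refInterp S (fun x => u x - c) (fun _ => f) x := by
  cases S
  · have e := squareRT_const c x
    simp only [refInterp, edgeFlux_eq_greenPairing]
    simp only [fun e => greenPairing_eq_const_add (isEdgeFun_cutoff_square e) hu hu' f c]
    refine Eq.trans ?_ (congrArg (· + _) e)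
    ext <;> simp only [squareRT, Prod.fst_add, Prod.snd_add] <;> ring
  · have e := triangleRT_const c x
    simp only [refInterp, edgeFlux_eq_greenPairing]
    simp only [fun e => greenPairing_eq_const_add (isEdgeFun_cutoff_triangle e) hu hu' f c]
    refine Eq.trans ?_ (congrArg (· + _) e)
    ext <;> simp only [triangleRT, Prod.fst_add, Prod.snd_add] <;> ring

theorem gagliardo_id_le {S : Shape} {h₁ h₂ : ℝ} (p₁ : 0 < h₁) (p₂ : 0 < h₂) {F : Type*}
    [NormedAddCommGroup F] (U : ℝ × ℝ → F) : gagliardo S.dom id U ≤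
      ENNReal.ofReal (max h₁ h₂) ^ 3 * gagliardo S.dom (scl h₁ h₂) U := by
  have hm : 0 < max h₁ h₂ := p₁.trans_le (le_max_left _ _)
  set m := ENNReal.ofReal (max h₁ h₂) with hmd
  have m3 : m ^ 3 ≠ ⊤ := ENNReal.pow_ne_top ENNReal.ofReal_ne_top
  have m0 : m ^ 3 ≠ 0 := pow_ne_zero 3 (by rw [hmd]; exact (ENNReal.ofReal_pos.2 hm).ne')
  rw [gagliardo, gagliardo, ← lintegral_const_mul' _ _ m3]
  refine lintegral_mono fun x => ?_
  rw [← lintegral_const_mul' _ _ m3]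
  refine lintegral_mono fun y => ?_
  have h : edist (scl h₁ h₂ x) (scl h₁ h₂ y) ≤ m * edist x y := by
    rw [edist_dist x y, hmd, ← ENNReal.ofReal_mul hm.le]
    refine edist_scl_le p₁ p₂ (mul_le_mul (le_max_left _ _) ?_ (abs_nonneg _) hm.le)
      (mul_le_mul (le_max_right _ _) ?_ (abs_nonneg _) hm.le)
    · exact le_max_left (dist x.1 y.1) (dist x.2 y.2)
    · exact le_max_right (dist x.1 y.1) (dist x.2 y.2)
  calc ‖U x - U y‖ₑ ^ 2 / edist (id x) (id y) ^ 3 =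
      m ^ 3 * (‖U x - U y‖ₑ ^ 2 / (m * edist x y) ^ 3) := by
        rw [mul_pow, ← mul_div_assoc, ENNReal.mul_div_mul_left _ _ m0 m3]; rfl
    _ ≤ _ := by gcongr

theorem gagliardo_scl_self {S : Shape} {h : ℝ} (p : 0 < h) {F : Type*}
    [NormedAddCommGroup F] (U : ℝ × ℝ → F) : gagliardo S.dom id U =
      ENNReal.ofReal h ^ 3 * gagliardo S.dom (scl h h) U := by
  have m3 : ENNReal.ofReal h ^ 3 ≠ ⊤ := ENNReal.pow_ne_top ENNReal.ofReal_ne_top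
  have m0 : ENNReal.ofReal h ^ 3 ≠ 0 := pow_ne_zero 3 (by simpa using p)
  rw [gagliardo, gagliardo, ← lintegral_const_mul' _ _ m3]
  refine lintegral_congr fun x => ?_
  rw [← lintegral_const_mul' _ _ m3]
  refine lintegral_congr fun y => ?_
  have e : edist (scl h h x) (scl h h y) = ENNReal.ofReal h * edist x y := by
    rw [edist_dist, edist_dist, ← ENNReal.ofReal_mul p.le, Prod.dist_eq, Prod.dist_eq,
      mul_max_of_nonneg _ _ p.le]
    simp [scl, Real.dist_eq, ← mul_sub, abs_mul, abs_of_pos p]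
  rw [e, mul_pow, ← mul_div_assoc, ENNReal.mul_div_mul_left _ _ m0 m3]; rfl

theorem lintegral_sq_enorm_sub_scl_le {S : Shape} {h₁ h₂ : ℝ} (p₁ : 0 < h₁) (p₂ : 0 < h₂) {F : Type*}
    [NormedAddCommGroup F] (U : ℝ × ℝ → F) : ∫⁻ x in S.dom, ∫⁻ y in S.dom, ‖U x - U y‖ₑ ^ 2 ≤
      ENNReal.ofReal (max h₁ h₂) ^ 3 * gagliardo S.dom (scl h₁ h₂) U := by
  refine lintegral_sq_enorm_sub_le (measurableSet_dom _) (scl_injective p₁ p₂)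
    ENNReal.ofReal_ne_top fun x hx y hy => ?_
  have hx := dom_subset_square S hx
  have hy := dom_subset_square S hy
  have := near_of_mem_square hx ⟨hy.1.le, hy.2.1.le, hy.2.2.1.le, hy.2.2.2.le⟩
  have m₁ := le_max_left h₁ h₂
  have m₂ := le_max_right h₁ h₂
  refine edist_scl_le p₁ p₂ ?_ ?_
  · nlinarith [abs_nonneg (x.1 - y.1)]
  · nlinarith [abs_nonneg (x.2 - y.2)]

/-- A pointwise bound by differences of `U` gives a bound in `L²`. -/
theorem lintegral_sq_le_of_forall {S : Shape} {U e : ℝ × ℝ → 𝕜 × 𝕜} {Q : ℝ × ℝ → ℝ≥0∞} {C : ℝ≥0}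
    {X : ℝ≥0∞} (hU : StronglyMeasurable U)
    (h : ∀ x ∈ S.dom, ∀ y, ‖e x‖ₑ ≤ ‖U x - U y‖ₑ + Q y)
    (hQ : ∫⁻ y in S.dom, Q y ≤ C * X ^ (1 / 2 : ℝ))
    (hX : ∫⁻ x in S.dom, ∫⁻ y in S.dom, ‖U x - U y‖ₑ ^ 2 ≤ X) :
    ∫⁻ x in S.dom, ‖e x‖ₑ ^ 2 ≤ (8 * (1 + C ^ 2) : ℝ≥0) * X := by
  have hN : ∀ x, Measurable fun y => ‖U x - U y‖ₑ := fun x =>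
    (measurable_enorm_sub hU).comp measurable_prodMk_left
  have h1 : ∀ x ∈ S.dom, ‖e x‖ₑ ^ 2 ≤
      8 * ((∫⁻ y in S.dom, ‖U x - U y‖ₑ ^ 2) + C ^ 2 * X) := fun x hx => by
    -- The pointwise bound is integrated over y; the left side then carries the area, which is at
    -- least 1/2.
    have h2 : 2⁻¹ * ‖e x‖ₑ ≤ (∫⁻ y in S.dom, ‖U x - U y‖ₑ) + C * X ^ (1 / 2 : ℝ) := by
      calc 2⁻¹ * ‖e x‖ₑ ≤ volume S.dom * ‖e x‖ₑ := by gcongr; exact le_volume_dom S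
        _ = ∫⁻ _ in S.dom, ‖e x‖ₑ := by
            rw [lintegral_const, Measure.restrict_apply_univ, mul_comm]
        _ ≤ ∫⁻ y in S.dom, (‖U x - U y‖ₑ + Q y) := lintegral_mono (h x hx)
        _ ≤ _ := by
            rw [lintegral_add_left (hN x)]
            gcongr
    have h3 : (∫⁻ y in S.dom, ‖U x - U y‖ₑ) ^ 2 ≤ ∫⁻ y in S.dom, ‖U x - U y‖ₑ ^ 2 := by
      refine (sq_lintegral_le (hN x).aemeasurable).trans ?_
      rw [Measure.restrict_apply_univ]
      exact mul_le_of_le_one_left' (volume_dom_le S)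
    have h4 : (X ^ (1 / 2 : ℝ)) ^ 2 = X := by
      rw [← ENNReal.rpow_natCast, ← ENNReal.rpow_mul]; norm_num
    calc ‖e x‖ₑ ^ 2 = 4 * (2⁻¹ * ‖e x‖ₑ) ^ 2 := by
          rw [mul_pow, ← mul_assoc, show (4 : ℝ≥0∞) = 2 ^ 2 by norm_num, ← mul_pow,
            ENNReal.mul_inv_cancel (by norm_num) (by norm_num), one_pow, one_mul]
      _ ≤ 4 * (2 * ((∫⁻ y in S.dom, ‖U x - U y‖ₑ) ^ 2 + (C * X ^ (1 / 2 : ℝ)) ^ 2)) := by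
          gcongr
          exact (pow_le_pow_left' h2 2).trans (ENNReal_add_sq_le _ _)
      _ ≤ 4 * (2 * ((∫⁻ y in S.dom, ‖U x - U y‖ₑ ^ 2) + C ^ 2 * X)) := by
          rw [mul_pow _ (X ^ (1 / 2 : ℝ)), h4]
          gcongr
      _ = _ := by rw [← mul_assoc]; norm_num
  calc ∫⁻ x in S.dom, ‖e x‖ₑ ^ 2 ≤
        ∫⁻ x in S.dom, 8 * ((∫⁻ y in S.dom, ‖U x - U y‖ₑ ^ 2) + C ^ 2 * X) :=
        setLIntegral_mono' (measurableSet_dom S) h1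
    _ = 8 * ((∫⁻ x in S.dom, ∫⁻ y in S.dom, ‖U x - U y‖ₑ ^ 2) +
          C ^ 2 * X * volume S.dom) := by
        rw [lintegral_const_mul' _ _ (by norm_num), lintegral_add_right _ measurable_const,
          lintegral_const, Measure.restrict_apply_univ]
    _ ≤ 8 * (X + C ^ 2 * X * 1) := by gcongr; exact volume_dom_le S
    _ = _ := by push_cast; ring

/-- The flux of U − U(y) is the flux of U minus a real-linear function of U(y), hence a continuous
function of U(y). -/
theorem measurable_enorm_greenPairing_sub {S : Shape} {φ : ℝ × ℝ → ℝ} (hφ : IsEdgeFun S φ)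
    {h₁ h₂ : ℝ} {U : ℝ × ℝ → 𝕜 × 𝕜} (hU : StronglyMeasurable U)
    (hU' : ∫⁻ x in S.dom, denWeight S x * ‖aniso h₁ h₂ (U x)‖ₑ < ⊤) (f : 𝕜) :
    Measurable fun y => ‖greenPairing S.dom φ (fun x => aniso h₁ h₂ (U x - U y)) f‖ₑ := by
  have e : ∀ y, greenPairing S.dom φ (fun x => aniso h₁ h₂ (U x - U y)) f =
      greenPairing S.dom φ (fun x => aniso h₁ h₂ (U x)) f -
        ((∫ x in S.dom, fderiv ℝ φ x (1, 0)) • (aniso h₁ h₂ (U y)).1 +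
          (∫ x in S.dom, fderiv ℝ φ x (0, 1)) • (aniso h₁ h₂ (U y)).2) := fun y => by
    rw [greenPairing_eq_const_add hφ ((continuous_aniso h₁ h₂).comp_stronglyMeasurable hU) hU' f
      (aniso h₁ h₂ (U y)), greenPairing_const hφ, add_sub_cancel_left]
    simp only [aniso_sub]
  simp only [e]
  have hc : Continuous fun w : 𝕜 × 𝕜 => greenPairing S.dom φ (fun x => aniso h₁ h₂ (U x)) f -
        ((∫ x in S.dom, fderiv ℝ φ x (1, 0)) • (aniso h₁ h₂ w).1 +
          (∫ x in S.dom, fderiv ℝ φ x (0, 1)) • (aniso h₁ h₂ w).2) := by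
    unfold aniso; fun_prop
  exact (hc.comp_stronglyMeasurable hU).enorm

/-- The first component involves only the fluxes through the left and right edges and is divided by
h₂, the second only those through bottom and top, divided by h₁. These are the lengths by which the
corresponding flux bounds scale. -/
theorem enorm_aniso_squareRT_le {h₁ h₂ : ℝ} (p₁ : 0 < h₁) (p₂ : 0 < h₂) (q : Fin 4 → 𝕜) {x : ℝ × ℝ}
    (hx : x ∈ Shape.square.dom) : ‖aniso h₁⁻¹ h₂⁻¹ (squareRT q x)‖ₑ ≤
      2 * ((ENNReal.ofReal h₂⁻¹ * ‖q 3‖ₑ + ENNReal.ofReal h₂⁻¹ * ‖q 1‖ₑ) +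
        (ENNReal.ofReal h₁⁻¹ * ‖q 0‖ₑ + ENNReal.ofReal h₁⁻¹ * ‖q 2‖ₑ)) := by
  obtain ⟨a, b, c, d⟩ := hx
  have key : ∀ (α γ : 𝕜) (t : ℝ), 0 < t → t < 1 → ‖-α + (γ + α) * (t : 𝕜)‖ ≤ 2 * (‖α‖ + ‖γ‖) := by
    intro α γ t t0 t1
    refine (norm_add_le _ _).trans ?_
    rw [norm_neg, norm_mul, RCLike.norm_ofReal, abs_of_pos t0]
    have := norm_add_le γ α
    nlinarith [norm_nonneg α, norm_nonneg γ, norm_nonneg (γ + α)]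
  have hi₁ := inv_pos.2 p₁
  have hi₂ := inv_pos.2 p₂
  simp only [← ofReal_norm]
  rw [← ENNReal.ofReal_mul hi₂.le, ← ENNReal.ofReal_mul hi₂.le, ← ENNReal.ofReal_mul hi₁.le,
    ← ENNReal.ofReal_mul hi₁.le, ← ENNReal.ofReal_add (by positivity) (by positivity),
    ← ENNReal.ofReal_add (by positivity) (by positivity),
    ← ENNReal.ofReal_add (by positivity) (by positivity), ← ENNReal.ofReal_ofNat,
    ← ENNReal.ofReal_mul (by norm_num)]
  refine ENNReal.ofReal_le_ofReal (max_le ?_ ?_)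
  · simp only [aniso, norm_smul, Real.norm_of_nonneg hi₂.le, squareRT]
    have := mul_le_mul_of_nonneg_left (key (q 3) (q 1) x.1 a b) hi₂.le
    have := mul_nonneg hi₁.le (norm_nonneg (q 0))
    have := mul_nonneg hi₁.le (norm_nonneg (q 2))
    linarith
  · simp only [aniso, norm_smul, Real.norm_of_nonneg hi₁.le, squareRT]
    have := mul_le_mul_of_nonneg_left (key (q 0) (q 2) x.2 c d) hi₁.le
    have := mul_nonneg hi₂.le (norm_nonneg (q 3))
    have := mul_nonneg hi₂.le (norm_nonneg (q 1))
    linarith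

theorem enorm_triangleRT_le (q : Fin 3 → 𝕜) {x : ℝ × ℝ} (hx : x ∈ Shape.triangle.dom)
    {M : ℝ≥0∞} (hM : ∀ e, ‖q e‖ₑ ≤ M) : ‖triangleRT q x‖ₑ ≤ 5 * M := by
  have hx := dom_subset_square _ hx
  obtain ⟨a, b, c, d⟩ := hx
  have key : ∀ (t : ℝ), 0 < t → t < 1 → ‖(q 0 + q 1 + q 2) * (t : 𝕜)‖ₑ ≤ 3 * M := by
    intro t t0 t1
    calc _ ≤ ‖q 0 + q 1 + q 2‖ₑ := by
          rw [← ofReal_norm, ← ofReal_norm, norm_mul, RCLike.norm_ofReal, abs_of_pos t0]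
          exact ENNReal.ofReal_le_ofReal (mul_le_of_le_one_right (norm_nonneg _) t1.le)
      _ ≤ ‖q 0‖ₑ + ‖q 1‖ₑ + ‖q 2‖ₑ := (enorm_add_le _ _).trans (add_le_add_left (enorm_add_le _ _) _)
      _ ≤ M + M + M := add_le_add (add_le_add (hM 0) (hM 1)) (hM 2)
      _ = _ := by ring
  rw [← ofReal_norm, Prod.norm_def, ENNReal.ofReal_max, ofReal_norm, ofReal_norm]
  refine max_le ?_ ?_
  · calc _ ≤ ‖-q 0 - q 2‖ₑ + ‖(q 0 + q 1 + q 2) * (x.1 : 𝕜)‖ₑ := enorm_add_le _ _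
      _ ≤ (‖-q 0‖ₑ + ‖q 2‖ₑ) + 3 * M := add_le_add enorm_sub_le (key _ a b)
      _ ≤ (M + M) + 3 * M := by rw [enorm_neg]; gcongr <;> exact hM _
      _ = _ := by ring
  · calc _ ≤ ‖-q 0‖ₑ + ‖(q 0 + q 1 + q 2) * (x.2 : 𝕜)‖ₑ := enorm_add_le _ _
      _ ≤ M + 3 * M := by rw [enorm_neg]; exact add_le_add (hM 0) (key _ c d)
      _ ≤ M + 3 * M + M := le_self_add
      _ = _ := by ring

/-- The interpolation error on an anisotropic reference element, for a field whose Piola transform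
has constant divergence. -/
def InterpBound (𝕜 : Type*) [RCLike 𝕜] (S : Shape) (C : ℝ≥0) : Prop :=
  ∀ (h₁ h₂ : ℝ) (U : ℝ × ℝ → 𝕜 × 𝕜) (f : 𝕜), 0 < h₁ → 0 < h₂ → (S = .triangle → h₁ = h₂) →
    StronglyMeasurable U → gagliardo S.dom (scl h₁ h₂) U < ⊤ →
    WeakDiv S.dom (fun x => aniso h₁ h₂ (U x)) f →
    ∫⁻ x in S.dom, ‖U x - aniso h₁⁻¹ h₂⁻¹
      (refInterp S (fun x => aniso h₁ h₂ (U x)) (fun _ => f) x)‖ₑ ^ 2 ≤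
      C * (ENNReal.ofReal (max h₁ h₂) ^ 3 * gagliardo S.dom (scl h₁ h₂) U)

/-- The constant U(y) is subtracted from the field and from its interpolant, where it reproduces
itself. -/
theorem enorm_error_le {S : Shape} {h₁ h₂ : ℝ} (p₁ : 0 < h₁) (p₂ : 0 < h₂) {U : ℝ × ℝ → 𝕜 × 𝕜}
    (hU : StronglyMeasurable U)
    (hU' : ∫⁻ x in S.dom, denWeight S x * ‖aniso h₁ h₂ (U x)‖ₑ < ⊤) (f : 𝕜) (x y : ℝ × ℝ) :
    ‖U x - aniso h₁⁻¹ h₂⁻¹ (refInterp S (fun x => aniso h₁ h₂ (U x)) (fun _ => f) x)‖ₑ ≤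
      ‖U x - U y‖ₑ + ‖aniso h₁⁻¹ h₂⁻¹
        (refInterp S (fun x => aniso h₁ h₂ (U x - U y)) (fun _ => f) x)‖ₑ := by
  rw [refInterp_eq_const_add ((continuous_aniso h₁ h₂).comp_stronglyMeasurable hU) hU' f
    (aniso h₁ h₂ (U y)), aniso_add, aniso_inv_aniso p₁ p₂, ← sub_sub]
  simp only [aniso_sub]
  exact enorm_sub_le

/-- Each flux is bounded by the length of its edge times `osc`, and undoing the Piola scaling
divides by exactly that length, so the aspect ratio disappears. -/
theorem exists_interpBound_square (𝕜 : Type*) [RCLike 𝕜] : ∃ C, InterpBound 𝕜 .square C := by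
  obtain ⟨C, b3, b1, b0, b2⟩ := exists_fluxBound 𝕜
  refine ⟨8 * (1 + (8 * C) ^ 2), fun h₁ h₂ U f p₁ p₂ _ hU hG hdiv => ?_⟩
  have hm3 : ENNReal.ofReal (max h₁ h₂) ^ 3 ≠ ⊤ := ENNReal.pow_ne_top ENNReal.ofReal_ne_top
  have hG' : gagliardo Shape.square.dom id U < ⊤ :=
    (gagliardo_id_le p₁ p₂ U).trans_lt (ENNReal.mul_lt_top hm3.lt_top hG)
  have hU' := lintegral_denWeight_aniso_lt_top p₁ p₂ (lintegral_denWeight_enorm_lt_top .square hU hG')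
  have hq := fun e => measurable_enorm_greenPairing_sub (isEdgeFun_cutoff_square e) hU hU' f
  refine lintegral_sq_le_of_forall hU (fun x hx y => (enorm_error_le p₁ p₂ hU hU' f x y).trans
    (add_le_add le_rfl (enorm_aniso_squareRT_le p₁ p₂ _ hx))) ?_
    (lintegral_sq_enorm_sub_scl_le p₁ p₂ U)
  simp only [edgeFlux_eq_greenPairing]
  have i₁ : ENNReal.ofReal h₁⁻¹ * ENNReal.ofReal h₁ = 1 := by
    rw [← ENNReal.ofReal_mul (inv_pos.2 p₁).le, inv_mul_cancel₀ p₁.ne', ENNReal.ofReal_one]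
  have i₂ : ENNReal.ofReal h₂⁻¹ * ENNReal.ofReal h₂ = 1 := by
    rw [← ENNReal.ofReal_mul (inv_pos.2 p₂).le, inv_mul_cancel₀ p₂.ne', ENNReal.ofReal_one]
  rw [lintegral_const_mul' _ _ (by norm_num)]
  have hq' : Measurable fun y => ENNReal.ofReal h₂⁻¹ * ‖greenPairing Shape.square.dom
      (cutoff squareEdge 3) (fun x => aniso h₁ h₂ (U x - U y)) f‖ₑ + ENNReal.ofReal h₂⁻¹ *
      ‖greenPairing Shape.square.dom (cutoff squareEdge 1) (fun x => aniso h₁ h₂ (U x - U y)) f‖ₑ :=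
    ((hq 3).const_mul _).add ((hq 1).const_mul _)
  rw [lintegral_add_left hq', lintegral_add_left ((hq 3).const_mul _), lintegral_add_left ((hq 0).const_mul _)]
  simp only [lintegral_const_mul' _ _ ENNReal.ofReal_ne_top]
  calc _ ≤ 2 * ((ENNReal.ofReal h₂⁻¹ * (C * ENNReal.ofReal h₂ * osc h₁ h₂ U) +
          ENNReal.ofReal h₂⁻¹ * (C * ENNReal.ofReal h₂ * osc h₁ h₂ U)) +
          (ENNReal.ofReal h₁⁻¹ * (C * ENNReal.ofReal h₁ * osc h₁ h₂ U) +
          ENNReal.ofReal h₁⁻¹ * (C * ENNReal.ofReal h₁ * osc h₁ h₂ U))) := by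
        gcongr
        · exact b3 h₁ h₂ U f p₁ p₂ hU hG' hdiv
        · exact b1 h₁ h₂ U f p₁ p₂ hU hG' hdiv
        · exact b0 h₁ h₂ U f p₁ p₂ hU hG' hdiv
        · exact b2 h₁ h₂ U f p₁ p₂ hU hG' hdiv
    _ = 4 * (C * osc h₁ h₂ U * (ENNReal.ofReal h₂⁻¹ * ENNReal.ofReal h₂ +
          ENNReal.ofReal h₁⁻¹ * ENNReal.ofReal h₁)) := by ring
    _ = _ := by
        rw [i₁, i₂, osc]; push_cast; ring

/-- With h₁ = h₂ everything scales isotropically. The original cutoffs can be used, their gradients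
being bounded by a multiple of 1/den, and the weighted Hardy inequality finishes the estimate. -/
theorem exists_interpBound_triangle (𝕜 : Type*) [RCLike 𝕜] : ∃ C, InterpBound 𝕜 .triangle C := by
  obtain ⟨C₀, hC₀⟩ := exists_enorm_div_le 𝕜 .triangle
  have hA : ∃ A : ℝ, 0 ≤ A ∧ ∀ e : Fin 3, ∀ x ∈ Shape.triangle.dom,
      |cutoff triangleEdge e x| ≤ A ∧ ‖fderiv ℝ (cutoff triangleEdge e) x‖ ≤ A * (den .triangle x)⁻¹ := by
    choose A A0 hA using fun e => (isEdgeFun_cutoff_triangle e).bound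
    choose B B0 hB using fun e => (isEdgeFun_cutoff_triangle e).fderiv_bound
    refine ⟨∑ e, A e + ∑ e, B e, add_nonneg (Finset.sum_nonneg fun e _ => A0 e)
      (Finset.sum_nonneg fun e _ => B0 e), fun e x hx => ⟨(hA e x hx).trans ?_,
      (hB e x hx).trans (mul_le_mul_of_nonneg_right ?_ (inv_pos.2 (den_pos hx)).le)⟩⟩
    · have h1 := Finset.single_le_sum (fun i _ => A0 i) (Finset.mem_univ e)
      have h2 := Finset.sum_nonneg fun i (_ : i ∈ Finset.univ) => B0 i
      linarith
    · have h1 := Finset.single_le_sum (fun i _ => B0 i) (Finset.mem_univ e)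
      have h2 := Finset.sum_nonneg fun i (_ : i ∈ Finset.univ) => A0 i
      linarith
  obtain ⟨A, A0, hA⟩ := hA
  set K : ℝ≥0 := Real.toNNReal (2 * A) + Real.toNNReal A * C₀ with hK
  refine ⟨8 * (1 + (5 * (K * 3072)) ^ 2), fun h₁ h U f p₁ p hh hU hG hdiv => ?_⟩
  obtain rfl : h₁ = h := hh rfl
  set h := h₁
  set D := Shape.triangle.dom with hD
  have hX := gagliardo_scl_self (S := .triangle) p U
  have hG' : gagliardo D id U < ⊤ := by
    rw [hX]
    exact ENNReal.mul_lt_top (ENNReal.pow_ne_top ENNReal.ofReal_ne_top).lt_top hG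
  have hUd := lintegral_denWeight_enorm_lt_top .triangle hU hG'
  have hU' := lintegral_denWeight_aniso_lt_top p p hUd
  have hN := measurable_enorm_sub hU
  have hw := measurable_denWeight .triangle
  -- fluxes of the differences
  set W : ℝ × ℝ → ℝ≥0∞ := fun y => ∫⁻ x in D, denWeight .triangle x * ‖U x - U y‖ₑ with hW
  have hin : ∀ (y x : ℝ × ℝ), ‖aniso h h (U x - U y)‖ₑ ≤ ENNReal.ofReal h * ‖U x - U y‖ₑ := fun y x => by
    simpa using enorm_aniso_le p p (U x - U y)
  have hflux : ∀ (y : ℝ × ℝ) e, ‖greenPairing D (cutoff triangleEdge e)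
      (fun x => aniso h h (U x - U y)) f‖ₑ ≤ ENNReal.ofReal h * (K * W y) := by
    intro y e
    have hwd : WeakDiv D (fun x => aniso h h (U x - U y)) f := by
      simp only [aniso_sub]
      exact hdiv.sub_const ((continuous_aniso h h).comp_stronglyMeasurable hU) hU' _
    have hf : ‖f‖ₑ ≤ C₀ * (ENNReal.ofReal h * W y) := by
      refine (hC₀ _ f ((continuous_aniso h h).comp_stronglyMeasurable
        (hU.sub stronglyMeasurable_const)) (lintegral_denWeight_aniso_lt_top p p
        (lintegral_denWeight_sub_lt_top hUd (U y))) hwd).trans ?_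
      rw [← lintegral_const_mul' _ _ ENNReal.ofReal_ne_top]
      refine mul_le_mul_right (setLIntegral_mono' (measurableSet_dom _) fun x hx => ?_) _
      refine (hin y x).trans (mul_le_mul_right ?_ _)
      exact le_mul_of_one_le_left' (one_le_denWeight hx)
    refine (enorm_integral_le_lintegral_enorm _).trans ?_
    calc _ ≤ ∫⁻ x in D, (ENNReal.ofReal (2 * A) * (ENNReal.ofReal h *
            (denWeight .triangle x * ‖U x - U y‖ₑ)) + ENNReal.ofReal A * ‖f‖ₑ) := by
          refine setLIntegral_mono' (measurableSet_dom _) fun x hx => ?_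
          refine (enorm_greenDensity_le (hA e x hx).2 (hA e x hx).1).trans ?_
          refine add_le_add ?_ le_rfl
          rw [← mul_assoc 2, ENNReal.ofReal_mul (by positivity), mul_assoc, ← denWeight]
          refine mul_le_mul_right ?_ _
          rw [mul_left_comm]
          exact mul_le_mul_right (hin y x) _
      _ = ENNReal.ofReal (2 * A) * (ENNReal.ofReal h * W y) +
            ENNReal.ofReal A * ‖f‖ₑ * volume D := by
          rw [lintegral_add_right _ measurable_const, lintegral_const_mul' _ _ ENNReal.ofReal_ne_top,
            lintegral_const_mul' _ _ ENNReal.ofReal_ne_top, lintegral_const,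
            Measure.restrict_apply_univ]
      _ ≤ ENNReal.ofReal (2 * A) * (ENNReal.ofReal h * W y) +
            ENNReal.ofReal A * (C₀ * (ENNReal.ofReal h * W y)) * 1 := by
          gcongr
          exact volume_dom_le _
      _ = _ := by
          rw [hK]; push_cast
          rw [show ((2 * A).toNNReal : ℝ≥0∞) = ENNReal.ofReal (2 * A) from rfl,
            show (A.toNNReal : ℝ≥0∞) = ENNReal.ofReal A from rfl]
          ring
  have hmax : max h h = h := max_self h
  refine lintegral_sq_le_of_forall (Q := fun y => 5 * (K * W y)) hU (fun x hx y =>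
    (enorm_error_le p p hU hU' f x y).trans (add_le_add le_rfl ?_)) ?_
    (lintegral_sq_enorm_sub_scl_le p p U)
  · have h1 := enorm_triangleRT_le _ hx (hflux y)
    have h2 : ‖aniso h⁻¹ h⁻¹ (refInterp .triangle (fun x => aniso h h (U x - U y)) (fun _ => f) x)‖ₑ ≤
        ENNReal.ofReal h⁻¹ * (5 * (ENNReal.ofReal h * (K * W y))) := by
      refine (enorm_aniso_le (inv_pos.2 p) (inv_pos.2 p) _).trans ?_
      rw [max_self]
      exact mul_le_mul_right h1 _
    refine h2.trans_eq ?_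
    have i : ENNReal.ofReal h⁻¹ * ENNReal.ofReal h = 1 := by
      rw [← ENNReal.ofReal_mul (inv_pos.2 p).le, inv_mul_cancel₀ p.ne', ENNReal.ofReal_one]
    rw [mul_left_comm, ← mul_assoc (ENNReal.ofReal h⁻¹), i, one_mul]
  · have hswap : ∫⁻ y in D, W y ≤ 3072 * gagliardo D id U ^ (1 / 2 : ℝ) := by
      rw [hW, lintegral_lintegral_swap]
      · have e : ∀ x, ∫⁻ y in D, denWeight .triangle x * ‖U x - U y‖ₑ =
            denWeight .triangle x * ∫⁻ y in D, ‖U x - U y‖ₑ := fun x =>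
          lintegral_const_mul _ (hN.comp measurable_prodMk_left)
        simp only [e]
        exact denWeight_hardy .triangle hU
      · refine Measurable.aemeasurable ?_
        exact (hw.comp measurable_snd).mul (hN.comp measurable_swap)
    rw [lintegral_const_mul' _ _ (by norm_num), lintegral_const_mul' _ _ ENNReal.coe_ne_top, hmax,
      ← hX]
    calc _ ≤ 5 * (K * (3072 * gagliardo D id U ^ (1 / 2 : ℝ))) := by gcongr
      _ = _ := by push_cast; ring

theorem exists_interpBound (𝕜 : Type*) [RCLike 𝕜] : ∃ C, ∀ S, InterpBound 𝕜 S C := by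
  obtain ⟨C, hC⟩ := exists_interpBound_square 𝕜
  obtain ⟨C', hC'⟩ := exists_interpBound_triangle 𝕜
  refine ⟨max C C', fun S h₁ h₂ U f p₁ p₂ hS hU hG hdiv => ?_⟩
  cases S
  · refine (hC h₁ h₂ U f p₁ p₂ hS hU hG hdiv).trans ?_
    gcongr; exact le_max_left _ _
  · refine (hC' h₁ h₂ U f p₁ p₂ hS hU hG hdiv).trans ?_
    gcongr; exact le_max_right _ _

end GradedRT
end

/-! ### Patches in space and the Piola transform. -/

noncomputable section

namespace GradedRT
open scoped ENNReal NNReal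

variable {𝕜 : Type*} [RCLike 𝕜]

/-! ### Vector algebra -/

theorem bdot_add (v w : V 𝕜) (a : E3) : bdot (v + w) a = bdot v a + bdot w a := by
  simp [bdot, add_mul, Finset.sum_add_distrib]

theorem bdot_sub (v w : V 𝕜) (a : E3) : bdot (v - w) a = bdot v a - bdot w a := by
  simp [bdot, sub_mul, Finset.sum_sub_distrib]

theorem bdot_add_right (v : V 𝕜) (a b : E3) : bdot v (a + b) = bdot v a + bdot v b := by
  simp [bdot, mul_add, Finset.sum_add_distrib]

theorem bdot_smul_right (v : V 𝕜) (r : ℝ) (a : E3) : bdot v (r • a) = r • bdot v a := by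
  simp only [bdot, PiLp.smul_apply, smul_eq_mul, RCLike.ofReal_mul, Finset.smul_sum,
    RCLike.real_smul_eq_coe_mul]
  exact Finset.sum_congr rfl fun k _ => by ring

theorem bdot_smul (r : 𝕜) (v : V 𝕜) (a : E3) : bdot (r • v) a = r * bdot v a := by
  simp only [bdot, PiLp.smul_apply, smul_eq_mul, Finset.mul_sum]
  exact Finset.sum_congr rfl fun k _ => by ring

theorem bdot_real_smul (r : ℝ) (v : V 𝕜) (a : E3) : bdot (r • v) a = r • bdot v a := by
  simp only [bdot, PiLp.smul_apply, Finset.smul_sum, smul_mul_assoc]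

theorem bdot_toV (a b : E3) : bdot (toV 𝕜 a) b = ((inner ℝ b a : ℝ) : 𝕜) := by
  simp [bdot, toV, PiLp.inner_apply]

theorem norm_bdot_le (v : V 𝕜) (a : E3) : ‖bdot v a‖ ≤ 3 * (‖v‖ * ‖a‖) := by
  refine (norm_sum_le _ _).trans ?_
  have h : ∀ k ∈ Finset.univ, ‖v k * (a k : 𝕜)‖ ≤ ‖v‖ * ‖a‖ := fun k _ => by
    rw [norm_mul, RCLike.norm_ofReal, ← Real.norm_eq_abs]
    exact mul_le_mul (PiLp.norm_apply_le v k) (PiLp.norm_apply_le a k) (norm_nonneg _) (norm_nonneg _)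
  refine (Finset.sum_le_sum h).trans_eq ?_
  simp

theorem norm_le_sum (v : V 𝕜) : ‖v‖ ≤ ‖v 0‖ + ‖v 1‖ + ‖v 2‖ := by
  refine abs_le_of_sq_le_sq' ?_ (by positivity) |>.2
  rw [EuclideanSpace.norm_sq_eq, Fin.sum_univ_three]
  nlinarith [norm_nonneg (v 0), norm_nonneg (v 1), norm_nonneg (v 2),
    mul_nonneg (norm_nonneg (v 0)) (norm_nonneg (v 1)),
    mul_nonneg (norm_nonneg (v 0)) (norm_nonneg (v 2)),
    mul_nonneg (norm_nonneg (v 1)) (norm_nonneg (v 2))]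

theorem norm_toV (a : E3) : ‖toV 𝕜 a‖ = ‖a‖ := by
  rw [EuclideanSpace.norm_eq, EuclideanSpace.norm_eq]; simp [toV]

theorem cross_apply_zero {R : Type*} [CommRing R] (x y : EuclideanSpace R (Fin 3)) :
    cross x y 0 = x 1 * y 2 - x 2 * y 1 := by simp [cross, cross_apply]

theorem cross_apply_one {R : Type*} [CommRing R] (x y : EuclideanSpace R (Fin 3)) :
    cross x y 1 = x 2 * y 0 - x 0 * y 2 := by simp [cross, cross_apply]

theorem cross_apply_two {R : Type*} [CommRing R] (x y : EuclideanSpace R (Fin 3)) :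
    cross x y 2 = x 0 * y 1 - x 1 * y 0 := by simp [cross, cross_apply]

theorem cross_sub_left (v w z : V 𝕜) : cross (v - w) z = cross v z - cross w z := by
  ext k
  fin_cases k <;> simp [cross_apply_zero, cross_apply_one, cross_apply_two] <;> ring

theorem norm_cross_le (v w : V 𝕜) : ‖cross v w‖ ≤ 6 * (‖v‖ * ‖w‖) := by
  have h : ∀ k l m n : Fin 3, ‖v k * w l - v m * w n‖ ≤ 2 * (‖v‖ * ‖w‖) := fun k l m n => by
    refine (norm_sub_le _ _).trans ?_
    rw [norm_mul, norm_mul, two_mul]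
    exact add_le_add
      (mul_le_mul (PiLp.norm_apply_le v k) (PiLp.norm_apply_le w l) (norm_nonneg _) (norm_nonneg _))
      (mul_le_mul (PiLp.norm_apply_le v m) (PiLp.norm_apply_le w n) (norm_nonneg _) (norm_nonneg _))
  refine (norm_le_sum _).trans ?_
  rw [cross_apply_zero, cross_apply_one, cross_apply_two]
  linarith [h 1 2 2 1, h 2 0 0 2, h 0 1 1 0]

theorem continuous_cross (w : V 𝕜) : Continuous fun v : V 𝕜 => cross v w := by
  have e : (fun v : V 𝕜 => cross v w) = fun v => WithLp.toLp 2
      ![v 1 * w 2 - v 2 * w 1, v 2 * w 0 - v 0 * w 2, v 0 * w 1 - v 1 * w 0] := by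
    funext v; simp [cross, cross_apply]
  rw [e]
  refine (PiLp.continuous_toLp 2 _).comp (continuous_pi fun k => ?_)
  fin_cases k <;> simp <;> fun_prop

theorem continuous_bdot (a : E3) : Continuous fun v : V 𝕜 => bdot v a := by
  unfold bdot; fun_prop

theorem bdot_cross_self (v : V 𝕜) (a : E3) : bdot (cross v (toV 𝕜 a)) a = 0 := by
  simp only [bdot, Fin.sum_univ_three, cross_apply_zero, cross_apply_one, cross_apply_two, toV]
  ring

/-! ### Geometry of patches -/

namespace Patch

variable {K : Patch}

theorem continuous_map (K : Patch) : Continuous K.map := by unfold map; fun_prop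

theorem map_injective (h : K.jac ≠ 0) : Function.Injective K.map :=
  Function.LeftInverse.injective (coord_map K h)

theorem measurableEmbedding_map (h : K.jac ≠ 0) : MeasurableEmbedding K.map :=
  (continuous_map K).measurableEmbedding (map_injective h)

theorem measurableSet_carrier (h : K.jac ≠ 0) : MeasurableSet K.carrier :=
  (measurableEmbedding_map h).measurableSet_image.2 (measurableSet_dom _)

theorem jac_nonneg (K : Patch) : 0 ≤ K.jac := norm_nonneg _

theorem jac_pos (h : K.jac ≠ 0) : 0 < K.jac := (jac_nonneg K).lt_of_ne' h

theorem lintegral_surfMeasure (h : K.jac ≠ 0) (g : E3 → ℝ≥0∞) :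
    ∫⁻ y, g y ∂K.surfMeasure = ENNReal.ofReal K.jac * ∫⁻ x in K.shape.dom, g (K.map x) := by
  rw [surfMeasure, lintegral_smul_measure, (measurableEmbedding_map h).lintegral_map, smul_eq_mul]

theorem integral_surfMeasure (h : K.jac ≠ 0) (g : E3 → 𝕜) :
    ∫ y, g y ∂K.surfMeasure = K.jac • ∫ x in K.shape.dom, g (K.map x) := by
  rw [surfMeasure, integral_smul_measure, (measurableEmbedding_map h).integral_map,
    ENNReal.toReal_ofReal (jac_nonneg K)]

theorem ae_surfMeasure_iff (h : K.jac ≠ 0) (p : E3 → Prop) :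
    (∀ᵐ y ∂K.surfMeasure, p y) ↔ ∀ᵐ x ∂volume.restrict K.shape.dom, p (K.map x) := by
  rw [surfMeasure, Measure.ae_ennreal_smul_measure_iff (by simpa using jac_pos h),
    (measurableEmbedding_map h).ae_map_iff]

theorem ae_mem_carrier (h : K.jac ≠ 0) : ∀ᵐ y ∂K.surfMeasure, y ∈ K.carrier := by
  rw [ae_surfMeasure_iff h]
  exact (ae_restrict_mem (measurableSet_dom _)).mono fun x hx => mem_image_of_mem _ hx

theorem inner_dual (h : K.jac ≠ 0) : inner ℝ K.dualA K.a = (1 : ℝ) ∧ inner ℝ K.dualB K.a = (0 : ℝ) ∧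
    inner ℝ K.dualA K.b = (0 : ℝ) ∧ inner ℝ K.dualB K.b = (1 : ℝ) := by
  have h1 := coord_map K h (1, 0)
  have h2 := coord_map K h (0, 1)
  simp only [coord, map, Prod.mk.injEq] at h1 h2
  have e1 : K.p + (1 : ℝ) • K.a + (0 : ℝ) • K.b - K.p = K.a := by simp
  have e2 : K.p + (0 : ℝ) • K.a + (1 : ℝ) • K.b - K.p = K.b := by simp
  rw [e1] at h1
  rw [e2] at h2
  exact ⟨h1.1, h1.2, h2.1, h2.2⟩

/-- A tangential vector is determined by its components along the patch. -/
theorem bdot_dual_smul (h : K.jac ≠ 0) {w : V 𝕜} (hw : bdot w K.nrm = 0) :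
    bdot w K.dualA • toV 𝕜 K.a + bdot w K.dualB • toV 𝕜 K.b = w := by
  have hJ : K.jac ^ 2 = (K.nrm 0) ^ 2 + (K.nrm 1) ^ 2 + (K.nrm 2) ^ 2 := by
    rw [jac, EuclideanSpace.norm_sq_eq]
    simp [Fin.sum_univ_three]
  have h2 : ((K.jac ^ 2 : ℝ) : 𝕜) ≠ 0 := by exact_mod_cast pow_ne_zero 2 h
  have key : bdot w (cross K.b K.nrm) • toV 𝕜 K.a + bdot w (cross K.nrm K.a) • toV 𝕜 K.b =
      ((K.jac ^ 2 : ℝ) : 𝕜) • w := by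
    have h0 : K.nrm 0 = K.a 1 * K.b 2 - K.a 2 * K.b 1 := cross_apply_zero _ _
    have h1 : K.nrm 1 = K.a 2 * K.b 0 - K.a 0 * K.b 2 := cross_apply_one _ _
    have h3 : K.nrm 2 = K.a 0 * K.b 1 - K.a 1 * K.b 0 := cross_apply_two _ _
    rw [hJ]
    simp only [bdot, Fin.sum_univ_three] at hw
    ext k
    simp only [bdot, Fin.sum_univ_three, cross_apply_zero, cross_apply_one, cross_apply_two,
      PiLp.add_apply, PiLp.smul_apply, toV, smul_eq_mul]
    rw [h0, h1, h3] at hw ⊢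
    push_cast at hw ⊢
    fin_cases k
    · simp only [Fin.zero_eta]
      linear_combination (-((K.a 1 : 𝕜) * K.b 2 - K.a 2 * K.b 1)) * hw
    · simp only [Fin.mk_one]
      linear_combination (-((K.a 2 : 𝕜) * K.b 0 - K.a 0 * K.b 2)) * hw
    · simp only [Fin.reduceFinMk]
      linear_combination (-((K.a 0 : 𝕜) * K.b 1 - K.a 1 * K.b 0)) * hw
  rw [dualA, dualB, bdot_smul_right, bdot_smul_right, smul_assoc, smul_assoc, ← smul_add, key,
    RCLike.real_smul_eq_coe_smul (K := 𝕜), smul_smul, RCLike.ofReal_inv, inv_mul_cancel₀ h2, one_smul]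

theorem pull_push (h : K.jac ≠ 0) (r : ℝ × ℝ → 𝕜 × 𝕜) (x : ℝ × ℝ) :
    K.pull (K.push r) x = r x := by
  obtain ⟨h1, h2, h3, h4⟩ := inner_dual h
  simp only [pull, push, coord_map K h, bdot_real_smul, bdot_add, bdot_smul, bdot_toV, h1, h2, h3, h4,
    smul_smul, mul_inv_cancel₀ h, one_smul]
  ext <;> simp

theorem push_pull (h : K.jac ≠ 0) {u : E3 → V 𝕜} {x : ℝ × ℝ} (hu : bdot (u (K.map x)) K.nrm = 0) :
    K.push (K.pull u) (K.map x) = u (K.map x) := by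
  refine Eq.trans ?_ (bdot_dual_smul h hu)
  simp only [push, pull, coord_map K h, smul_assoc, ← smul_add, smul_smul, inv_mul_cancel₀ h,
    one_smul]

theorem push_sub (w r : ℝ × ℝ → 𝕜 × 𝕜) (y : E3) :
    K.push w y - K.push r y = K.push (fun x => w x - r x) y := by
  simp only [push, ← smul_sub, Prod.fst_sub, Prod.snd_sub, sub_smul]
  congr 1; abel

theorem norm_push_map_le (h : K.jac ≠ 0) (w : ℝ × ℝ → 𝕜 × 𝕜) (x : ℝ × ℝ) :
    ‖K.push w (K.map x)‖ ≤ K.jac⁻¹ * (‖(w x).1‖ * ‖K.a‖ + ‖(w x).2‖ * ‖K.b‖) := by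
  rw [push, coord_map K h, norm_smul, Real.norm_of_nonneg (inv_nonneg.2 (jac_nonneg K))]
  refine mul_le_mul_of_nonneg_left ((norm_add_le _ _).trans_eq ?_) (inv_nonneg.2 (jac_nonneg K))
  rw [norm_smul, norm_smul, norm_toV, norm_toV]

theorem norm_jac_dual_le (h : K.jac ≠ 0) :
    K.jac * ‖K.dualA‖ ≤ 6 * ‖K.b‖ ∧ K.jac * ‖K.dualB‖ ≤ 6 * ‖K.a‖ := by
  have hp := jac_pos h
  have e : ∀ t z : ℝ, z ≤ 6 * (t * K.jac) → K.jac * ((K.jac ^ 2)⁻¹ * z) ≤ 6 * t := fun t z hz => by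
    have : K.jac * ((K.jac ^ 2)⁻¹ * z) = z / K.jac := by field_simp
    rw [this, div_le_iff₀ hp]; linarith
  constructor
  · rw [dualA, norm_smul, Real.norm_of_nonneg (by positivity)]
    exact e _ _ (norm_cross_le K.b K.nrm)
  · rw [dualB, norm_smul, Real.norm_of_nonneg (by positivity)]
    exact e _ _ ((norm_cross_le K.nrm K.a).trans_eq (by rw [mul_comm ‖K.nrm‖]; rfl))

end Patch

/-! ### Patches contained in a patch -/

/-- The patch `K` is a part of the patch `F`. -/
structure IsSub (K F : Patch) : Prop where
  jac_ne : K.jac ≠ 0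
  jac_ne' : F.jac ≠ 0
  subset : K.carrier ⊆ F.carrier
  surf_eq : K.surfMeasure = F.surfMeasure.restrict K.carrier
  nrm_eq : ∃ r : ℝ, r ≠ 0 ∧ K.nrm = r • F.nrm
  range_eq : range K.map = range F.map

theorem IsSub.trans {K B F : Patch} (h : IsSub K B) (h' : IsSub B F) : IsSub K F := by
  obtain ⟨r, r0, hr⟩ := h.nrm_eq
  obtain ⟨s, s0, hs⟩ := h'.nrm_eq
  refine ⟨h.jac_ne, h'.jac_ne', h.subset.trans h'.subset, ?_, ⟨r * s, mul_ne_zero r0 s0, ?_⟩,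
    h.range_eq.trans h'.range_eq⟩
  · rw [h.surf_eq, h'.surf_eq, Measure.restrict_restrict_of_subset h.subset]
  · rw [hr, hs, smul_smul]

/-- The part of the patch `F` with parameters in the image of a reference element under an affine
map of the plane. -/
def Patch.sub (F : Patch) (S : Shape) (p a b : ℝ × ℝ) : Patch :=
  ⟨S, F.map p, a.1 • F.a + a.2 • F.b, b.1 • F.a + b.2 • F.b⟩

theorem Patch.sub_map (F : Patch) (S : Shape) (p a b x : ℝ × ℝ) :
    (F.sub S p a b).map x = F.map (planeMap p a b x) := by
  simp only [Patch.map, Patch.sub, planeMap, Prod.fst_add, Prod.snd_add, Prod.smul_fst,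
    Prod.smul_snd, smul_eq_mul]
  module

theorem Patch.sub_nrm (F : Patch) (S : Shape) (p a b : ℝ × ℝ) :
    (F.sub S p a b).nrm = (a.1 * b.2 - a.2 * b.1) • F.nrm := by
  ext k
  fin_cases k <;>
    simp [Patch.sub, Patch.nrm, cross_apply_zero, cross_apply_one, cross_apply_two] <;> ring

theorem Patch.sub_jac (F : Patch) (S : Shape) (p a b : ℝ × ℝ) :
    (F.sub S p a b).jac = |a.1 * b.2 - a.2 * b.1| * F.jac := by
  rw [Patch.jac, Patch.sub_nrm, norm_smul, Real.norm_eq_abs, Patch.jac]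

theorem planeMap_surjective (p a b : ℝ × ℝ) (h : a.1 * b.2 - a.2 * b.1 ≠ 0) :
    Function.Surjective (planeMap p a b) := by
  intro y
  have hi := mul_inv_cancel₀ h
  set i := (a.1 * b.2 - a.2 * b.1)⁻¹
  refine ⟨((b.2 * (y.1 - p.1) - b.1 * (y.2 - p.2)) * i,
    (a.1 * (y.2 - p.2) - a.2 * (y.1 - p.1)) * i), ?_⟩
  ext
  · simp only [planeMap, Prod.fst_add, Prod.smul_fst, smul_eq_mul]
    linear_combination (y.1 - p.1) * hi
  · simp only [planeMap, Prod.snd_add, Prod.smul_snd, smul_eq_mul]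
    linear_combination (y.2 - p.2) * hi

/-- The Jacobian of the composite parametrisation is that of `F` times the modulus of the planar
determinant, so the surface measures agree by the planar change of variables. -/
theorem isSub_sub {F : Patch} (hF : F.jac ≠ 0) {S : Shape} {p a b : ℝ × ℝ}
    (hd : a.1 * b.2 - a.2 * b.1 ≠ 0) (hm : MapsTo (planeMap p a b) S.dom F.shape.dom) :
    IsSub (F.sub S p a b) F := by
  have hK : (F.sub S p a b).jac ≠ 0 := by
    rw [Patch.sub_jac]; exact mul_ne_zero (abs_ne_zero.2 hd) hF
  have hc : (F.sub S p a b).carrier = F.map '' (planeMap p a b '' S.dom) := by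
    rw [Patch.carrier, image_image]
    exact image_congr fun x _ => Patch.sub_map F S p a b x
  have hsub : planeMap p a b '' S.dom ⊆ F.shape.dom := hm.image_subset
  refine ⟨hK, hF, ?_, ?_, ⟨_, hd, Patch.sub_nrm F S p a b⟩, ?_⟩
  · rw [hc]; exact image_mono hsub
  · refine Measure.ext_of_lintegral _ fun g _ => ?_
    rw [Patch.lintegral_surfMeasure hK, ← lintegral_indicator (Patch.measurableSet_carrier hK),
      Patch.lintegral_surfMeasure hF, Patch.sub_jac, ENNReal.ofReal_mul (abs_nonneg _)]
    have e : ∀ x, (F.sub S p a b).carrier.indicator g (F.map x) =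
        (planeMap p a b '' S.dom).indicator (fun x => g (F.map x)) x := fun x => by
      rw [hc]
      by_cases hx : x ∈ planeMap p a b '' S.dom
      · rw [indicator_of_mem hx, indicator_of_mem (mem_image_of_mem _ hx)]
      · rw [indicator_of_notMem hx, indicator_of_notMem]
        rintro ⟨z, hz, hzx⟩
        exact hx (Patch.map_injective hF hzx ▸ hz)
    simp only [e]
    have hmeas : MeasurableSet (planeMap p a b '' S.dom) := by
      have hcont : Continuous (planeMap p a b) := by unfold planeMap; fun_prop
      exact (hcont.measurableEmbedding (planeMap_injective p a b hd)).measurableSet_image.2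
        (measurableSet_dom S)
    rw [lintegral_indicator hmeas, Measure.restrict_restrict hmeas, inter_eq_left.2 hsub,
      lintegral_image_planeMap p a b hd (measurableSet_dom S)]
    simp only [Patch.sub_map]
    rw [mul_comm (ENNReal.ofReal |_|), mul_assoc]
    rfl
  · have : (F.sub S p a b).map = F.map ∘ planeMap p a b := funext fun x => Patch.sub_map F S p a b x
    rw [this, (planeMap_surjective p a b hd).range_comp]

end GradedRT
end

/-! ### Faces and their six blocks in barycentric coordinates. -/

noncomputable section

namespace GradedRT
open scoped ENNReal NNReal

/-! ### Barycentric coordinates of a face -/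

/-- The vertices of the reference triangle. -/
def refVert : Fin 3 → ℝ × ℝ := ![(0, 0), (1, 0), (1, 1)]

/-- The barycentric coordinates of the reference triangle. -/
def bary : Fin 3 → ℝ × ℝ → ℝ := ![fun x => 1 - x.1, fun x => x.1 - x.2, fun x => x.2]

theorem mem_triangle_iff (x : ℝ × ℝ) : x ∈ Shape.triangle.dom ↔ ∀ k, 0 < bary k x := by
  simp only [Fin.forall_fin_succ, bary, Shape.dom, mem_ofPred_eq]
  simp only [Matrix.cons_val_zero, Matrix.cons_val_succ, sub_pos, IsEmpty.forall_iff, and_true]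
  constructor
  · rintro ⟨h1, h2, h3, h4⟩; exact ⟨h2, h4, h3⟩
  · rintro ⟨h2, h4, h3⟩; exact ⟨h3.trans h4, h2, h3, h4⟩

theorem bary_sum (x : ℝ × ℝ) : bary 0 x + bary 1 x + bary 2 x = 1 := by simp [bary]

theorem trianglePatch_map_eq (v : Fin 3 → E3) (x : ℝ × ℝ) :
    (trianglePatch v).map x = ∑ k, bary k x • v k := by
  simp only [trianglePatch, Patch.map, Fin.sum_univ_three, bary]
  simp only [Matrix.cons_val_zero, Matrix.cons_val_one, Matrix.cons_val]
  module

theorem trianglePatch_map_refVert (v : Fin 3 → E3) (k : Fin 3) :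
    (trianglePatch v).map (refVert k) = v k := by
  fin_cases k <;> simp [trianglePatch, Patch.map, refVert]

theorem Patch.lin_sub (F : Patch) (c : ℝ) (z w : ℝ × ℝ) :
    (c • (z - w)).1 • F.a + (c • (z - w)).2 • F.b = c • (F.map z - F.map w) := by
  simp only [Patch.map, Prod.smul_fst, Prod.smul_snd, Prod.fst_sub, Prod.snd_sub, smul_eq_mul]
  module

theorem Patch.map_add_lin (F : Patch) (c : ℝ) (z w y : ℝ × ℝ) :
    F.map (y + c • (z - w)) = F.map y + c • (F.map z - F.map w) := by
  simp only [Patch.map, Prod.smul_fst, Prod.smul_snd, Prod.fst_sub, Prod.snd_sub, smul_eq_mul,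
    Prod.fst_add, Prod.snd_add]
  module

theorem trianglePatch_jac_ne {v : Fin 3 → E3} (hv : AffineIndependent ℝ v) :
    (trianglePatch v).jac ≠ 0 := by
  rw [Patch.jac, norm_ne_zero_iff]
  intro h0
  have h1 : crossProduct (trianglePatch v).a.ofLp (trianglePatch v).b.ofLp = 0 := by
    have := congrArg WithLp.ofLp h0
    simpa [Patch.nrm, cross] using this
  refine (crossProduct_ne_zero_iff_linearIndependent.2 ?_) h1
  rw [LinearIndependent.pair_iff]
  intro s t hst
  have hst' : s • (trianglePatch v).a + t • (trianglePatch v).b = 0 := by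
    ext k; exact congrFun hst k
  -- The relation s(v₁ − v₀) + t(v₂ − v₁) = 0 is an affine relation with weights −s, s − t, t.
  have hw := (affineIndependent_iff.1 hv) Finset.univ ![-s, s - t, t]
    (by simp [Fin.sum_univ_three]; ring) (by
      rw [← hst']
      simp only [Fin.sum_univ_three, trianglePatch, Matrix.cons_val_zero, Matrix.cons_val_one,
        Matrix.cons_val]
      module)
  have h0 := hw 0 (Finset.mem_univ _)
  have h2 := hw 2 (Finset.mem_univ _)
  simp at h0 h2
  exact ⟨h0, h2⟩

theorem carrier_subset_convexHull (v : Fin 3 → E3) :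
    (trianglePatch v).carrier ⊆ convexHull ℝ (range v) := by
  rintro _ ⟨x, hx, rfl⟩
  rw [trianglePatch_map_eq]
  have hx' := (mem_triangle_iff x).1 hx
  refine (convex_convexHull ℝ _).sum_mem (fun k _ => (hx' k).le) ?_
    fun k _ => subset_convexHull ℝ _ (mem_range_self k)
  rw [Fin.sum_univ_three, bary_sum]

theorem Patch.coord_combo (F : Patch) {a b : ℝ} (hab : a + b = 1) (y z : E3) :
    F.coord (a • y + b • z) = a • F.coord y + b • F.coord z := by
  have e : a • y + b • z - F.p = a • (y - F.p) + b • (z - F.p) := by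
    have : F.p = (a + b) • F.p := by rw [hab, one_smul]
    nth_rw 1 [this]
    module
  simp only [Patch.coord, e, inner_add_right, inner_smul_right]
  rfl

theorem bary_combo (k : Fin 3) {a b : ℝ} (hab : a + b = 1) (y z : ℝ × ℝ) :
    bary k (a • y + b • z) = a * bary k y + b * bary k z := by
  fin_cases k
  · simp [bary]; linear_combination -hab
  · simp [bary]; ring
  · simp [bary]

theorem bary_refVert_of_ne {k l : Fin 3} (h : l ≠ k) : bary k (refVert l) = 0 := by
  fin_cases k <;> fin_cases l <;> simp_all [bary, refVert]

/-- The k-th barycentric coordinate vanishes on the hull of the other vertices and is positive on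
the open face. -/
theorem not_mem_convexHull_of_mem_carrier {v : Fin 3 → E3} (hv : AffineIndependent ℝ v) {k : Fin 3}
    {s : Set E3} (hs : s ⊆ range v) (hk : v k ∉ s) {y : E3} (hy : y ∈ (trianglePatch v).carrier) :
    y ∉ convexHull ℝ s := by
  have hF := trianglePatch_jac_ne hv
  intro hc
  have hsub : convexHull ℝ s ⊆ {y | bary k ((trianglePatch v).coord y) = 0} := by
    refine convexHull_min ?_ ?_
    · intro z hz
      obtain ⟨l, rfl⟩ := hs hz
      have hl : l ≠ k := fun h => hk (h ▸ hz)
      rw [mem_ofPred_eq, ← trianglePatch_map_refVert v l, Patch.coord_map _ hF,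
        bary_refVert_of_ne hl]
    · intro y hy z hz a b _ _ hab
      rw [mem_ofPred_eq] at hy hz ⊢
      rw [Patch.coord_combo _ hab, bary_combo k hab, hy, hz]; simp
  obtain ⟨x, hx, rfl⟩ := hy
  have := hsub hc
  rw [mem_ofPred_eq, Patch.coord_map _ hF] at this
  exact ((mem_triangle_iff x).1 hx k).ne' this

namespace PolyhedralSurface

variable {ι : Type*} (Γ : PolyhedralSurface ι)

/-- The patch of a face. -/
abbrev face (i : ι) : Patch := trianglePatch (Γ.vert i)

theorem face_jac_ne (i : ι) : (Γ.face i).jac ≠ 0 := trianglePatch_jac_ne (Γ.indep i)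

/-- By conformity a common point lies in the hull of the common vertices. Distinct faces cannot
share all three, so one vertex of face i is missing from that hull, which therefore does not meet
the open face. -/
theorem disjoint_carrier_hull {i j : ι} (h : i ≠ j) :
    Disjoint (Γ.face i).carrier (convexHull ℝ (range (Γ.vert j))) := by
  rw [Set.disjoint_left]
  intro y hy hyj
  have hy2 : y ∈ convexHull ℝ (range (Γ.vert i) ∩ range (Γ.vert j)) :=
    Γ.conforming i j ▸ ⟨carrier_subset_convexHull _ hy, hyj⟩
  by_cases hsub : ∀ k, Γ.vert i k ∈ range (Γ.vert j)
  · refine Γ.distinct i j h (Set.eq_of_subset_of_ncard_le (range_subset_iff.2 hsub) ?_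
      (finite_range _))
    rw [ncard_range_of_injective (Γ.indep i).injective, ncard_range_of_injective (Γ.indep j).injective]
  · push Not at hsub
    obtain ⟨k, hk⟩ := hsub
    exact not_mem_convexHull_of_mem_carrier (Γ.indep i) inter_subset_left (fun h => hk h.2) hy hy2

theorem disjoint_carrier {i j : ι} (h : i ≠ j) : Disjoint (Γ.face i).carrier (Γ.face j).carrier :=
  (Γ.disjoint_carrier_hull h).mono_right (carrier_subset_convexHull _)

variable [Fintype ι]

theorem surfMeasure_restrict {i : ι} {K : Patch} (hK : IsSub K (Γ.face i)) :
    Γ.surfMeasure.restrict K.carrier = K.surfMeasure := by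
  have hKm := Patch.measurableSet_carrier hK.jac_ne
  rw [hK.surf_eq]
  refine Measure.ext fun s hs => ?_
  rw [Measure.restrict_apply hs, Measure.restrict_apply hs, surfMeasure, Measure.finsetSum_apply]
  refine Finset.sum_eq_single i (fun j _ hj => ?_) (by simp)
  have h1 := Patch.ae_mem_carrier (Γ.face_jac_ne j)
  refine measure_mono_null (fun y hy => (?_ : ¬ y ∈ (Γ.face j).carrier)) h1
  exact fun hyj => (Γ.disjoint_carrier hj).le_bot ⟨hyj, hK.subset hy.2⟩

theorem ae_surfMeasure_iff {p : E3 → Prop} :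
    (∀ᵐ y ∂Γ.surfMeasure, p y) ↔ ∀ i, ∀ᵐ y ∂Γ.faceMeasure i, p y := by
  simp only [ae_iff, surfMeasure, Measure.finsetSum_apply, Finset.sum_eq_zero_iff,
    Finset.mem_univ, true_implies]

end PolyhedralSurface

/-! ### Blocks of the reference triangle -/

/-- Origin and edge vectors of the blocks of the reference triangle; `τ` tells which endpoint of the
edge `k` comes first in the triangular block at that edge. -/
def refBlock (k : Fin 3) (τ : Bool) : Shape → (ℝ × ℝ) × (ℝ × ℝ) × (ℝ × ℝ)
  | .square => (refVert k, (1 / 3 : ℝ) • (refVert (k + 1) - refVert k),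
      (1 / 3 : ℝ) • (refVert (k + 2) - refVert k))
  | .triangle =>
    let P := refVert (if τ then k else k + 1)
    let R := refVert (if τ then k + 1 else k)
    (P + (1 / 3 : ℝ) • (R - P), (1 / 3 : ℝ) • (R - P), (1 / 3 : ℝ) • (refVert (k + 2) - R))

/-- The parametrisation of a block of the reference triangle. -/
def blockMap (k : Fin 3) (τ : Bool) (S : Shape) : ℝ × ℝ → ℝ × ℝ :=
  planeMap (refBlock k τ S).1 (refBlock k τ S).2.1 (refBlock k τ S).2.2

theorem refBlock_det (k : Fin 3) (τ : Bool) (S : Shape) :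
    |(refBlock k τ S).2.1.1 * (refBlock k τ S).2.2.2 - (refBlock k τ S).2.1.2 * (refBlock k τ S).2.2.1|
      = 1 / 9 := by
  cases S <;> cases τ <;> fin_cases k <;> simp [refBlock, refVert] <;> norm_num [abs_of_neg]

theorem refBlock_det_ne (k : Fin 3) (τ : Bool) (S : Shape) :
    (refBlock k τ S).2.1.1 * (refBlock k τ S).2.2.2 -
      (refBlock k τ S).2.1.2 * (refBlock k τ S).2.2.1 ≠ 0 := by
  rw [← abs_ne_zero, refBlock_det]; norm_num

theorem bary_blockMap_square (k : Fin 3) (τ : Bool) (x : ℝ × ℝ) :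
    bary k (blockMap k τ .square x) = 1 - (x.1 + x.2) / 3 ∧
    bary (k + 1) (blockMap k τ .square x) = x.1 / 3 ∧
    bary (k + 2) (blockMap k τ .square x) = x.2 / 3 := by
  fin_cases k <;> refine ⟨?_, ?_, ?_⟩ <;> simp [blockMap, planeMap, refBlock, refVert, bary] <;> ring

theorem bary_blockMap_triangle (k : Fin 3) (τ : Bool) (x : ℝ × ℝ) :
    bary (if τ then k else k + 1) (blockMap k τ .triangle x) = (2 - x.1) / 3 ∧
    bary (if τ then k + 1 else k) (blockMap k τ .triangle x) = (1 + x.1 - x.2) / 3 ∧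
    bary (k + 2) (blockMap k τ .triangle x) = x.2 / 3 := by
  cases τ <;> fin_cases k <;> refine ⟨?_, ?_, ?_⟩ <;>
    simp [blockMap, planeMap, refBlock, refVert, bary] <;> ring

/-- Position of the points of a block relative to the parallels through the centroid. -/
theorem bary_lt_iff (k : Fin 3) (τ : Bool) (S : Shape) {x : ℝ × ℝ} (hx : x ∈ S.dom) (m : Fin 3) :
    bary m (blockMap k τ S x) < 1 / 3 ↔
      (match S with | .square => m ≠ k | .triangle => m = k + 2) := by
  have hm : m = k ∨ m = k + 1 ∨ m = k + 2 := by revert m k; decide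
  have n2 : k + 2 ≠ k := by clear hm; revert k; decide
  have n3 : k + 1 ≠ k + 2 := by clear hm; revert k; decide
  cases S
  · obtain ⟨h0, h1, h2⟩ := bary_blockMap_square k τ x
    obtain ⟨a, b, c, d⟩ := hx
    rcases hm with rfl | rfl | rfl
    · rw [h0]; simp; linarith
    · rw [h1]; simp; linarith
    · rw [h2]; simp [n2]; linarith
  · obtain ⟨h0, h1, h2⟩ := bary_blockMap_triangle k τ x
    obtain ⟨a, b, c, d⟩ := hx
    have e0 : ∀ t, bary t (blockMap k τ .triangle x) = (2 - x.1) / 3 →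
        ¬ bary t (blockMap k τ .triangle x) < 1 / 3 := fun t ht => by rw [ht]; push Not; linarith
    have e1 : ∀ t, bary t (blockMap k τ .triangle x) = (1 + x.1 - x.2) / 3 →
        ¬ bary t (blockMap k τ .triangle x) < 1 / 3 := fun t ht => by rw [ht]; push Not; linarith
    rcases hm with rfl | rfl | rfl
    · refine iff_of_false ?_ (fun h => n2 h.symm)
      cases τ
      · exact e1 _ h1
      · exact e0 _ h0
    · refine iff_of_false ?_ n3
      cases τ
      · exact e0 _ h0
      · exact e1 _ h1
    · rw [h2]; simp; linarith

theorem blockMap_mapsTo (k : Fin 3) (τ : Bool) (S : Shape) :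
    MapsTo (blockMap k τ S) S.dom Shape.triangle.dom := by
  intro x hx
  rw [mem_triangle_iff]
  intro m
  have hm : m = k ∨ m = k + 1 ∨ m = k + 2 := by revert m k; decide
  cases S
  · obtain ⟨h0, h1, h2⟩ := bary_blockMap_square k τ x
    obtain ⟨a, b, c, d⟩ := hx
    rcases hm with rfl | rfl | rfl
    · rw [h0]; linarith
    · rw [h1]; linarith
    · rw [h2]; linarith
  · obtain ⟨h0, h1, h2⟩ := bary_blockMap_triangle k τ x
    obtain ⟨a, b, c, d⟩ := hx
    by_cases h : 0 < bary m (blockMap k τ .triangle x)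
    · exact h
    rcases hm with rfl | rfl | rfl
    · cases τ
      · rw [if_neg (by simp)] at h1; rw [h1]; linarith
      · rw [if_pos rfl] at h0; rw [h0]; linarith
    · cases τ
      · rw [if_neg (by simp)] at h0; rw [h0]; linarith
      · rw [if_pos rfl] at h1; rw [h1]; linarith
    · rw [h2]; linarith

/-- The set of barycentric coordinates below 1/3 identifies the block: all but the k-th for the
parallelogram at vertex k, only the one opposite the edge for a triangle. -/
theorem block_index_unique {k k' : Fin 3} {τ τ' : Bool} {S S' : Shape} {x x' : ℝ × ℝ}
    (hx : x ∈ S.dom) (hx' : x' ∈ S'.dom) (h : blockMap k τ S x = blockMap k' τ' S' x') :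
    k = k' ∧ S = S' := by
  have key : ∀ m, _ ↔ _ := fun m => (bary_lt_iff k τ S hx m).symm.trans
    ((iff_of_eq (by rw [h])).trans (bary_lt_iff k' τ' S' hx' m))
  cases S <;> cases S'
  · refine ⟨?_, rfl⟩
    have : ∀ k k' : Fin 3, (∀ m, m ≠ k ↔ m ≠ k') → k = k' := by decide
    exact this k k' key
  · have : ∀ k k' : Fin 3, ¬ (∀ m, m ≠ k ↔ m = k' + 2) := by decide
    exact (this k k' key).elim
  · have : ∀ k k' : Fin 3, ¬ (∀ m, m = k + 2 ↔ m ≠ k') := by decide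
    exact (this k k' key).elim
  · refine ⟨?_, rfl⟩
    have : ∀ k k' : Fin 3, (∀ m, m = k + 2 ↔ m = k' + 2) → k = k' := by decide
    exact this k k' key

theorem blockMap_square_inv (k : Fin 3) (τ : Bool) (z : ℝ × ℝ) :
    blockMap k τ .square (3 * bary (k + 1) z, 3 * bary (k + 2) z) = z := by
  fin_cases k <;> ext <;> simp [blockMap, planeMap, refBlock, refVert, bary] <;> ring

theorem blockMap_triangle_inv (k : Fin 3) (τ : Bool) (z : ℝ × ℝ) :
    blockMap k τ .triangle (2 - 3 * bary (if τ then k else k + 1) z, 3 * bary (k + 2) z) = z := by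
  cases τ <;> fin_cases k <;> ext <;> simp [blockMap, planeMap, refBlock, refVert, bary] <;> ring

/-- The barycentric coordinates sum to 1, so off the three parallels either two of them are below
1/3, which gives a parallelogram, or two are above, which gives a triangle. -/
theorem exists_blockMap_eq (τ : Fin 3 → Bool) {z : ℝ × ℝ} (hz : z ∈ Shape.triangle.dom)
    (h : ∀ m, bary m z ≠ 1 / 3) : ∃ k S, ∃ x ∈ S.dom, blockMap k (τ k) S x = z := by
  have hz' := (mem_triangle_iff z).1 hz
  have hs := bary_sum z
  have hs' : ∀ k : Fin 3, bary k z + bary (k + 1) z + bary (k + 2) z = 1 := fun k => by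
    fin_cases k <;> simp <;> linarith
  have hcase : (∃ k : Fin 3, bary (k + 1) z < 1 / 3 ∧ bary (k + 2) z < 1 / 3) ∨
      ∃ k : Fin 3, 1 / 3 < bary k z ∧ 1 / 3 < bary (k + 1) z := by
    rcases (h 0).lt_or_gt with h0 | h0 <;> rcases (h 1).lt_or_gt with h1 | h1 <;>
      rcases (h 2).lt_or_gt with h2 | h2
    · exact Or.inl ⟨0, h1, h2⟩
    · exact Or.inl ⟨2, h0, h1⟩
    · exact Or.inl ⟨1, h2, h0⟩
    · exact Or.inr ⟨1, h1, h2⟩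
    · exact Or.inl ⟨0, h1, h2⟩
    · exact Or.inr ⟨2, h2, h0⟩
    · exact Or.inr ⟨0, h0, h1⟩
    · linarith
  rcases hcase with ⟨k, h1, h2⟩ | ⟨k, h1, h2⟩
  · refine ⟨k, .square, _, ?_, blockMap_square_inv k (τ k) z⟩
    have := hz' (k + 1)
    have := hz' (k + 2)
    refine ⟨?_, ?_, ?_, ?_⟩ <;> simp only <;> linarith
  · refine ⟨k, .triangle, _, ?_, blockMap_triangle_inv k (τ k) z⟩
    have e := hs' k
    have := hz' (k + 2)
    cases τ k
    · refine ⟨?_, ?_, ?_, ?_⟩ <;> simp <;> linarith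
    · refine ⟨?_, ?_, ?_, ?_⟩ <;> simp <;> linarith

open PolyhedralSurface in
theorem block_eq_sub (o : Orientation) (v : Fin 3 → E3) (k : Fin 3) : ∃ τ : Bool, ∀ S,
    block o v k S = (trianglePatch v).sub S (refBlock k τ S).1 (refBlock k τ S).2.1
      (refBlock k τ S).2.2 := by
  have key : ∀ τ : Bool, o.1 s(v k, v (k + 1)) = v (if τ then k else k + 1) → ∀ S,
      block o v k S = (trianglePatch v).sub S (refBlock k τ S).1 (refBlock k τ S).2.1
        (refBlock k τ S).2.2 := by
    intro τ hτ S
    cases S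
    · simp only [block, Patch.sub, refBlock, Patch.lin_sub, trianglePatch_map_refVert]
    · simp only [block, Patch.sub, refBlock, Patch.lin_sub, Patch.map_add_lin,
        trianglePatch_map_refVert, hτ]
      cases τ <;> simp
  have ho := o.2 s(v k, v (k + 1))
  rw [Sym2.mem_iff] at ho
  rcases ho with ho | ho
  · exact ⟨true, key true ho⟩
  · exact ⟨false, key false ho⟩

end GradedRT
end

/-! ### The graded cells tile the surface. -/

noncomputable section

namespace GradedRT
open scoped ENNReal NNReal
open PolyhedralSurface

/-! ### The graded nodes -/

section Nodes

variable {β : ℝ} {N : ℕ}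

/-- The mesh sizes of the graded one-dimensional mesh. -/
def step (β : ℝ) (N i : ℕ) : ℝ := node β N (i + 1) - node β N i

theorem node_zero (hβ : 1 ≤ β) : node β N 0 = 0 := by
  rw [node, Nat.cast_zero, zero_div, Real.zero_rpow (by linarith)]

theorem node_self (hN : 1 ≤ N) : node β N N = 1 := by
  rw [node, div_self (by positivity), Real.one_rpow]

/-- Superadditivity of t ↦ t^β for β ≥ 1: no cell is thinner than the first one. -/
theorem le_step (hβ : 1 ≤ β) (i : ℕ) : (1 / (N : ℝ)) ^ β ≤ step β N i := by
  have h := Real.add_rpow_le_rpow_add (p := β) (a := (i : ℝ) / N) (b := 1 / N) (by positivity)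
    (by positivity) hβ
  rw [step, node, node]
  push_cast
  rw [add_div]
  linarith

theorem step_pos (hβ : 1 ≤ β) (hN : 1 ≤ N) (i : ℕ) : 0 < step β N i :=
  (Real.rpow_pos_of_pos (by positivity) β).trans_le (le_step hβ i)

theorem step_le (hβ : 1 ≤ β) (hN : 1 ≤ N) {i : ℕ} (hi : i < N) :
    step β N i ≤ β * (1 / (N : ℝ)) := by
  have hN' : (0 : ℝ) < N := by positivity
  set y : ℝ := ((i + 1 : ℕ) : ℝ) / N with hy
  set x : ℝ := (i : ℝ) / N with hx
  have y0 : 0 < y := by positivity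
  have x0 : 0 ≤ x := by positivity
  have y1 : y ≤ 1 := by
    rw [hy, div_le_one hN']; exact_mod_cast hi
  have hyx : y - x = 1 / N := by
    rw [hy, hx]; push_cast; ring
  -- Bernoulli's inequality for (x/y)^β, multiplied by y^β, gives y^β − x^β ≤ β(y − x)y^{β−1}.
  have h := one_add_mul_self_le_rpow_one_add (s := x / y - 1) (by
    have : 0 ≤ x / y := by positivity
    linarith) hβ
  rw [add_sub_cancel, Real.div_rpow x0 y0.le, le_div_iff₀ (Real.rpow_pos_of_pos y0 β)] at h
  have e : (1 + β * (x / y - 1)) * y ^ β = y ^ β - β * (1 / N) * (y ^ β / y) := by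
    rw [← hyx]; field_simp; ring
  have hle : y ^ β / y ≤ 1 := by
    rw [div_le_one y0]
    exact (Real.rpow_le_rpow_of_exponent_ge y0 y1 hβ).trans_eq (Real.rpow_one y)
  have hβN : 0 ≤ β * (1 / (N : ℝ)) := by positivity
  rw [step, node, node, ← hy, ← hx]
  rw [e] at h
  nlinarith

theorem node_strictMono (hβ : 1 ≤ β) (hN : 1 ≤ N) : StrictMono (node β N) :=
  strictMono_nat_of_lt_succ fun i => sub_pos.1 (step_pos hβ hN i)

theorem node_nonneg (β : ℝ) (N i : ℕ) : 0 ≤ node β N i := Real.rpow_nonneg (by positivity) _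

theorem node_le_one (hβ : 1 ≤ β) (hN : 1 ≤ N) {i : ℕ} (hi : i ≤ N) : node β N i ≤ 1 :=
  ((node_strictMono hβ hN).monotone hi).trans_eq (node_self hN)

theorem exists_node (hN : 1 ≤ N) {s : ℝ} (hβ : 1 ≤ β) (h0 : 0 < s) (h1 : s < 1)
    (hs : ∀ i, s ≠ node β N i) : ∃ i < N, s ∈ Ioo (node β N i) (node β N (i + 1)) := by
  classical
  have hex : ∃ m, s < node β N m := ⟨N, by rwa [node_self hN]⟩
  have hm0 : Nat.find hex ≠ 0 := fun h => by
    have := Nat.find_spec hex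
    rw [h, node_zero hβ] at this
    linarith
  obtain ⟨i, hi⟩ := Nat.exists_eq_succ_of_ne_zero hm0
  have hlt : ¬ s < node β N i := Nat.find_min hex (by omega)
  have hle : Nat.find hex ≤ N := Nat.find_min' hex (by rwa [node_self hN])
  refine ⟨i, by omega, lt_of_le_of_ne (not_lt.1 hlt) (hs i).symm, ?_⟩
  have := Nat.find_spec hex
  rwa [hi] at this

theorem node_interval_unique (hβ : 1 ≤ β) (hN : 1 ≤ N) {i j : ℕ} {s : ℝ}
    (hi : s ∈ Ioo (node β N i) (node β N (i + 1))) (hj : s ∈ Ioo (node β N j) (node β N (j + 1))) :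
    i = j := by
  have h1 := (node_strictMono hβ hN).lt_iff_lt.1 (hi.1.trans hj.2)
  have h2 := (node_strictMono hβ hN).lt_iff_lt.1 (hj.1.trans hi.2)
  omega

/-! ### Cells of a block -/

/-- The parameters of the points of a cell. -/
def cellSet (β : ℝ) (N : ℕ) (S : Shape) (i j : ℕ) : Set (ℝ × ℝ) :=
  {s | s.1 ∈ Ioo (node β N i) (node β N (i + 1)) ∧ s.2 ∈ Ioo (node β N j) (node β N (j + 1)) ∧
    (S = .triangle → s.2 < s.1)}

theorem cellSet_subset (hβ : 1 ≤ β) (hN : 1 ≤ N) {S : Shape} {i j : ℕ} (hi : i < N) (hj : j < N) :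
    cellSet β N S i j ⊆ S.dom := by
  rintro s ⟨h1, h2, h3⟩
  have a := node_nonneg β N i
  have b := node_nonneg β N j
  have c := node_le_one hβ hN hi
  have d := node_le_one hβ hN hj
  cases S
  · exact ⟨a.trans_lt h1.1, h1.2.trans_le c, b.trans_lt h2.1, h2.2.trans_le d⟩
  · exact ⟨a.trans_lt h1.1, h1.2.trans_le c, b.trans_lt h2.1, h3 rfl⟩

/-- The parametrisation of a cell by a reference element. -/
def cellMap (β : ℝ) (N i j : ℕ) : ℝ × ℝ → ℝ × ℝ :=
  planeMap (node β N i, node β N j) (step β N i, 0) (0, step β N j)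

theorem cellMap_apply (β : ℝ) (N i j : ℕ) (x : ℝ × ℝ) : cellMap β N i j x =
    (node β N i + step β N i * x.1, node β N j + step β N j * x.2) := by
  ext <;> simp [cellMap, planeMap] <;> ring

theorem cellPatch_eq_sub (β : ℝ) (N : ℕ) (B : Patch) (i j : ℕ) : cellPatch β N B i j =
    B.sub (cellPatch β N B i j).shape (node β N i, node β N j) (step β N i, 0) (0, step β N j) := by
  simp [cellPatch, Patch.sub, step]

theorem node_add_step_mul_mem (hβ : 1 ≤ β) (hN : 1 ≤ N) (i : ℕ) {t : ℝ} (h0 : 0 < t) (h1 : t < 1) :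
    node β N i + step β N i * t ∈ Ioo (node β N i) (node β N (i + 1)) := by
  have h := step_pos hβ hN i
  have e : node β N (i + 1) = node β N i + step β N i := by rw [step]; ring
  rw [e]
  constructor <;> nlinarith

/-- Because the nodes increase, a cell of a triangular block with j < i lies entirely below the
diagonal and is a full rectangle; only for i = j is it cut to a triangle. -/
theorem cellMap_image (hβ : 1 ≤ β) (hN : 1 ≤ N) (B : Patch) {i j : ℕ}
    (hij : B.shape = .triangle → j ≤ i) :
    cellMap β N i j '' (cellPatch β N B i j).shape.dom = cellSet β N B.shape i j := by
  have pi := step_pos hβ hN i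
  have pj := step_pos hβ hN j
  have hmono := (node_strictMono (β := β) hβ hN).monotone
  have hdom : ∀ x, x ∈ (cellPatch β N B i j).shape.dom ↔ x ∈ Shape.square.dom ∧
      (B.shape = .triangle → i = j → x.2 < x.1) := by
    intro x
    rcases hB : B.shape with _ | _
    · simp [cellPatch, hB]
    · by_cases h : i = j
      · simp only [cellPatch, hB, h, if_true, true_implies]
        exact ⟨fun hx => ⟨dom_subset_square _ hx, hx.2.2.2⟩,
          fun hx => ⟨hx.1.1, hx.1.2.1, hx.1.2.2.1, hx.2⟩⟩
      · simp [cellPatch, hB, h]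
  ext s
  constructor
  · rintro ⟨x, hx, rfl⟩
    obtain ⟨⟨a, b, c, d⟩, ht⟩ := (hdom x).1 hx
    rw [cellMap_apply]
    have h1 := node_add_step_mul_mem hβ hN i a b
    have h2 := node_add_step_mul_mem hβ hN j c d
    refine ⟨h1, h2, fun hB => ?_⟩
    rcases (hij hB).lt_or_eq with hlt | rfl
    · exact (h2.2.trans_le (hmono hlt)).trans h1.1
    · have := ht hB rfl
      simp only
      nlinarith
  · rintro ⟨h1, h2, h3⟩
    refine ⟨((s.1 - node β N i) / step β N i, (s.2 - node β N j) / step β N j), (hdom _).2 ⟨?_, ?_⟩, ?_⟩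
    · have e1 : s.1 - node β N i < step β N i := by rw [step]; linarith [h1.2]
      have e2 : s.2 - node β N j < step β N j := by rw [step]; linarith [h2.2]
      exact ⟨div_pos (sub_pos.2 h1.1) pi, (div_lt_one pi).2 e1, div_pos (sub_pos.2 h2.1) pj,
        (div_lt_one pj).2 e2⟩
    · rintro hB rfl
      have := h3 hB
      simp only
      gcongr
    · rw [cellMap_apply]
      ext
      · simp only; field_simp; ring
      · simp only; field_simp; ring

theorem isSub_cellPatch (hβ : 1 ≤ β) (hN : 1 ≤ N) {B : Patch} (hB : B.jac ≠ 0) {i j : ℕ}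
    (hi : i < N) (hj : j < N) (hij : B.shape = .triangle → j ≤ i) :
    IsSub (cellPatch β N B i j) B := by
  rw [cellPatch_eq_sub]
  refine isSub_sub hB ?_ ?_
  · simp [(step_pos hβ hN i).ne', (step_pos hβ hN j).ne']
  · exact mapsTo_iff_image_subset.2 ((cellMap_image hβ hN B hij).subset.trans (cellSet_subset hβ hN hi hj))

theorem cellPatch_jac (hβ : 1 ≤ β) (hN : 1 ≤ N) (B : Patch) (i j : ℕ) :
    (cellPatch β N B i j).jac = step β N i * step β N j * B.jac := by
  rw [cellPatch_eq_sub, Patch.sub_jac]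
  have := mul_pos (step_pos hβ hN i) (step_pos hβ hN j)
  simp [abs_mul, abs_of_pos (step_pos hβ hN i), abs_of_pos (step_pos hβ hN j)]

theorem cellPatch_carrier (hβ : 1 ≤ β) (hN : 1 ≤ N) (B : Patch) {i j : ℕ}
    (hij : B.shape = .triangle → j ≤ i) :
    (cellPatch β N B i j).carrier = B.map '' cellSet β N B.shape i j := by
  rw [← cellMap_image hβ hN B hij, image_image, Patch.carrier]
  refine image_congr fun x _ => ?_
  have := Patch.sub_map B (cellPatch β N B i j).shape (node β N i, node β N j) (step β N i, 0)
    (0, step β N j) x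
  rwa [← cellPatch_eq_sub] at this

end Nodes

/-! ### Elements -/

section Elements

variable {ι : Type*} {N : ℕ}

/-- The kind of block a cell belongs to. -/
def cellShape (c : Cell ι N) : Shape := Sum.elim (fun _ => .square) (fun _ => .triangle) c.2.2

/-- The first index of a cell. -/
def cellFst (c : Cell ι N) : ℕ := Sum.elim (fun d => d.1) (fun d => d.1.1) c.2.2

/-- The second index of a cell. -/
def cellSnd (c : Cell ι N) : ℕ := Sum.elim (fun d => d.2) (fun d => d.1.2) c.2.2

theorem cellFst_lt (c : Cell ι N) : cellFst c < N := by
  obtain ⟨F, k, d | d⟩ := c <;> exact Fin.is_lt _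

theorem cellSnd_lt (c : Cell ι N) : cellSnd c < N := by
  obtain ⟨F, k, d | d⟩ := c <;> exact Fin.is_lt _

theorem cellSnd_le (c : Cell ι N) (h : cellShape c = .triangle) : cellSnd c ≤ cellFst c := by
  obtain ⟨F, k, d | d⟩ := c
  · simp [cellShape] at h
  · exact d.2

theorem cell_ext {c d : Cell ι N} (h1 : c.1 = d.1) (h2 : c.2.1 = d.2.1)
    (h3 : cellShape c = cellShape d) (h4 : cellFst c = cellFst d) (h5 : cellSnd c = cellSnd d) :
    c = d := by
  obtain ⟨F, k, ⟨a, b⟩ | ⟨⟨a, b⟩, hab⟩⟩ := c <;> obtain ⟨F', k', ⟨a', b'⟩ | ⟨⟨a', b'⟩, hab'⟩⟩ := d <;>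
    simp_all [cellShape, cellFst, cellSnd, Fin.ext_iff]

theorem exists_cell (i : ι) (k : Fin 3) (S : Shape) {a b : ℕ} (ha : a < N) (hb : b < N)
    (hab : S = .triangle → b ≤ a) : ∃ c : Cell ι N, c.1 = i ∧ c.2.1 = k ∧ cellShape c = S ∧
      cellFst c = a ∧ cellSnd c = b := by
  cases S
  · exact ⟨(i, k, .inl (⟨a, ha⟩, ⟨b, hb⟩)), rfl, rfl, rfl, rfl, rfl⟩
  · exact ⟨(i, k, .inr ⟨(⟨a, ha⟩, ⟨b, hb⟩), hab rfl⟩), rfl, rfl, rfl, rfl, rfl⟩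

variable (Γ : PolyhedralSurface ι) {β : ℝ} (o : Orientation)

/-- The block of a cell. -/
def cellBlock (c : Cell ι N) : Patch := block o (Γ.vert c.1) c.2.1 (cellShape c)

theorem element_eq (c : Cell ι N) :
    Γ.element β N o c = cellPatch β N (cellBlock Γ o c) (cellFst c) (cellSnd c) := by
  obtain ⟨F, k, d | d⟩ := c <;> rfl

/-- Which endpoint of the edge comes first in the triangular block. -/
def blockFlag (i : ι) (k : Fin 3) : Bool := (block_eq_sub o (Γ.vert i) k).choose

theorem cellBlock_eq (c : Cell ι N) : cellBlock Γ o c = (Γ.face c.1).sub (cellShape c)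
    (refBlock c.2.1 (blockFlag Γ o c.1 c.2.1) (cellShape c)).1
    (refBlock c.2.1 (blockFlag Γ o c.1 c.2.1) (cellShape c)).2.1
    (refBlock c.2.1 (blockFlag Γ o c.1 c.2.1) (cellShape c)).2.2 :=
  (block_eq_sub o (Γ.vert c.1) c.2.1).choose_spec (cellShape c)

theorem cellBlock_shape (c : Cell ι N) : (cellBlock Γ o c).shape = cellShape c := by
  rw [cellBlock_eq]; rfl

theorem cellBlock_map (c : Cell ι N) (x : ℝ × ℝ) : (cellBlock Γ o c).map x =
    (Γ.face c.1).map (blockMap c.2.1 (blockFlag Γ o c.1 c.2.1) (cellShape c) x) := by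
  rw [cellBlock_eq, Patch.sub_map]; rfl

theorem cellBlock_jac (c : Cell ι N) : (cellBlock Γ o c).jac = 1 / 9 * (Γ.face c.1).jac := by
  rw [cellBlock_eq, Patch.sub_jac, refBlock_det]

theorem isSub_cellBlock (c : Cell ι N) : IsSub (cellBlock Γ o c) (Γ.face c.1) := by
  rw [cellBlock_eq]
  exact isSub_sub (Γ.face_jac_ne _) (refBlock_det_ne _ _ _) (blockMap_mapsTo _ _ _)

variable {Γ o}

theorem isSub_element (hβ : 1 ≤ β) (hN : 1 ≤ N) (c : Cell ι N) :
    IsSub (Γ.element β N o c) (Γ.face c.1) := by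
  rw [element_eq]
  refine (isSub_cellPatch hβ hN (isSub_cellBlock Γ o c).jac_ne (cellFst_lt c) (cellSnd_lt c) ?_).trans
    (isSub_cellBlock Γ o c)
  rw [cellBlock_shape]; exact cellSnd_le c

theorem mem_element_carrier (hβ : 1 ≤ β) (hN : 1 ≤ N) (c : Cell ι N) (y : E3) :
    y ∈ (Γ.element β N o c).carrier ↔ ∃ s ∈ cellSet β N (cellShape c) (cellFst c) (cellSnd c),
      (Γ.face c.1).map (blockMap c.2.1 (blockFlag Γ o c.1 c.2.1) (cellShape c) s) = y := by
  rw [element_eq, cellPatch_carrier hβ hN _ (by rw [cellBlock_shape]; exact cellSnd_le c),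
    cellBlock_shape]
  simp only [mem_image, cellBlock_map]

/-- A common point determines in turn its face, its block and its two grid intervals, hence the
cell. -/
theorem disjoint_element (hβ : 1 ≤ β) (hN : 1 ≤ N) {c d : Cell ι N} (h : c ≠ d) :
    Disjoint (Γ.element β N o c).carrier (Γ.element β N o d).carrier := by
  rw [Set.disjoint_left]
  intro y hc hd
  apply h
  have h1 : c.1 = d.1 := by
    by_contra hne
    exact (Γ.disjoint_carrier hne).le_bot ⟨(isSub_element hβ hN c).subset hc,
      (isSub_element hβ hN d).subset hd⟩
  obtain ⟨s, hs, rfl⟩ := (mem_element_carrier hβ hN c y).1 hc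
  obtain ⟨t, ht, hst⟩ := (mem_element_carrier hβ hN d _).1 hd
  rw [← h1] at hst
  have hst := Patch.map_injective (Γ.face_jac_ne c.1) hst
  obtain ⟨h2, h3⟩ := block_index_unique
    (cellSet_subset hβ hN (cellFst_lt d) (cellSnd_lt d) ht)
    (cellSet_subset hβ hN (cellFst_lt c) (cellSnd_lt c) hs) hst
  rw [h2, h3] at hst
  have hst : t = s := planeMap_injective _ _ _ (refBlock_det_ne _ _ _) hst
  subst hst
  exact cell_ext h1 h2.symm h3.symm (node_interval_unique hβ hN hs.1 ht.1)
    (node_interval_unique hβ hN hs.2.1 ht.2.1)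

theorem ae_bary_ne (m : Fin 3) (c : ℝ) : ∀ᵐ x : ℝ × ℝ, bary m x ≠ c := by
  have hmeas : ∀ f : ℝ × ℝ → ℝ, Continuous f → MeasurableSet {x | f x = c} := fun f hf =>
    (isClosed_eq hf continuous_const).measurableSet
  rw [ae_iff]
  simp only [ne_eq, not_not]
  rw [Measure.volume_eq_prod]
  fin_cases m
  · refine (Measure.measure_prod_null (hmeas _ (by simp [bary]; fun_prop))).2 ?_
    filter_upwards [compl_mem_ae_iff.2 (measure_singleton (μ := (volume : Measure ℝ)) (1 - c))] with x hx
    have : Prod.mk x ⁻¹' {x : ℝ × ℝ | bary 0 x = c} = ∅ := by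
      ext y
      simp only [bary, mem_preimage, mem_ofPred_eq, Matrix.cons_val_zero, mem_empty_iff_false, iff_false]
      intro h
      exact hx (by rw [mem_singleton_iff]; linarith)
    simp [this]
  · refine (Measure.measure_prod_null (hmeas _ (by simp [bary]; fun_prop))).2 ?_
    refine Filter.Eventually.of_forall fun x => Set.Subsingleton.measure_zero ?_ _
    intro y hy z hz
    simp only [bary, mem_preimage, mem_ofPred_eq, Fin.mk_one, Matrix.cons_val_one,
      Matrix.cons_val_zero] at hy hz
    linarith
  · refine (Measure.measure_prod_null (hmeas _ (by simp [bary]; fun_prop))).2 ?_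
    refine Filter.Eventually.of_forall fun x => Set.Subsingleton.measure_zero ?_ _
    intro y hy z hz
    simp only [bary, mem_preimage, mem_ofPred_eq, Fin.reduceFinMk, Matrix.cons_val] at hy hz
    linarith

/-- The elements cover the surface up to a null set. -/
theorem ae_exists_element [Fintype ι] (hβ : 1 ≤ β) (hN : 1 ≤ N) :
    ∀ᵐ y ∂Γ.surfMeasure, ∃ c, y ∈ (Γ.element β N o c).carrier := by
  rw [Γ.ae_surfMeasure_iff]
  intro i
  rw [faceMeasure, Patch.ae_surfMeasure_iff (Γ.face_jac_ne i)]
  -- The excluded lines are the parallels through the centroid and the grid lines: in barycentric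
  -- coordinates the latter sit at node/3, or at (2 − node)/3 for the first variable of a triangular
  -- block.
  have hae : ∀ᵐ x : ℝ × ℝ, ∀ m : Fin 3, bary m x ≠ 1 / 3 ∧ ∀ a : ℕ, bary m x ≠ node β N a / 3 ∧
      bary m x ≠ (2 - node β N a) / 3 := by
    rw [ae_all_iff]; intro m
    refine (ae_bary_ne m _).and ?_
    rw [ae_all_iff]; intro a
    exact (ae_bary_ne m _).and (ae_bary_ne m _)
  filter_upwards [ae_restrict_of_ae hae, ae_restrict_mem (measurableSet_dom _)] with z hz hzd
  obtain ⟨k, S, s, hs, hsz⟩ := exists_blockMap_eq (blockFlag Γ o i) hzd fun m => (hz m).1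
  have hs' := dom_subset_square S hs
  have hne : (∀ a, s.1 ≠ node β N a) ∧ ∀ a, s.2 ≠ node β N a := by
    cases S
    · obtain ⟨-, h1, h2⟩ := bary_blockMap_square k (blockFlag Γ o i k) s
      rw [hsz] at h1 h2
      exact ⟨fun a h => ((hz _).2 a).1 (h1.trans (by rw [h])),
        fun a h => ((hz _).2 a).1 (h2.trans (by rw [h]))⟩
    · obtain ⟨h1, -, h2⟩ := bary_blockMap_triangle k (blockFlag Γ o i k) s
      rw [hsz] at h1 h2
      exact ⟨fun a h => ((hz _).2 a).2 (h1.trans (by rw [h])),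
        fun a h => ((hz _).2 a).1 (h2.trans (by rw [h]))⟩
  obtain ⟨a, ha, ha'⟩ := exists_node hN hβ hs'.1 hs'.2.1 hne.1
  obtain ⟨b, hb, hb'⟩ := exists_node hN hβ hs'.2.2.1 hs'.2.2.2 hne.2
  have htri : S = .triangle → s.2 < s.1 := by
    rintro rfl; exact hs.2.2.2
  obtain ⟨c, rfl, rfl, rfl, rfl, rfl⟩ := exists_cell i k S ha hb fun h => by
    have := (node_strictMono hβ hN).lt_iff_lt.1 ((hb'.1.trans (htri h)).trans ha'.2)
    omega
  exact ⟨c, (mem_element_carrier hβ hN c _).2 ⟨s, ⟨ha', hb', htri⟩, by rw [hsz]⟩⟩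

end Elements

end GradedRT
end

/-! ### From the surface divergence to a constant divergence on each element. -/

noncomputable section

namespace GradedRT
open scoped ENNReal NNReal
open PolyhedralSurface Filter
open scoped Topology

/-! ### Test functions on the surface -/

variable {ι : Type*} [Fintype ι] {Γ : PolyhedralSurface ι}

theorem Patch.contDiff_coord (K : Patch) : ContDiff ℝ ∞ K.coord := by
  unfold Patch.coord
  exact (contDiff_const.inner ℝ (contDiff_id.sub contDiff_const)).prodMk
    (contDiff_const.inner ℝ (contDiff_id.sub contDiff_const))

theorem eventuallyEq_zero_of_notMem_tsupport {K : Patch} {φ : ℝ × ℝ → ℝ} {y : E3}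
    (hy : K.coord y ∉ tsupport φ) : ∀ᶠ z in 𝓝 y, φ (K.coord z) = 0 := by
  have h1 : φ =ᶠ[𝓝 (K.coord y)] 0 := notMem_tsupport_iff_eventuallyEq.1 hy
  exact K.contDiff_coord.continuous.continuousAt.eventually h1

/-- A test function on an element extends to a smooth function that vanishes near the rest of the
surface. -/
theorem exists_extension {i : ι} {K : Patch} (hK : IsSub K (Γ.face i)) {φ : ℝ × ℝ → ℝ}
    (hφ : ContDiff ℝ ∞ φ) (hc : HasCompactSupport φ) (hs : tsupport φ ⊆ K.shape.dom) :
    ∃ Φ : E3 → ℝ, ContDiff ℝ ∞ Φ ∧ (∀ y ∈ K.carrier, Φ =ᶠ[𝓝 y] fun z => φ (K.coord z)) ∧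
      ∀ j, ∀ y ∈ (Γ.face j).carrier, y ∉ K.carrier → Φ =ᶠ[𝓝 y] fun _ => 0 := by
  set Q : Set E3 := K.map '' tsupport φ with hQ
  set A : Set E3 := ⋃ j ∈ {j | i ≠ j}, convexHull ℝ (range (Γ.vert j)) with hA
  have hQc : IsClosed Q := (hc.isCompact.image (Patch.continuous_map K)).isClosed
  have hAc : IsClosed A := (toFinite _).isClosed_biUnion fun j _ =>
    ((finite_range _).isCompact_convexHull (𝕜 := ℝ)).isClosed
  have hQK : Q ⊆ K.carrier := image_mono hs
  have hd : Disjoint A Q := by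
    rw [hA, disjoint_iUnion₂_left]
    exact fun j hj => ((Γ.disjoint_carrier_hull hj).mono_left (hQK.trans hK.subset)).symm
  -- The function φ ∘ `coord` is constant in the direction normal to the patch and may be nonzero on
  -- other faces, so it is multiplied by a smooth χ that is 0 near the other closed faces and 1 near
  -- the image of the support.
  obtain ⟨χ, h0, h1, -⟩ := exists_contMDiffMap_zero_one_nhds_of_isClosed (n := ⊤)
    (modelWithCornersSelf ℝ E3) hAc hQc hd
  have hχ : ContDiff ℝ ∞ χ := contMDiff_iff_contDiff.1 χ.contMDiff
  rw [eventually_nhdsSet_iff_forall] at h0 h1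
  refine ⟨fun y => φ (K.coord y) * χ y, (hφ.comp K.contDiff_coord).mul hχ, ?_, ?_⟩
  · rintro _ ⟨x, hx, rfl⟩
    by_cases hxs : x ∈ tsupport φ
    · filter_upwards [h1 _ (mem_image_of_mem _ hxs)] with z hz
      rw [hz, mul_one]
    · have : K.coord (K.map x) ∉ tsupport φ := by rwa [Patch.coord_map _ hK.jac_ne]
      filter_upwards [eventuallyEq_zero_of_notMem_tsupport this] with z hz
      rw [hz, zero_mul]
  · intro j y hy hyK
    by_cases hij : i = j
    · subst hij
      -- Points of the same face lie in the plane of `K`, so they have parameters, but outside the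
      -- support of φ.
      obtain ⟨x, rfl⟩ : y ∈ range K.map := by
        rw [hK.range_eq]; obtain ⟨x, -, rfl⟩ := hy; exact mem_range_self x
      have : K.coord (K.map x) ∉ tsupport φ := by
        rw [Patch.coord_map _ hK.jac_ne]
        exact fun h => hyK (mem_image_of_mem _ (hs h))
      filter_upwards [eventuallyEq_zero_of_notMem_tsupport this] with z hz
      rw [hz, zero_mul]
    · have hyA : y ∈ A := mem_biUnion (show j ∈ {j | i ≠ j} from hij) (carrier_subset_convexHull _ hy)
      filter_upwards [h0 y hyA] with z hz
      rw [hz, mul_zero]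

theorem Patch.gradient_comp_coord {K : Patch} (h : K.jac ≠ 0) {φ : ℝ × ℝ → ℝ}
    (hφ : ContDiff ℝ ∞ φ) (x : ℝ × ℝ) : gradient (fun z => φ (K.coord z)) (K.map x) =
      fderiv ℝ φ x (1, 0) • K.dualA + fderiv ℝ φ x (0, 1) • K.dualB := by
  refine ext_inner_right ℝ fun v => ?_
  have h1 : HasFDerivAt K.coord ((innerSL ℝ K.dualA).prod (innerSL ℝ K.dualB)) (K.map x) :=
    ((innerSL ℝ K.dualA).hasFDerivAt.comp _ ((hasFDerivAt_id (𝕜 := ℝ) (K.map x)).sub_const K.p)).prodMk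
      ((innerSL ℝ K.dualB).hasFDerivAt.comp _ ((hasFDerivAt_id (𝕜 := ℝ) (K.map x)).sub_const K.p))
  have h2 : HasFDerivAt φ (fderiv ℝ φ x) (K.coord (K.map x)) := by
    rw [coord_map K h]; exact (hφ.differentiable (by simp) x).hasFDerivAt
  have h3 := (h2.comp (K.map x) h1).fderiv
  rw [inner_gradient_left, show (fun z => φ (K.coord z)) = φ ∘ K.coord from rfl, h3]
  have e : (inner ℝ K.dualA v, inner ℝ K.dualB v) =
      (inner ℝ K.dualA v : ℝ) • ((1, 0) : ℝ × ℝ) + (inner ℝ K.dualB v : ℝ) • ((0, 1) : ℝ × ℝ) := by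
    ext <;> simp
  have e' : (fderiv ℝ φ x ∘SL (innerSL ℝ K.dualA).prod (innerSL ℝ K.dualB)) v =
      fderiv ℝ φ x (inner ℝ K.dualA v, inner ℝ K.dualB v) := rfl
  rw [e', e, map_add, map_smul, map_smul, inner_add_left, inner_smul_left, inner_smul_left]
  simp [mul_comm]

variable {𝕜 : Type*} [RCLike 𝕜]

theorem integral_eq_of_support {i : ι} {K : Patch} (hK : IsSub K (Γ.face i)) {g : E3 → 𝕜}
    (hg : ∀ j, ∀ y ∈ (Γ.face j).carrier, y ∉ K.carrier → g y = 0) :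
    ∫ y, g y ∂Γ.surfMeasure = K.jac • ∫ x in K.shape.dom, g (K.map x) := by
  rw [← Patch.integral_surfMeasure hK.jac_ne, ← Γ.surfMeasure_restrict hK]
  refine (setIntegral_eq_integral_of_ae_compl_eq_zero ?_).symm
  rw [Γ.ae_surfMeasure_iff]
  intro j
  exact (Patch.ae_mem_carrier (Γ.face_jac_ne j)).mono fun y hy => hg j y hy

theorem Patch.bdot_gradient {K : Patch} (h : K.jac ≠ 0) (φ : ℝ × ℝ → ℝ) (u : E3 → V 𝕜) (x : ℝ × ℝ) :
    bdot (u (K.map x)) (fderiv ℝ φ x (1, 0) • K.dualA + fderiv ℝ φ x (0, 1) • K.dualB) =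
      K.jac⁻¹ • greenDensity φ (K.pull u) 0 x := by
  simp only [bdot_add_right, bdot_smul_right, greenDensity, pull, smul_zero, add_zero, smul_add,
    smul_smul]
  congr 2 <;> field_simp

/-- The Jacobian of the surface measure cancels the one in the Piola transform: the surface pairing
is the weak divergence on the reference element without any factor, whereas the density of the
divergence is multiplied by `jac`. -/
theorem exists_divPairing_eq {i : ι} {K : Patch} (hK : IsSub K (Γ.face i)) {φ : ℝ × ℝ → ℝ}
    (hφ : ContDiff ℝ ∞ φ) (hc : HasCompactSupport φ) (hs : tsupport φ ⊆ K.shape.dom) :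
    ∃ Φ : E3 → ℝ, ContDiff ℝ ∞ Φ ∧
      (∀ u : E3 → V 𝕜, Γ.divPairing u Φ = -∫ x in K.shape.dom, greenDensity φ (K.pull u) 0 x) ∧
      ∀ f : E3 → 𝕜, ∫ y, Φ y • f y ∂Γ.surfMeasure =
        ∫ x in K.shape.dom, φ x • (K.jac • f (K.map x)) := by
  obtain ⟨Φ, hΦ, h1, h2⟩ := exists_extension hK hφ hc hs
  refine ⟨Φ, hΦ, fun u => ?_, fun f => ?_⟩
  · rw [divPairing, integral_eq_of_support hK (g := fun y => bdot (u y) (gradient Φ y))]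
    · congr 1
      rw [← integral_smul]
      refine setIntegral_congr_fun (measurableSet_dom _) fun x hx => ?_
      rw [(h1 _ (mem_image_of_mem _ hx)).gradient_eq, Patch.gradient_comp_coord hK.jac_ne hφ,
        Patch.bdot_gradient hK.jac_ne, smul_smul, mul_inv_cancel₀ hK.jac_ne, one_smul]
    · intro j y hy hyK
      rw [(h2 j y hy hyK).gradient_eq, gradient_fun_const]
      simp [bdot]
  · rw [integral_eq_of_support hK (g := fun y => Φ y • f y)]
    · rw [← integral_smul]
      refine setIntegral_congr_fun (measurableSet_dom _) fun x hx => ?_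
      rw [(h1 _ (mem_image_of_mem _ hx)).eq_of_nhds, Patch.coord_map _ hK.jac_ne, smul_comm]
    · intro j y hy hyK
      rw [(h2 j y hy hyK).eq_of_nhds, zero_smul]

/-! ### The divergence of the fields of the boundary element space -/

/-- One writes x₁∂₁φ = ∂₁(x₁φ) − φ, and likewise for x₂; derivatives of compactly supported
functions integrate to zero, and what is left is −(γ + δ)∫φ. -/
theorem exists_div_of_isRefRT0 {S : Shape} {r : ℝ × ℝ → 𝕜 × 𝕜} (hr : IsRefRT0 S r) :
    ∃ δ : 𝕜, ∀ φ : ℝ × ℝ → ℝ, ContDiff ℝ ∞ φ → HasCompactSupport φ → tsupport φ ⊆ S.dom →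
      ∫ x in S.dom, greenDensity φ r 0 x = -∫ x in S.dom, φ x • δ := by
  have hr' : ∃ α β γ δ : 𝕜, ∀ x, r x = (α + γ * (x.1 : 𝕜), β + δ * (x.2 : 𝕜)) := by
    cases S
    · exact hr
    · obtain ⟨α, β, γ, h⟩ := hr; exact ⟨α, β, γ, γ, h⟩
  obtain ⟨α, β, γ, δ, hr⟩ := hr'
  refine ⟨γ + δ, fun φ hφ hc hs => ?_⟩
  have hd := fun x => hφ.differentiable (by simp) x
  set ψ₁ : ℝ × ℝ → ℝ := fun x => x.1 * φ x with hψ₁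
  set ψ₂ : ℝ × ℝ → ℝ := fun x => x.2 * φ x with hψ₂
  have s₁ : ContDiff ℝ ∞ ψ₁ := contDiff_fst.mul hφ
  have s₂ : ContDiff ℝ ∞ ψ₂ := contDiff_snd.mul hφ
  have c₁ : HasCompactSupport ψ₁ := hc.mul_left
  have c₂ : HasCompactSupport ψ₂ := hc.mul_left
  have t₁ : tsupport ψ₁ ⊆ S.dom := (tsupport_mul_subset_right).trans hs
  have t₂ : tsupport ψ₂ ⊆ S.dom := (tsupport_mul_subset_right).trans hs
  have d₁ : ∀ x, fderiv ℝ ψ₁ x (1, 0) = φ x + x.1 * fderiv ℝ φ x (1, 0) := fun x => by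
    rw [hψ₁, fderiv_fun_mul differentiableAt_fst (hd x)]
    simp [fderiv_fst]; ring
  have d₂ : ∀ x, fderiv ℝ ψ₂ x (0, 1) = φ x + x.2 * fderiv ℝ φ x (0, 1) := fun x => by
    rw [hψ₂, fderiv_fun_mul differentiableAt_snd (hd x)]
    simp [fderiv_snd]; ring
  have hi : ∀ ψ : ℝ × ℝ → ℝ, ContDiff ℝ ∞ ψ → HasCompactSupport ψ → ∀ v,
      IntegrableOn (fun x => fderiv ℝ ψ x v) S.dom := fun ψ hψ hcψ v =>
    (((hψ.continuous_fderiv (by simp)).clm_apply continuous_const).integrable_of_hasCompactSupport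
      (hcψ.fderiv_apply (𝕜 := ℝ) v)).integrableOn
  have hiφ : IntegrableOn φ S.dom := (hφ.continuous.integrable_of_hasCompactSupport hc).integrableOn
  have e : ∀ x, greenDensity φ r 0 x = (((fderiv ℝ φ x (1, 0) • α + fderiv ℝ φ x (0, 1) • β) +
      fderiv ℝ ψ₁ x (1, 0) • γ) + fderiv ℝ ψ₂ x (0, 1) • δ) - φ x • (γ + δ) := fun x => by
    rw [greenDensity, hr, d₁, d₂]
    simp only [RCLike.real_smul_eq_coe_mul]
    push_cast
    ring
  simp only [e]
  have i₁ := (hi φ hφ hc (1, 0)).smul_const α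
  have i₂ := (hi φ hφ hc (0, 1)).smul_const β
  have i₃ := (hi ψ₁ s₁ c₁ (1, 0)).smul_const γ
  have i₄ := (hi ψ₂ s₂ c₂ (0, 1)).smul_const δ
  have i₅ := hiφ.smul_const (γ + δ)
  have i₁₂ : IntegrableOn (fun x => fderiv ℝ φ x (1, 0) • α + fderiv ℝ φ x (0, 1) • β) S.dom :=
    i₁.add i₂
  have i₁₃ : IntegrableOn (fun x => fderiv ℝ φ x (1, 0) • α + fderiv ℝ φ x (0, 1) • β +
    fderiv ℝ ψ₁ x (1, 0) • γ) S.dom := i₁₂.add i₃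
  have i₁₄ : IntegrableOn (fun x => fderiv ℝ φ x (1, 0) • α + fderiv ℝ φ x (0, 1) • β +
    fderiv ℝ ψ₁ x (1, 0) • γ + fderiv ℝ ψ₂ x (0, 1) • δ) S.dom := i₁₃.add i₄
  rw [integral_sub i₁₄ i₅, integral_add i₁₃ i₄, integral_add i₁₂ i₃, integral_add i₁ i₂, integral_smul_const, integral_smul_const,
    integral_smul_const, integral_smul_const, setIntegral_fderiv_eq_zero hφ hc hs,
    setIntegral_fderiv_eq_zero hφ hc hs, setIntegral_fderiv_eq_zero s₁ c₁ t₁,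
    setIntegral_fderiv_eq_zero s₂ c₂ t₂]
  simp

theorem surfDiv_spec {u : E3 → V 𝕜} (h : ∃ f : E3 → 𝕜, MemLp f 2 Γ.surfMeasure ∧ Γ.HasDiv u f) :
    MemLp (Γ.surfDiv u) 2 Γ.surfMeasure ∧ Γ.HasDiv u (Γ.surfDiv u) := by
  rw [surfDiv, dif_pos h]
  exact h.choose_spec

theorem Patch.memLp_comp_map {i : ι} {K : Patch} (hK : IsSub K (Γ.face i)) {f : E3 → 𝕜}
    (hf : MemLp f 2 Γ.surfMeasure) : MemLp (fun x => f (K.map x)) 2 (volume.restrict K.shape.dom) := by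
  have h1 : MemLp f 2 K.surfMeasure := Γ.surfMeasure_restrict hK ▸ hf.restrict K.carrier
  have hj : ENNReal.ofReal K.jac ≠ 0 := by simpa using jac_pos hK.jac_ne
  have h2 : MemLp f 2 ((volume.restrict K.shape.dom).map K.map) :=
    h1.of_measure_le_smul (c := (ENNReal.ofReal K.jac)⁻¹) (ENNReal.inv_ne_top.2 hj) (by
      rw [surfMeasure, smul_smul, ENNReal.inv_mul_cancel hj ENNReal.ofReal_ne_top, one_smul])
  exact (measurableEmbedding_map hK.jac_ne).memLp_map_measure_iff.1 h2

/-- The discrete-divergence hypothesis is turned into local information here. On the element, u has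
the same weak divergence as a Raviart–Thomas field, which is constant; the chosen L² representative
of the surface divergence then equals this constant almost everywhere, by the fundamental lemma of
the calculus of variations. -/
theorem exists_elementwise_div {β : ℝ} (hβ : 1 ≤ β) {N : ℕ} (hN : 1 ≤ N) {o : Orientation}
    {u : E3 → V 𝕜} (hu : Γ.HasDiscreteDiv β N o u) (c : Cell ι N) :
    ∃ δ : 𝕜, (∀ φ : ℝ × ℝ → ℝ, ContDiff ℝ ∞ φ → HasCompactSupport φ →
        tsupport φ ⊆ (Γ.element β N o c).shape.dom →
        ∫ x in (Γ.element β N o c).shape.dom, greenDensity φ ((Γ.element β N o c).pull u) 0 x =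
          -∫ x in (Γ.element β N o c).shape.dom, φ x • δ) ∧
      ∀ᵐ x ∂volume.restrict (Γ.element β N o c).shape.dom,
        (Γ.element β N o c).jac • Γ.surfDiv u ((Γ.element β N o c).map x) = δ := by
  have hK := isSub_element (Γ := Γ) (o := o) hβ hN c
  set K := Γ.element β N o c with hKd
  obtain ⟨w, ⟨hwr, f, hf, hwf⟩, huw⟩ := hu
  obtain ⟨r, hr, hwr⟩ := hwr c
  obtain ⟨hg, hug⟩ := surfDiv_spec (Γ := Γ) (u := u) ⟨f, hf, fun φ hφ => (huw φ hφ).trans (hwf φ hφ)⟩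
  obtain ⟨δ, hδ⟩ := exists_div_of_isRefRT0 hr
  have key : ∀ φ : ℝ × ℝ → ℝ, ContDiff ℝ ∞ φ → HasCompactSupport φ → tsupport φ ⊆ K.shape.dom →
      ∫ x in K.shape.dom, greenDensity φ (K.pull u) 0 x = -∫ x in K.shape.dom, φ x • δ ∧
      ∫ x in K.shape.dom, φ x • (K.jac • Γ.surfDiv u (K.map x)) = ∫ x in K.shape.dom, φ x • δ := by
    intro φ hφ hc hs
    obtain ⟨Φ, hΦ, hΦ1, hΦ2⟩ := exists_divPairing_eq (𝕜 := 𝕜) hK hφ hc hs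
    have h1 : ∫ x in K.shape.dom, greenDensity φ (K.pull w) 0 x =
        ∫ x in K.shape.dom, greenDensity φ r 0 x := by
      refine setIntegral_congr_fun (measurableSet_dom _) fun x hx => ?_
      have : K.pull w x = r x := by
        rw [← Patch.pull_push hK.jac_ne r x, Patch.pull, Patch.pull,
          hwr _ (mem_image_of_mem _ hx)]
      simp only [greenDensity, this]
    have h2 : ∫ x in K.shape.dom, greenDensity φ (K.pull u) 0 x = -∫ x in K.shape.dom, φ x • δ := by
      rw [← hδ φ hφ hc hs, ← h1]
      have := huw Φ hΦ
      rwa [hΦ1, hΦ1, neg_inj] at this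
    refine ⟨h2, ?_⟩
    have := hug Φ hΦ
    rw [hΦ1, hΦ2, h2, neg_neg] at this
    exact this.symm
  refine ⟨δ, fun φ hφ hc hs => (key φ hφ hc hs).1, ?_⟩
  have hfin : volume K.shape.dom ≠ ⊤ := ((volume_dom_le _).trans_lt (by simp)).ne
  have : IsFiniteMeasure (volume.restrict K.shape.dom) := ⟨by
    rw [Measure.restrict_apply_univ]; exact hfin.lt_top⟩
  have hint : IntegrableOn (fun x => K.jac • Γ.surfDiv u (K.map x) - δ) K.shape.dom :=
    (((Patch.memLp_comp_map hK hg).integrable (by norm_num)).smul K.jac).sub (integrable_const δ)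
  have hae := (isOpen_dom K.shape).ae_eq_zero_of_integral_contDiff_smul_eq_zero
    (μ := volume.restrict K.shape.dom) (f := fun x => K.jac • Γ.surfDiv u (K.map x) - δ)
    (Integrable.locallyIntegrable hint |>.locallyIntegrableOn _) fun φ hφ hc hs => by
      obtain ⟨B, hB⟩ := hφ.continuous.bounded_above_of_compact_support hc
      have j1 : IntegrableOn (fun x => φ x • (K.jac • Γ.surfDiv u (K.map x))) K.shape.dom :=
        ((((Patch.memLp_comp_map hK hg).integrable (by norm_num)).smul K.jac).bdd_smul B
          hφ.continuous.aestronglyMeasurable (Eventually.of_forall hB))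
      have j2 : IntegrableOn (fun x => φ x • δ) K.shape.dom :=
        ((hφ.continuous.integrable_of_hasCompactSupport hc).integrableOn).smul_const δ
      simp only [smul_sub]
      rw [integral_sub j1 j2, (key φ hφ hc hs).2, sub_self]
  filter_upwards [hae, ae_restrict_mem (measurableSet_dom _)] with x hx hxd
  exact sub_eq_zero.1 (hx hxd)

end GradedRT
end

/-! ### Transfer of the error estimate to patches in space. -/

noncomputable section

namespace GradedRT
open scoped ENNReal NNReal
open PolyhedralSurface

variable {𝕜 : Type*} [RCLike 𝕜]

/-! ### The interpolation error on a patch -/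

theorem div_pow_three_le {A ρ σ m : ℝ≥0∞} (m0 : m ≠ 0) (mt : m ≠ ⊤) (h : σ ≤ m * ρ) :
    A / ρ ^ 3 ≤ m ^ 3 * (A / σ ^ 3) := by
  calc A / ρ ^ 3 = m ^ 3 * (A / (m * ρ) ^ 3) := by
        rw [mul_pow, ← mul_div_assoc, ENNReal.mul_div_mul_left _ _ (pow_ne_zero 3 m0)
          (ENNReal.pow_ne_top mt)]
    _ ≤ _ := by gcongr

/-- Since a and b are orthogonal to the unit vector ν, their vector product is a multiple of ν, and
w × ν is orthogonal to ν. Rotated traces are therefore tangential to the patch. -/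
theorem bdot_cross_normal {ν a b : E3} (hν : ‖ν‖ = 1) (ha : inner ℝ ν a = (0 : ℝ))
    (hb : inner ℝ ν b = (0 : ℝ)) (w : V 𝕜) : bdot (cross w (toV 𝕜 ν)) (cross a b) = 0 := by
  have h1 : ν 0 ^ 2 + ν 1 ^ 2 + ν 2 ^ 2 = 1 := by
    have := EuclideanSpace.norm_sq_eq ν
    rw [hν, Fin.sum_univ_three] at this
    simpa using this.symm
  have ha' : ν 0 * a 0 + ν 1 * a 1 + ν 2 * a 2 = 0 := by
    rw [← ha, PiLp.inner_apply, Fin.sum_univ_three]; simp [mul_comm]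
  have hb' : ν 0 * b 0 + ν 1 * b 1 + ν 2 * b 2 = 0 := by
    rw [← hb, PiLp.inner_apply, Fin.sum_univ_three]; simp [mul_comm]
  have e : cross a b = (ν 0 * cross a b 0 + ν 1 * cross a b 1 + ν 2 * cross a b 2) • ν := by
    ext k
    fin_cases k
    · simp only [Fin.zero_eta, PiLp.smul_apply, smul_eq_mul, cross_apply_zero, cross_apply_one,
        cross_apply_two]
      linear_combination (-(a 1 * b 2 - a 2 * b 1)) * h1 - (ν 1 * a 2 - ν 2 * a 1) * hb' +
        (ν 1 * b 2 - ν 2 * b 1) * ha'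
    · simp only [Fin.mk_one, PiLp.smul_apply, smul_eq_mul, cross_apply_zero, cross_apply_one,
        cross_apply_two]
      linear_combination (-(a 2 * b 0 - a 0 * b 2)) * h1 - (ν 2 * a 0 - ν 0 * a 2) * hb' +
        (ν 2 * b 0 - ν 0 * b 2) * ha'
    · simp only [Fin.reduceFinMk, PiLp.smul_apply, smul_eq_mul, cross_apply_zero, cross_apply_one,
        cross_apply_two]
      linear_combination (-(a 0 * b 1 - a 1 * b 0)) * h1 - (ν 0 * a 1 - ν 1 * a 0) * hb' +
        (ν 0 * b 1 - ν 1 * b 0) * ha'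
  rw [e, bdot_smul_right, bdot_cross_self, smul_zero]

theorem refInterp_congr_ae {S : Shape} {u u' : ℝ × ℝ → 𝕜 × 𝕜} {f f' : ℝ × ℝ → 𝕜}
    (hu : ∀ᵐ x ∂volume.restrict S.dom, u x = u' x) (hf : ∀ᵐ x ∂volume.restrict S.dom, f x = f' x) :
    refInterp S u f = refInterp S u' f' := by
  have h : ∀ {n : ℕ} (d : Fin n → ℝ × ℝ → ℝ) e, edgeFlux S.dom d e u f = edgeFlux S.dom d e u' f' := by
    intro n d e
    refine integral_congr_ae ?_
    filter_upwards [hu, hf] with x h1 h2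
    rw [h1, h2]
  cases S
  · simp only [refInterp, h squareEdge]
  · simp only [refInterp, h triangleEdge]

/-- The double integral of the parametrised Gagliardo seminorm. -/
def patchSeminorm (K : Patch) (v : E3 → V 𝕜) : ℝ≥0∞ :=
  ∫⁻ x in K.shape.dom, ∫⁻ y in K.shape.dom,
    ‖v (K.map x) - v (K.map y)‖ₑ ^ 2 / edist (K.map x) (K.map y) ^ 3

/-- A patch of anisotropic size `h₁ × h₂`. -/
structure PatchSize (K : Patch) (R h₁ h₂ : ℝ) : Prop where
  jac_ne : K.jac ≠ 0
  pos_R : 0 < R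
  pos₁ : 0 < h₁
  pos₂ : 0 < h₂
  le₁ : ‖K.a‖ ≤ h₁ * R
  le₂ : ‖K.b‖ ≤ h₂ * R
  eq_of_triangle : K.shape = .triangle → h₁ = h₂

namespace PatchSize

variable {K : Patch} {R h₁ h₂ : ℝ} (h : PatchSize K R h₁ h₂)
include h

/-- The dual vectors satisfy jac · ‖a*‖ ≤ 6‖b‖ and jac · ‖b*‖ ≤ 6‖a‖, so dividing the two components
by h₂ and h₁ leaves a bound without the aspect ratio; 18 is this 6 times the 3 of `norm_bdot_le`. -/
theorem norm_sub_le (u : E3 → V 𝕜) (x y : ℝ × ℝ) :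
    ‖aniso h₁⁻¹ h₂⁻¹ (K.pull u x) - aniso h₁⁻¹ h₂⁻¹ (K.pull u y)‖ ≤
      18 * R * ‖u (K.map x) - u (K.map y)‖ := by
  have p₁ := h.pos₁
  have p₂ := h.pos₂
  have hR := h.pos_R
  obtain ⟨dA, dB⟩ := Patch.norm_jac_dual_le h.jac_ne
  set w := u (K.map x) - u (K.map y) with hw
  have e : aniso h₁⁻¹ h₂⁻¹ (K.pull u x) - aniso h₁⁻¹ h₂⁻¹ (K.pull u y) =
      (h₂⁻¹ • (K.jac • bdot w K.dualA), h₁⁻¹ • (K.jac • bdot w K.dualB)) := by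
    rw [← aniso_sub]
    simp only [aniso, Patch.pull, Prod.fst_sub, Prod.snd_sub, ← smul_sub, ← bdot_sub, hw]
  have key : ∀ {t : ℝ} {d : E3}, 0 < t → K.jac * ‖d‖ ≤ 6 * (t * R) →
      ‖t⁻¹ • (K.jac • bdot w d)‖ ≤ 18 * R * ‖w‖ := by
    intro t d ht hd
    rw [norm_smul, norm_smul, Real.norm_of_nonneg (inv_pos.2 ht).le,
      Real.norm_of_nonneg (Patch.jac_nonneg K), inv_mul_le_iff₀ ht]
    have h1 := mul_le_mul_of_nonneg_left (norm_bdot_le w d) (Patch.jac_nonneg K)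
    have h2 := mul_le_mul_of_nonneg_right hd (norm_nonneg w)
    nlinarith
  rw [e]
  exact max_le (key p₂ (dA.trans (by linarith [h.le₂]))) (key p₁ (dB.trans (by linarith [h.le₁])))

theorem edist_map_le (x y : ℝ × ℝ) : edist (K.map x) (K.map y) ≤
    ENNReal.ofReal (2 * R) * edist (scl h₁ h₂ x) (scl h₁ h₂ y) := by
  have p₁ := h.pos₁
  have p₂ := h.pos₂
  have hR := h.pos_R
  rw [edist_dist, edist_dist, ← ENNReal.ofReal_mul (by positivity)]
  refine ENNReal.ofReal_le_ofReal ?_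
  have e : K.map x - K.map y = (x.1 - y.1) • K.a + (x.2 - y.2) • K.b := by
    simp only [Patch.map]; module
  have e1 : h₁ * |x.1 - y.1| ≤ dist (scl h₁ h₂ x) (scl h₁ h₂ y) := by
    refine le_trans (le_of_eq ?_) (le_max_left _ _)
    simp [scl, Real.dist_eq, ← mul_sub, abs_mul, abs_of_pos p₁]
  have e2 : h₂ * |x.2 - y.2| ≤ dist (scl h₁ h₂ x) (scl h₁ h₂ y) := by
    refine le_trans (le_of_eq ?_) (le_max_right _ _)
    simp [scl, Real.dist_eq, ← mul_sub, abs_mul, abs_of_pos p₂]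
  rw [dist_eq_norm, e]
  refine (norm_add_le _ _).trans ?_
  rw [norm_smul, norm_smul, Real.norm_eq_abs, Real.norm_eq_abs]
  have f1 := mul_le_mul_of_nonneg_left h.le₁ (abs_nonneg (x.1 - y.1))
  have f2 := mul_le_mul_of_nonneg_left h.le₂ (abs_nonneg (x.2 - y.2))
  nlinarith

/-- Scaled parameter distances are at least physical distances divided by 2R, and 108 is 18 times
the 6 of `norm_cross_le`. -/
theorem gagliardo_le {ν : E3} (hν : ‖ν‖ = 1) (v : E3 → V 𝕜) :
    gagliardo K.shape.dom (scl h₁ h₂)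
      (fun x => aniso h₁⁻¹ h₂⁻¹ (K.pull (fun y => cross (v y) (toV 𝕜 ν)) x)) ≤
      ENNReal.ofReal (108 * R) ^ 2 * ENNReal.ofReal (2 * R) ^ 3 * patchSeminorm K v := by
  have hR := h.pos_R
  have m0 : ENNReal.ofReal (2 * R) ≠ 0 := by simpa using hR
  have ht : ENNReal.ofReal (108 * R) ^ 2 * ENNReal.ofReal (2 * R) ^ 3 ≠ ⊤ :=
    ENNReal.mul_ne_top (ENNReal.pow_ne_top ENNReal.ofReal_ne_top)
      (ENNReal.pow_ne_top ENNReal.ofReal_ne_top)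
  rw [gagliardo, patchSeminorm, ← lintegral_const_mul' _ _ ht]
  refine lintegral_mono fun x => ?_
  rw [← lintegral_const_mul' _ _ ht]
  refine lintegral_mono fun y => ?_
  refine (div_pow_three_le m0 ENNReal.ofReal_ne_top (h.edist_map_le x y)).trans ?_
  have hn : ‖aniso h₁⁻¹ h₂⁻¹ (K.pull (fun y => cross (v y) (toV 𝕜 ν)) x) -
      aniso h₁⁻¹ h₂⁻¹ (K.pull (fun y => cross (v y) (toV 𝕜 ν)) y)‖ₑ ≤
      ENNReal.ofReal (108 * R) * ‖v (K.map x) - v (K.map y)‖ₑ := by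
    rw [← ofReal_norm, ← ofReal_norm (v _ - v _), ← ENNReal.ofReal_mul (by positivity)]
    refine ENNReal.ofReal_le_ofReal ((h.norm_sub_le _ x y).trans ?_)
    rw [← cross_sub_left]
    have := norm_cross_le (v (K.map x) - v (K.map y)) (toV 𝕜 ν)
    rw [norm_toV, hν, mul_one] at this
    have := mul_le_mul_of_nonneg_left this (by positivity : (0 : ℝ) ≤ 18 * R)
    linarith
  calc _ ≤ ENNReal.ofReal (2 * R) ^ 3 * ((ENNReal.ofReal (108 * R) *
        ‖v (K.map x) - v (K.map y)‖ₑ) ^ 2 / edist (K.map x) (K.map y) ^ 3) := by gcongr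
    _ = _ := by rw [mul_pow, mul_div_assoc]; ring

/-- Each component picks up one of the lengths from `aniso` and the other from its edge vector. The
resulting factor h₁h₂/jac is bounded on the elements, whose area is comparable to h₁h₂. -/
theorem enorm_push_le (w E : ℝ × ℝ → 𝕜 × 𝕜) (x : ℝ × ℝ) (hw : w x = aniso h₁ h₂ (E x)) :
    ‖K.push w (K.map x)‖ₑ ≤ ENNReal.ofReal (2 * R * (h₁ * h₂) / K.jac) * ‖E x‖ₑ := by
  have p₁ := h.pos₁
  have p₂ := h.pos₂
  have hR := h.pos_R
  have hJ := Patch.jac_pos h.jac_ne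
  rw [← ofReal_norm, ← ofReal_norm (E x), ← ENNReal.ofReal_mul (by positivity)]
  refine ENNReal.ofReal_le_ofReal ((Patch.norm_push_map_le h.jac_ne w x).trans ?_)
  rw [hw, div_mul_eq_mul_div, inv_mul_eq_div]
  refine div_le_div_of_nonneg_right ?_ hJ.le
  simp only [aniso, norm_smul, Real.norm_of_nonneg p₁.le, Real.norm_of_nonneg p₂.le]
  have f1 : h₂ * ‖(E x).1‖ * ‖K.a‖ ≤ h₂ * ‖E x‖ * (h₁ * R) :=
    mul_le_mul (mul_le_mul_of_nonneg_left (norm_fst_le _) p₂.le) h.le₁ (norm_nonneg _) (by positivity)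
  have f2 : h₁ * ‖(E x).2‖ * ‖K.b‖ ≤ h₁ * ‖E x‖ * (h₂ * R) :=
    mul_le_mul (mul_le_mul_of_nonneg_left (norm_snd_le _) p₁.le) h.le₂ (norm_nonneg _) (by positivity)
  nlinarith

theorem lintegral_error_le {C : ℝ≥0} (hC : InterpBound 𝕜 K.shape C) {ν : E3} (hν : ‖ν‖ = 1)
    {v : E3 → V 𝕜} (hv : StronglyMeasurable v)
    (ht : ∀ y, bdot (cross (v y) (toV 𝕜 ν)) K.nrm = 0) (hfin : patchSeminorm K v < ⊤) {δ : 𝕜}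
    (hδ : ∀ φ : ℝ × ℝ → ℝ, ContDiff ℝ ∞ φ → HasCompactSupport φ → tsupport φ ⊆ K.shape.dom →
      ∫ x in K.shape.dom, greenDensity φ (K.pull fun y => cross (v y) (toV 𝕜 ν)) 0 x =
        -∫ x in K.shape.dom, φ x • δ) :
    ∫⁻ x in K.shape.dom, ‖cross (v (K.map x)) (toV 𝕜 ν) -
      K.push (refInterp K.shape (K.pull fun y => cross (v y) (toV 𝕜 ν)) fun _ => δ) (K.map x)‖ₑ ^ 2 ≤
      ENNReal.ofReal (2 * R * (h₁ * h₂) / K.jac) ^ 2 * (C * (ENNReal.ofReal (max h₁ h₂) ^ 3 *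
        (ENNReal.ofReal (108 * R) ^ 2 * ENNReal.ofReal (2 * R) ^ 3 * patchSeminorm K v))) := by
  have p₁ := h.pos₁
  have p₂ := h.pos₂
  set u : E3 → V 𝕜 := fun y => cross (v y) (toV 𝕜 ν) with hu
  set U : ℝ × ℝ → 𝕜 × 𝕜 := fun x => aniso h₁⁻¹ h₂⁻¹ (K.pull u x) with hUd
  have hum : StronglyMeasurable u := (continuous_cross _).comp_stronglyMeasurable hv
  have hpm : StronglyMeasurable (K.pull u) := by
    have hm : StronglyMeasurable fun x => u (K.map x) :=
      hum.comp_measurable (Patch.continuous_map K).measurable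
    have hc : Continuous fun w : V 𝕜 => ((K.jac • bdot w K.dualA, K.jac • bdot w K.dualB) : 𝕜 × 𝕜) :=
      ((continuous_bdot _).const_smul _).prodMk ((continuous_bdot _).const_smul _)
    exact hc.comp_stronglyMeasurable hm
  have hUm : StronglyMeasurable U := (continuous_aniso _ _).comp_stronglyMeasurable hpm
  have hUi : ∀ x, aniso h₁ h₂ (U x) = K.pull u x := fun x => by
    have := aniso_inv_aniso (inv_pos.2 p₁) (inv_pos.2 p₂) (K.pull u x)
    rwa [inv_inv, inv_inv] at this
  have hG := h.gagliardo_le hν v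
  have hGt : gagliardo K.shape.dom (scl h₁ h₂) U < ⊤ := hG.trans_lt (ENNReal.mul_lt_top
    (ENNReal.mul_lt_top (ENNReal.pow_ne_top ENNReal.ofReal_ne_top).lt_top
      (ENNReal.pow_ne_top ENNReal.ofReal_ne_top).lt_top) hfin)
  have hG' : gagliardo K.shape.dom id U < ⊤ := (gagliardo_id_le p₁ p₂ U).trans_lt
    (ENNReal.mul_lt_top (ENNReal.pow_ne_top ENNReal.ofReal_ne_top).lt_top hGt)
  have hden := lintegral_denWeight_aniso_lt_top p₁ p₂
    (lintegral_denWeight_enorm_lt_top K.shape hUm hG')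
  simp only [hUi] at hden
  have hwd : WeakDiv K.shape.dom (K.pull u) δ := by
    intro φ hφ hc hs
    have i1 := integrableOn_greenDensity (isEdgeFun_of_contDiff hφ hc) hpm hden 0
    have i2 : IntegrableOn (fun x => φ x • δ) K.shape.dom :=
      ((hφ.continuous.integrable_of_hasCompactSupport hc).integrableOn).smul_const δ
    have e : greenDensity φ (K.pull u) δ = fun x => greenDensity φ (K.pull u) 0 x + φ x • δ := by
      funext x; simp [greenDensity]
    rw [greenPairing, e, integral_add i1 i2, hδ φ hφ hc hs, neg_add_cancel]
  have hmain := hC h₁ h₂ U δ p₁ p₂ h.eq_of_triangle hUm hGt (by simpa only [hUi] using hwd)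
  simp only [hUi] at hmain
  set r := refInterp K.shape (K.pull u) fun _ => δ with hr
  have hpt : ∀ x, ‖u (K.map x) - K.push r (K.map x)‖ₑ ≤
      ENNReal.ofReal (2 * R * (h₁ * h₂) / K.jac) * ‖U x - aniso h₁⁻¹ h₂⁻¹ (r x)‖ₑ := by
    intro x
    have hpp : K.push (K.pull u) (K.map x) = u (K.map x) := Patch.push_pull h.jac_ne (ht _)
    rw [← hpp, Patch.push_sub]
    refine h.enorm_push_le (fun x => K.pull u x - r x) (fun x => U x - aniso h₁⁻¹ h₂⁻¹ (r x)) x ?_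
    have := aniso_inv_aniso (inv_pos.2 p₁) (inv_pos.2 p₂) (r x)
    rw [inv_inv, inv_inv] at this
    simp only [aniso_sub, hUi, this]
  calc _ ≤ ∫⁻ x in K.shape.dom, ENNReal.ofReal (2 * R * (h₁ * h₂) / K.jac) ^ 2 *
        ‖U x - aniso h₁⁻¹ h₂⁻¹ (r x)‖ₑ ^ 2 := by
        refine lintegral_mono fun x => ?_
        rw [← mul_pow]
        exact pow_le_pow_left' (hpt x) 2
    _ = ENNReal.ofReal (2 * R * (h₁ * h₂) / K.jac) ^ 2 *
        ∫⁻ x in K.shape.dom, ‖U x - aniso h₁⁻¹ h₂⁻¹ (r x)‖ₑ ^ 2 :=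
        lintegral_const_mul' _ _ (ENNReal.pow_ne_top ENNReal.ofReal_ne_top)
    _ ≤ _ := by
        refine mul_le_mul_right (hmain.trans ?_) _
        exact mul_le_mul_right (mul_le_mul_right hG _) _

end PatchSize

end GradedRT
end

/-! ### Element sizes, grading and summation over the mesh. -/

noncomputable section

namespace GradedRT
open scoped ENNReal NNReal
open PolyhedralSurface

variable {𝕜 : Type*} [RCLike 𝕜] {ι : Type*} [Fintype ι] {Γ : PolyhedralSurface ι}
  {β : ℝ} {N : ℕ} {o : Orientation}

/-! ### The size of the elements -/

theorem refBlock_abs_le (k : Fin 3) (τ : Bool) (S : Shape) :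
    (|(refBlock k τ S).2.1.1| ≤ 1 ∧ |(refBlock k τ S).2.1.2| ≤ 1) ∧
      |(refBlock k τ S).2.2.1| ≤ 1 ∧ |(refBlock k τ S).2.2.2| ≤ 1 := by
  cases S <;> cases τ <;> fin_cases k <;> refine ⟨⟨?_, ?_⟩, ?_, ?_⟩ <;> simp [refBlock, refVert] <;>
    norm_num

theorem norm_lin_le (F : Patch) {a : ℝ × ℝ} (h1 : |a.1| ≤ 1) (h2 : |a.2| ≤ 1) :
    ‖a.1 • F.a + a.2 • F.b‖ ≤ ‖F.a‖ + ‖F.b‖ := by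
  refine (norm_add_le _ _).trans ?_
  rw [norm_smul, norm_smul]
  exact add_le_add (mul_le_of_le_one_left (norm_nonneg _) h1)
    (mul_le_of_le_one_left (norm_nonneg _) h2)

theorem Patch.norm_sub_a_le (F : Patch) (S : Shape) (p a b : ℝ × ℝ) (h1 : |a.1| ≤ 1) (h2 : |a.2| ≤ 1) :
    ‖(F.sub S p a b).a‖ ≤ ‖F.a‖ + ‖F.b‖ := norm_lin_le F h1 h2

theorem Patch.norm_sub_b_le (F : Patch) (S : Shape) (p a b : ℝ × ℝ) (h1 : |b.1| ≤ 1) (h2 : |b.2| ≤ 1) :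
    ‖(F.sub S p a b).b‖ ≤ ‖F.a‖ + ‖F.b‖ := norm_lin_le F h1 h2

theorem norm_cellBlock_le {ι : Type*} (Γ : PolyhedralSurface ι) (o : Orientation) (c : Cell ι N) :
    ‖(cellBlock Γ o c).a‖ ≤ ‖(Γ.face c.1).a‖ + ‖(Γ.face c.1).b‖ ∧
      ‖(cellBlock Γ o c).b‖ ≤ ‖(Γ.face c.1).a‖ + ‖(Γ.face c.1).b‖ := by
  have hab := refBlock_abs_le c.2.1 (blockFlag Γ o c.1 c.2.1) (cellShape c)
  rw [cellBlock_eq]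
  exact ⟨Patch.norm_sub_a_le _ _ _ _ _ hab.1.1 hab.1.2,
    Patch.norm_sub_b_le _ _ _ _ _ hab.2.1 hab.2.2⟩

theorem exists_pos_forall_le (f : ι → ℝ) : ∃ R : ℝ, 0 < R ∧ ∀ i, f i ≤ R := by
  obtain ⟨M, hM⟩ := (Set.finite_range f).bddAbove
  exact ⟨max M 1, lt_max_of_lt_right one_pos, fun i => le_max_of_le_left (hM ⟨i, rfl⟩)⟩

/-- Only finitely many faces occur, and up to the two steps an element is a block of a face; hence R
and D depend on Γ alone. -/
theorem exists_patchSize (Γ : PolyhedralSurface ι) : ∃ R D : ℝ, 0 < R ∧ 0 < D ∧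
    ∀ (β : ℝ) (N : ℕ) (o : Orientation), 1 ≤ β → 1 ≤ N → ∀ c : Cell ι N,
      PatchSize (Γ.element β N o c) R (step β N (cellFst c)) (step β N (cellSnd c)) ∧
      step β N (cellFst c) * step β N (cellSnd c) ≤ D * (Γ.element β N o c).jac := by
  obtain ⟨R, hR, hr⟩ := exists_pos_forall_le fun i => ‖(Γ.face i).a‖ + ‖(Γ.face i).b‖
  -- The 9 is there because each block has one ninth of the Jacobian of its face.
  obtain ⟨D, hD, hd⟩ := exists_pos_forall_le fun i => 9 * (Γ.face i).jac⁻¹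
  refine ⟨R, D, hR, hD, fun β N o hβ hN c => ⟨?_, ?_⟩⟩
  · have p₁ := step_pos hβ hN (cellFst c)
    have p₂ := step_pos hβ hN (cellSnd c)
    obtain ⟨ha, hb⟩ := norm_cellBlock_le Γ o c
    have hJ := (isSub_element (Γ := Γ) (o := o) hβ hN c).jac_ne
    rw [element_eq] at hJ ⊢
    refine PatchSize.mk hJ hR p₁ p₂ ?_ ?_ ?_
    · change ‖step β N (cellFst c) • (cellBlock Γ o c).a‖ ≤ _
      rw [norm_smul, Real.norm_of_nonneg p₁.le]
      exact mul_le_mul_of_nonneg_left (ha.trans (hr c.1)) p₁.le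
    · change ‖step β N (cellSnd c) • (cellBlock Γ o c).b‖ ≤ _
      rw [norm_smul, Real.norm_of_nonneg p₂.le]
      exact mul_le_mul_of_nonneg_left (hb.trans (hr c.1)) p₂.le
    · intro hs
      by_contra hne
      have hij : cellFst c ≠ cellSnd c := fun h => hne (by rw [h])
      rcases hB : (cellBlock Γ o c).shape with _ | _ <;> simp [cellPatch, hB, hij] at hs
  · rw [element_eq, cellPatch_jac hβ hN, cellBlock_jac]
    have p := mul_pos (step_pos hβ hN (cellFst c)) (step_pos hβ hN (cellSnd c))
    have hJ := Patch.jac_pos (Γ.face_jac_ne c.1)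
    have h1 : 1 ≤ D * (1 / 9 * (Γ.face c.1).jac) := by
      have := mul_le_mul_of_nonneg_right (hd c.1) (by positivity : 0 ≤ 1 / 9 * (Γ.face c.1).jac)
      refine le_trans (le_of_eq ?_) this
      field_simp
    nlinarith

/-- The origin of the convergence rate. If s is the longer and t the other step, then s² ≤ β²h² =
β²h^{2−β}h^β ≤ β²h^{2−β}t, by the upper bound for the one step and the lower bound for the other. -/
theorem max_step_le (hβ : 1 ≤ β) (hN : 1 ≤ N) {i j : ℕ} (hi : i < N) (hj : j < N) :
    max (step β N i) (step β N j) ^ 3 ≤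
      β ^ 2 * (1 / (N : ℝ)) ^ (2 - β) * (step β N i * step β N j) := by
  have hN' : (0 : ℝ) < 1 / N := by positivity
  have hpow : (1 / (N : ℝ)) ^ (2 - β) * (1 / (N : ℝ)) ^ β = (1 / (N : ℝ)) ^ 2 := by
    rw [← Real.rpow_add hN', sub_add_cancel]; norm_cast
  have key : ∀ s t : ℝ, 0 < s → s ≤ β * (1 / (N : ℝ)) → (1 / (N : ℝ)) ^ β ≤ t →
      s ^ 3 ≤ β ^ 2 * (1 / (N : ℝ)) ^ (2 - β) * (s * t) := by
    intro s t hs h1 h2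
    have h3 : s ^ 2 ≤ (β * (1 / (N : ℝ))) ^ 2 := pow_le_pow_left₀ hs.le h1 2
    have h4 : (β * (1 / (N : ℝ))) ^ 2 ≤ β ^ 2 * (1 / (N : ℝ)) ^ (2 - β) * t := by
      rw [mul_pow, ← hpow, ← mul_assoc]
      exact mul_le_mul_of_nonneg_left h2 (by positivity)
    calc s ^ 3 = s ^ 2 * s := by ring
      _ ≤ (β ^ 2 * (1 / (N : ℝ)) ^ (2 - β) * t) * s :=
          mul_le_mul_of_nonneg_right (h3.trans h4) hs.le
      _ = _ := by ring
  rcases max_cases (step β N i) (step β N j) with ⟨h, _⟩ | ⟨h, _⟩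
  · rw [h]; exact key _ _ (step_pos hβ hN i) (step_le hβ hN hi) (le_step hβ j)
  · rw [h, mul_comm (step β N i)]
    exact key _ _ (step_pos hβ hN j) (step_le hβ hN hj) (le_step hβ i)

/-! ### The interpolation error on an element -/

theorem rtInterp_map (hβ : 1 ≤ β) (hN : 1 ≤ N) (u : E3 → V 𝕜) (c : Cell ι N) {y : E3}
    (hy : y ∈ (Γ.element β N o c).carrier) : Γ.rtInterp β N o u y =
      (Γ.element β N o c).push (refInterp (Γ.element β N o c).shape ((Γ.element β N o c).pull u)
        fun x => (Γ.element β N o c).jac • Γ.surfDiv u ((Γ.element β N o c).map x)) y := by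
  rw [rtInterp, Finset.sum_eq_single c, indicator_of_mem hy]
  · intro d _ hd
    exact indicator_of_notMem (fun h => (disjoint_element hβ hN hd).le_bot ⟨h, hy⟩) _
  · simp

theorem lintegral_carrier {i : ι} {K : Patch} (hK : IsSub K (Γ.face i)) (g : E3 → ℝ≥0∞) :
    ∫⁻ y in K.carrier, g y ∂Γ.surfMeasure =
      ENNReal.ofReal K.jac * ∫⁻ x in K.shape.dom, g (K.map x) := by
  rw [Γ.surfMeasure_restrict hK, Patch.lintegral_surfMeasure hK.jac_ne]

theorem seminorm_carrier {i : ι} {K : Patch} (hK : IsSub K (Γ.face i)) (v : E3 → V 𝕜) :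
    ∫⁻ x in K.carrier, ∫⁻ y in K.carrier, ‖v x - v y‖ₑ ^ 2 / edist x y ^ 3
      ∂Γ.surfMeasure ∂Γ.surfMeasure = ENNReal.ofReal (K.jac ^ 2) * patchSeminorm K v := by
  rw [lintegral_carrier hK]
  simp only [lintegral_carrier hK]
  rw [lintegral_const_mul' _ _ ENNReal.ofReal_ne_top, ← mul_assoc,
    ← ENNReal.ofReal_mul (Patch.jac_nonneg K), ← sq]
  rfl

theorem lintegral_element_le {C : ℝ≥0} (hC : ∀ S, InterpBound 𝕜 S C) (hβ : 1 ≤ β) (hN : 1 ≤ N)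
    {u v : E3 → V 𝕜} (hv : StronglyMeasurable v) (huv : Γ.IsRotatedTangential v u)
    (hu : Γ.HasDiscreteDiv β N o u) (c : Cell ι N) {R h₁ h₂ : ℝ}
    (hs : PatchSize (Γ.element β N o c) R h₁ h₂)
    (hfin : patchSeminorm (Γ.element β N o c) v < ⊤) :
    ∫⁻ y in (Γ.element β N o c).carrier, ‖u y - Γ.rtInterp β N o u y‖ₑ ^ 2 ∂Γ.surfMeasure ≤
      ENNReal.ofReal (Γ.element β N o c).jac *
      (ENNReal.ofReal (2 * R * (h₁ * h₂) / (Γ.element β N o c).jac) ^ 2 *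
      (C * (ENNReal.ofReal (max h₁ h₂) ^ 3 * (ENNReal.ofReal (108 * R) ^ 2 *
      ENNReal.ofReal (2 * R) ^ 3 * patchSeminorm (Γ.element β N o c) v)))) := by
  have hK := isSub_element (Γ := Γ) (o := o) hβ hN c
  have hrt := fun {y} => rtInterp_map (Γ := Γ) (o := o) hβ hN u c (y := y)
  obtain ⟨δ, hδ, hdiv⟩ := exists_elementwise_div hβ hN hu c
  set K := Γ.element β N o c with hKd
  have hν := Γ.normal_norm c.1
  set ν := Γ.normal c.1 with hνd
  have ht : ∀ y, bdot (cross (v y) (toV 𝕜 ν)) K.nrm = 0 := fun y => by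
    obtain ⟨r, -, hr⟩ := hK.nrm_eq
    have h0 : bdot (cross (v y) (toV 𝕜 ν)) (Γ.face c.1).nrm = 0 :=
      bdot_cross_normal hν (Γ.normal_orth c.1 1 0) (Γ.normal_orth c.1 2 1) _
    rw [hr, bdot_smul_right, h0, smul_zero]
  have hae : ∀ᵐ x ∂volume.restrict K.shape.dom, u (K.map x) = cross (v (K.map x)) (toV 𝕜 ν) := by
    rw [← Patch.ae_surfMeasure_iff hK.jac_ne (fun y => u y = cross (v y) (toV 𝕜 ν)), hK.surf_eq]
    exact ae_restrict_of_ae (huv c.1)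
  have hpull : ∀ᵐ x ∂volume.restrict K.shape.dom,
      K.pull u x = K.pull (fun y => cross (v y) (toV 𝕜 ν)) x :=
    hae.mono fun x hx => by simp only [Patch.pull, hx]
  have hδ' : ∀ φ : ℝ × ℝ → ℝ, ContDiff ℝ ∞ φ → HasCompactSupport φ → tsupport φ ⊆ K.shape.dom →
      ∫ x in K.shape.dom, greenDensity φ (K.pull fun y => cross (v y) (toV 𝕜 ν)) 0 x =
        -∫ x in K.shape.dom, φ x • δ := fun φ hφ hc hsupp => by
    rw [← hδ φ hφ hc hsupp]
    refine integral_congr_ae (hpull.mono fun x hx => ?_)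
    simp only [greenDensity, hx]
  rw [lintegral_carrier hK]
  refine mul_le_mul_right (le_trans (le_of_eq ?_)
    (hs.lintegral_error_le (hC _) hν hv ht hfin hδ')) _
  refine lintegral_congr_ae ?_
  filter_upwards [hae, ae_restrict_mem (measurableSet_dom _)] with x hx hxd
  rw [hrt (mem_image_of_mem _ hxd), hx, refInterp_congr_ae hpull hdiv]

theorem ofReal_mul_chain {a b c d e f : ℝ} (ha : 0 ≤ a) (hb : 0 ≤ b) (hc : 0 ≤ c) (hd : 0 ≤ d)
    (he : 0 ≤ e) (hf : 0 ≤ f) (X : ℝ≥0∞) :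
    ENNReal.ofReal a * (ENNReal.ofReal b ^ 2 * (ENNReal.ofReal c * (ENNReal.ofReal d ^ 3 *
      (ENNReal.ofReal e ^ 2 * ENNReal.ofReal f ^ 3 * X)))) =
    ENNReal.ofReal (a * (b ^ 2 * (c * (d ^ 3 * (e ^ 2 * f ^ 3))))) * X := by
  rw [ENNReal.ofReal_mul ha, ENNReal.ofReal_mul (by positivity), ENNReal.ofReal_mul hc,
    ENNReal.ofReal_mul (by positivity), ENNReal.ofReal_mul (by positivity), ENNReal.ofReal_pow hb,
    ENNReal.ofReal_pow hd, ENNReal.ofReal_pow he, ENNReal.ofReal_pow hf]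
  ring

/-- With J = jac comparable to h₁h₂, the error integral is at most of order J · max(h₁,h₂)³ times
the parametrised seminorm, and the latter is the surface seminorm divided by J². What remains is
max(h₁,h₂)³/(h₁h₂), to which the grading estimate applies. -/
theorem exists_element_estimate (𝕜 : Type*) [RCLike 𝕜] (Γ : PolyhedralSurface ι) (hβ : 1 ≤ β) :
    ∃ C : ℝ, 0 < C ∧ ∀ (N : ℕ) (o : Orientation) (u v : E3 → V 𝕜), 1 ≤ N → StronglyMeasurable v →
      Γ.IsRotatedTangential v u → Γ.HasDiscreteDiv β N o u → ∀ c : Cell ι N,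
      ∫⁻ x in (Γ.element β N o c).carrier, ∫⁻ y in (Γ.element β N o c).carrier,
        ‖v x - v y‖ₑ ^ 2 / edist x y ^ 3 ∂Γ.surfMeasure ∂Γ.surfMeasure < ⊤ →
      ∫⁻ y in (Γ.element β N o c).carrier, ‖u y - Γ.rtInterp β N o u y‖ₑ ^ 2 ∂Γ.surfMeasure ≤
        ENNReal.ofReal (C * (1 / (N : ℝ)) ^ (2 - β)) *
        ∫⁻ x in (Γ.element β N o c).carrier, ∫⁻ y in (Γ.element β N o c).carrier,
          ‖v x - v y‖ₑ ^ 2 / edist x y ^ 3 ∂Γ.surfMeasure ∂Γ.surfMeasure := by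
  obtain ⟨C, hC⟩ := exists_interpBound 𝕜
  obtain ⟨R, D, hR, hD, hsize⟩ := exists_patchSize Γ
  -- The summand 1 in C + 1 keeps the constant positive when C = 0.
  refine ⟨4 * R ^ 2 * (108 * R) ^ 2 * (2 * R) ^ 3 * (C + 1) * D ^ 3 * β ^ 2, by positivity,
    fun N o u v hN hv huv hu c hfin => ?_⟩
  have hK := isSub_element (Γ := Γ) (o := o) hβ hN c
  obtain ⟨hs, hj⟩ := hsize β N o hβ hN c
  have hmax := max_step_le hβ hN (cellFst_lt c) (cellSnd_lt c)
  set K := Γ.element β N o c with hKd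
  set h₁ := step β N (cellFst c)
  set h₂ := step β N (cellSnd c)
  have p := mul_pos hs.pos₁ hs.pos₂
  have hJ := Patch.jac_pos hK.jac_ne
  have hJ2 : ENNReal.ofReal (K.jac ^ 2) ≠ 0 := by
    rw [ne_eq, ENNReal.ofReal_eq_zero, not_le]; positivity
  rw [seminorm_carrier hK] at hfin ⊢
  have hfin' : patchSeminorm K v < ⊤ := by
    rw [lt_top_iff_ne_top]
    intro h
    rw [h, ENNReal.mul_top hJ2] at hfin
    exact lt_irrefl _ hfin
  refine (lintegral_element_le hC hβ hN hv huv hu c hs hfin').trans ?_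
  have m0 : 0 ≤ max h₁ h₂ := hs.pos₁.le.trans (le_max_left _ _)
  have hreal : K.jac * ((2 * R * (h₁ * h₂) / K.jac) ^ 2 * ((C + 1) * (max h₁ h₂ ^ 3 *
      ((108 * R) ^ 2 * (2 * R) ^ 3)))) ≤ 4 * R ^ 2 * (108 * R) ^ 2 * (2 * R) ^ 3 * (C + 1) * D ^ 3 *
      β ^ 2 * (1 / (N : ℝ)) ^ (2 - β) * K.jac ^ 2 := by
    set M := β ^ 2 * (1 / (N : ℝ)) ^ (2 - β) with hM
    have M0 : 0 ≤ M := by positivity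
    have h1 : (h₁ * h₂) ^ 2 * max h₁ h₂ ^ 3 ≤ M * (D * K.jac) ^ 3 := by
      calc (h₁ * h₂) ^ 2 * max h₁ h₂ ^ 3 ≤ (h₁ * h₂) ^ 2 * (M * (h₁ * h₂)) :=
            mul_le_mul_of_nonneg_left hmax (by positivity)
        _ = M * (h₁ * h₂) ^ 3 := by ring
        _ ≤ _ := mul_le_mul_of_nonneg_left (pow_le_pow_left₀ p.le hj 3) M0
    have e1 : K.jac * ((2 * R * (h₁ * h₂) / K.jac) ^ 2 * ((C + 1) * (max h₁ h₂ ^ 3 *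
        ((108 * R) ^ 2 * (2 * R) ^ 3)))) = 4 * R ^ 2 * (108 * R) ^ 2 * (2 * R) ^ 3 * (C + 1) *
        ((h₁ * h₂) ^ 2 * max h₁ h₂ ^ 3) / K.jac := by
      field_simp; ring
    rw [e1, div_le_iff₀ hJ]
    calc _ ≤ 4 * R ^ 2 * (108 * R) ^ 2 * (2 * R) ^ 3 * (C + 1) * (M * (D * K.jac) ^ 3) :=
          mul_le_mul_of_nonneg_left h1 (by positivity)
      _ = _ := by rw [hM]; ring
  have hCle : (C : ℝ≥0∞) ≤ ENNReal.ofReal (C + 1) := by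
    rw [← ENNReal.ofReal_coe_nnreal]; exact ENNReal.ofReal_le_ofReal (by linarith)
  have hb : (0 : ℝ) ≤ 2 * R * (h₁ * h₂) / K.jac := by positivity
  calc _ ≤ ENNReal.ofReal K.jac * (ENNReal.ofReal (2 * R * (h₁ * h₂) / K.jac) ^ 2 *
        (ENNReal.ofReal (C + 1) * (ENNReal.ofReal (max h₁ h₂) ^ 3 * (ENNReal.ofReal (108 * R) ^ 2 *
        ENNReal.ofReal (2 * R) ^ 3 * patchSeminorm K v)))) := by
        refine mul_le_mul_right (mul_le_mul_right (mul_le_mul_left hCle _) _) _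
    _ = ENNReal.ofReal (K.jac * ((2 * R * (h₁ * h₂) / K.jac) ^ 2 * ((C + 1) * (max h₁ h₂ ^ 3 *
        ((108 * R) ^ 2 * (2 * R) ^ 3))))) * patchSeminorm K v := by
        have hR2 : 0 ≤ 2 * R := by positivity
        have hR108 : 0 ≤ 108 * R := by positivity
        exact ofReal_mul_chain hJ.le hb (by positivity) m0 hR108 hR2 _
    _ ≤ _ := by
        rw [← mul_assoc (ENNReal.ofReal _) (ENNReal.ofReal _), ← ENNReal.ofReal_mul (by positivity)]
        exact mul_le_mul_left (ENNReal.ofReal_le_ofReal hreal) _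

/-! ### Summation over the elements -/

/-- The H^{1/2} seminorm is superadditive over disjoint pieces: the contributions of pairs of points
in different elements are nonnegative and can be dropped. -/
theorem lintegral_error_le (hβ : 1 ≤ β) (hN : 1 ≤ N) {u v : E3 → V 𝕜} {A : ℝ≥0∞}
    (h : ∀ c : Cell ι N, ∫⁻ y in (Γ.element β N o c).carrier,
        ‖u y - Γ.rtInterp β N o u y‖ₑ ^ 2 ∂Γ.surfMeasure ≤
        A * ∫⁻ x in (Γ.element β N o c).carrier, ∫⁻ y in (Γ.element β N o c).carrier,
          ‖v x - v y‖ₑ ^ 2 / edist x y ^ 3 ∂Γ.surfMeasure ∂Γ.surfMeasure) :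
    ∫⁻ y, ‖u y - Γ.rtInterp β N o u y‖ₑ ^ 2 ∂Γ.surfMeasure ≤
      A * ∫⁻ x, ∫⁻ y, ‖v x - v y‖ₑ ^ 2 / edist x y ^ 3 ∂Γ.surfMeasure ∂Γ.surfMeasure := by
  have hm : ∀ c : Cell ι N, MeasurableSet (Γ.element β N o c).carrier := fun c =>
    Patch.measurableSet_carrier (isSub_element hβ hN c).jac_ne
  have hd : Pairwise (Function.onFun Disjoint fun c : Cell ι N => (Γ.element β N o c).carrier) :=
    fun c d hcd => disjoint_element hβ hN hcd
  have hcov : ∀ᵐ y ∂Γ.surfMeasure, y ∈ ⋃ c : Cell ι N, (Γ.element β N o c).carrier :=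
    (ae_exists_element hβ hN).mono fun y hy => mem_iUnion.2 hy
  have hsplit : ∀ g : E3 → ℝ≥0∞, ∫⁻ y, g y ∂Γ.surfMeasure =
      ∑ c : Cell ι N, ∫⁻ y in (Γ.element β N o c).carrier, g y ∂Γ.surfMeasure := fun g => by
    rw [← tsum_fintype (L := SummationFilter.unconditional _), ← lintegral_iUnion hm hd,
      Measure.restrict_eq_self_of_ae_mem hcov]
  rw [hsplit, hsplit, Finset.mul_sum]
  exact Finset.sum_le_sum fun c _ => (h c).trans
    (mul_le_mul_right (lintegral_mono fun x => setLIntegral_le_lintegral _ _) _)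

theorem halfNorm_congr {v w : E3 → V 𝕜} (h : v =ᵐ[Γ.surfMeasure] w) :
    Γ.halfNorm v = Γ.halfNorm w := by
  have h1 : ∫⁻ x, ‖v x‖ₑ ^ 2 ∂Γ.surfMeasure = ∫⁻ x, ‖w x‖ₑ ^ 2 ∂Γ.surfMeasure :=
    lintegral_congr_ae (h.mono fun x hx => by simp only [hx])
  have h2 : ∫⁻ x, ∫⁻ y, ‖v x - v y‖ₑ ^ 2 / edist x y ^ 3 ∂Γ.surfMeasure ∂Γ.surfMeasure =
      ∫⁻ x, ∫⁻ y, ‖w x - w y‖ₑ ^ 2 / edist x y ^ 3 ∂Γ.surfMeasure ∂Γ.surfMeasure :=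
    lintegral_congr_ae (h.mono fun x hx => lintegral_congr_ae (h.mono fun y hy => by
      simp only [hx, hy]))
  rw [halfNorm, halfNorm, h1, h2]

theorem eLpNorm_error_le {C : ℝ} (hC0 : 0 < C) (hβ : 1 ≤ β) (hN : 1 ≤ N)
    (hC : ∀ (u v : E3 → V 𝕜), StronglyMeasurable v →
      Γ.IsRotatedTangential v u → Γ.HasDiscreteDiv β N o u → ∀ c : Cell ι N,
      ∫⁻ x in (Γ.element β N o c).carrier, ∫⁻ y in (Γ.element β N o c).carrier,
        ‖v x - v y‖ₑ ^ 2 / edist x y ^ 3 ∂Γ.surfMeasure ∂Γ.surfMeasure < ⊤ →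
      ∫⁻ y in (Γ.element β N o c).carrier, ‖u y - Γ.rtInterp β N o u y‖ₑ ^ 2 ∂Γ.surfMeasure ≤
        ENNReal.ofReal (C * (1 / (N : ℝ)) ^ (2 - β)) *
        ∫⁻ x in (Γ.element β N o c).carrier, ∫⁻ y in (Γ.element β N o c).carrier,
          ‖v x - v y‖ₑ ^ 2 / edist x y ^ 3 ∂Γ.surfMeasure ∂Γ.surfMeasure)
    {u v : E3 → V 𝕜} (hv : AEStronglyMeasurable v Γ.surfMeasure) (huv : Γ.IsRotatedTangential v u)
    (hu : Γ.HasDiscreteDiv β N o u) :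
    eLpNorm (fun x => u x - Γ.rtInterp β N o u x) 2 Γ.surfMeasure ≤
      ENNReal.ofReal (√C * (1 / (N : ℝ)) ^ (1 - β / 2)) * Γ.halfNorm v := by
  have hN' : (0 : ℝ) < 1 / N := by positivity
  have hcpos : 0 < √C * (1 / (N : ℝ)) ^ (1 - β / 2) :=
    mul_pos (Real.sqrt_pos.2 hC0) (Real.rpow_pos_of_pos hN' _)
  -- A positive factor times ⊤ is ⊤, so this case is trivial.
  by_cases htop : Γ.halfNorm v = ⊤
  · rw [htop, ENNReal.mul_top (ENNReal.ofReal_pos.2 hcpos).ne']; exact le_top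
  -- The element estimate needs a genuinely strongly measurable field; a representative has the same
  -- norm and the same rotated tangential trace almost everywhere.
  set w := hv.mk v with hw
  have hvw : v =ᵐ[Γ.surfMeasure] w := hv.ae_eq_mk
  have huw : Γ.IsRotatedTangential w u := fun i => by
    filter_upwards [huv i, Γ.ae_surfMeasure_iff.1 hvw i] with x h1 h2
    rw [h1, h2]
  rw [halfNorm_congr hvw] at htop ⊢
  set G := ∫⁻ x, ∫⁻ y, ‖w x - w y‖ₑ ^ 2 / edist x y ^ 3 ∂Γ.surfMeasure ∂Γ.surfMeasure with hG
  have hGn : G ^ (1 / 2 : ℝ) ≤ Γ.halfNorm w := ENNReal.rpow_le_rpow le_add_self (by norm_num)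
  have hGt : G < ⊤ := by
    have := hGn.trans_lt (lt_top_iff_ne_top.2 htop)
    rw [lt_top_iff_ne_top]
    intro h
    rw [h, ENNReal.top_rpow_of_pos (by norm_num)] at this
    exact lt_irrefl _ this
  have hsum := lintegral_error_le hβ hN fun c => hC u w hv.stronglyMeasurable_mk huw hu c
    (lt_of_le_of_lt ((lintegral_mono fun x => setLIntegral_le_lintegral _ _).trans
      (setLIntegral_le_lintegral _ _)) hGt)
  have hpow : (1 / (N : ℝ)) ^ (2 - β) = ((1 / (N : ℝ)) ^ (1 - β / 2)) ^ 2 := by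
    rw [← Real.rpow_natCast, ← Real.rpow_mul hN'.le]; congr 1; push_cast; ring
  have hsq : ENNReal.ofReal (C * (1 / (N : ℝ)) ^ (2 - β)) =
      ENNReal.ofReal (√C * (1 / (N : ℝ)) ^ (1 - β / 2)) ^ 2 := by
    rw [← ENNReal.ofReal_pow hcpos.le, mul_pow, Real.sq_sqrt hC0.le, hpow]
  rw [hsq] at hsum
  have hL : eLpNorm (fun x => u x - Γ.rtInterp β N o u x) 2 Γ.surfMeasure ^ 2 =
      ∫⁻ y, ‖u y - Γ.rtInterp β N o u y‖ₑ ^ 2 ∂Γ.surfMeasure := by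
    rw [eLpNorm_eq_lintegral_rpow_enorm_toReal (by norm_num) (by norm_num), ← ENNReal.rpow_natCast,
      ← ENNReal.rpow_mul]
    norm_num
  rw [← hL] at hsum
  exact (le_ofReal_mul_rpow_half hsum).trans (mul_le_mul_right hGn _)

end GradedRT
end

theorem lemma5p4 (𝕜 : Type*) [RCLike 𝕜] {ι : Type*} [Fintype ι]
    (Γ : GradedRT.PolyhedralSurface ι) (β : ℝ) (hβ : 1 ≤ β) :
    ∃ C : ℝ, 0 < C ∧
      ∀ (N : ℕ) (_ : 1 ≤ N) (h : ℝ) (_ : h = 1 / (N : ℝ))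
        (o : GradedRT.PolyhedralSurface.Orientation)
        (u : GradedRT.E3 → GradedRT.V 𝕜),
        Γ.MemHalfPerp u → Γ.HasDiscreteDiv β N o u →
          MeasureTheory.eLpNorm (fun x => u x - Γ.rtInterp β N o u x) 2 Γ.surfMeasure
            ≤ ENNReal.ofReal (C * h ^ (1 - β / 2)) * Γ.halfPerpNorm u := by
  obtain ⟨C, hC0, hC⟩ := GradedRT.exists_element_estimate 𝕜 Γ hβ
  refine ⟨√C, Real.sqrt_pos.2 hC0, fun N hN h hh o u _ hu => ?_⟩
  subst hh
  have hpos : 0 < √C * (1 / (N : ℝ)) ^ (1 - β / 2) := by positivity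
  have h0 : ENNReal.ofReal (√C * (1 / (N : ℝ)) ^ (1 - β / 2)) ≠ 0 :=
    (ENNReal.ofReal_pos.2 hpos).ne'
  -- A finite positive factor may be taken inside both infima, so it suffices to treat each
  -- admissible v separately.
  rw [GradedRT.PolyhedralSurface.halfPerpNorm, ENNReal.mul_iInf_of_ne h0 ENNReal.ofReal_ne_top]
  refine le_iInf fun v => ?_
  rw [ENNReal.mul_iInf_of_ne h0 ENNReal.ofReal_ne_top]
  exact le_iInf fun hv => GradedRT.eLpNorm_error_le hC0 hβ hN
    (fun u v => hC N o u v hN) hv.1 hv.2 hu
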